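/- Let $d,k$ be natural numbers, $c\in[0,\tfrac12)$, $\alpha>1$ and $\varepsilon\ge 0$ real. For probability measures $P,Q$ on the same measurable space, let $R_\alpha(P,Q)=\frac1{\alpha-1}\log\int \left(\frac{dP}{dQ}\right)^{\alpha}dQ\in[0,\infty]$ be the Rényi divergence of order $\alpha$, with $R_\alpha(P,Q)=\infty$ if $P$ is not absolutely continuous with respect to $Q$. For $x\in[0,1]^d$ let $\mathrm{Bern}(x)$ be the law of $d$ independent coin flips with biases $x_1,\dots,x_d$, i.e. $\Pr[\mathrm{Bern}(x)=(b_1,\dots,b_d)]=\prod_{i=1}^d x_i^{b_i}(1-x_i)^{1-b_i}$ for $b\in\{0,1\}^d$, and let $\mathrm{Bern}_k(x)$ be the law of $k$ independent runs of $\mathrm{Bern}(x)$. For a probability measure $P$ on $[0,1]^d$ let $\mathrm{Bern}_k(P)$ be the law, on $(\{0,1\}^d)^k$, obtained by drawing $x\sim P$ once and then drawing from $\mathrm{Bern}_k(x)$. Let $\sim$ be a symmetric relation on a set of databases such that $D\sim D'$ for at least one pair $D\ne D'$. A randomized algorithm $A$ with range in $\Theta$ assigns to each database $D$ a probability measure $A(D)$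 on $\Theta$; put $\varepsilon_A(\alpha)=\sup_{D\sim D'}R_\alpha(A(D),A(D'))$, and write $\mathrm{Bern}_k(A)$ for the algorithm $D\mapsto \mathrm{Bern}_k(A(D))$. For a set $\mathcal A$ of algorithms with range in $[0,1]^d$ put $$\mathrm{Post}_{\mathcal A,\alpha,k}(\varepsilon)=\sup_{A\in\mathcal A,\ \varepsilon_A(\alpha)\le\varepsilon}\ \varepsilon_{\mathrm{Bern}_k(A)}(\alpha).$$ Let $\mathcal A$ be the set of all algorithms with output in $[c,1-c]^d$, and let $\mathcal C_d$ be the set of probability measures supported on $\{c,1-c\}^d$. Then $$\mathrm{Post}_{\mathcal A,\alpha,k}(\varepsilon)=\sup_{\substack{P,Q\in\mathcal C_d\\ R_\alpha(P,Q)\le\varepsilon,\ R_\alpha(Q,P)\le\varepsilon}} R_\alpha(\mathrm{Bern}_k(P),\mathrm{Bern}_k(Q)).$$ -/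

import Mathlib

open MeasureTheory ProbabilityTheory
open scoped ENNReal

noncomputable section

namespace BernPost

/-- The parameter space `[0,1]^d`. -/
abbrev Cube (d : ℕ) : Type := Fin d → unitInterval

open Classical in
/-- The Rényi divergence of order `α > 1`: it is `(α - 1)⁻¹ log ∫ (dP/dQ)^α dQ` when `P` is absolutely
continuous with respect to `Q`, and `∞` otherwise. -/
def renyiDiv {X : Type*} [MeasurableSpace X] (α : ℝ) (P Q : ProbabilityMeasure X) : EReal :=
  if (P : Measure X) ≪ (Q : Measure X) then
    (((α - 1)⁻¹ : ℝ) : EReal) *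
      ENNReal.log (∫⁻ x, ((P : Measure X).rnDeriv (Q : Measure X) x) ^ α ∂(Q : Measure X))
  else ⊤

/-- The law of `d` independent coin flips with biases `x 0, …, x (d - 1)`. -/
def bern {d : ℕ} (x : Cube d) : Measure (Fin d → Bool) :=
  Measure.pi fun i => bernoulliMeasure true false (x i)

instance {d : ℕ} (x : Cube d) : IsProbabilityMeasure (bern x) := by
  unfold bern; infer_instance

theorem bern_singleton {d : ℕ} (x : Cube d) (b : Fin d → Bool) :
    bern x {b} = ∏ i, if b i then ENNReal.ofReal (x i) else ENNReal.ofReal (1 - x i) := by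
  unfold bern
  rw [Measure.pi_singleton]
  refine Finset.prod_congr rfl fun i _ => ?_
  rw [bernoulliMeasure_apply _ (MeasurableSet.singleton _)]
  cases b i
  · simp only [Set.mem_singleton_iff, Bool.true_eq_false, if_true, if_false, Bool.false_eq_true]
    exact (ENNReal.ofReal_eq_coe_nnreal (unitInterval.symm (x i)).2.1).symm
  · simp only [Set.mem_singleton_iff, Bool.false_eq_true, if_true, if_false]
    exact (ENNReal.ofReal_eq_coe_nnreal (x i).2.1).symm

/-- The law of `k` independent runs of `bern x`. -/
def bernRuns {d : ℕ} (k : ℕ) (x : Cube d) : Measure (Fin k → Fin d → Bool) :=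
  Measure.pi fun _ => bern x

instance {d : ℕ} (k : ℕ) (x : Cube d) : IsProbabilityMeasure (bernRuns k x) := by
  unfold bernRuns; infer_instance

theorem measurable_bernRuns (d k : ℕ) : Measurable (bernRuns k : Cube d → _) := by
  refine Measure.measurable_of_measurable_coe _ fun s _ => ?_
  have h : ∀ x : Cube d, bernRuns k x s = ∑ b ∈ s.toFinite.toFinset,
      ∏ j, ∏ i, if b j i then ENNReal.ofReal (x i) else ENNReal.ofReal (1 - x i) := by
    intro x
    conv_lhs => rw [← s.toFinite.coe_toFinset, ← sum_measure_singleton]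
    refine Finset.sum_congr rfl fun b _ => ?_
    unfold bernRuns
    rw [Measure.pi_singleton]
    exact Finset.prod_congr rfl fun j _ => bern_singleton x (b j)
  simp_rw [h]
  refine Finset.measurable_sum _ fun b _ => Finset.measurable_prod _ fun j _ =>
    Finset.measurable_prod _ fun i _ => ?_
  split_ifs
  · exact ENNReal.measurable_ofReal.comp (measurable_subtype_coe.comp (measurable_pi_apply i))
  · exact ENNReal.measurable_ofReal.comp
      (measurable_const.sub (measurable_subtype_coe.comp (measurable_pi_apply i)))

/-- `x ↦ Bern_k(x)` as a Markov kernel. -/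
def bernKernel (d k : ℕ) : Kernel (Cube d) (Fin k → Fin d → Bool) where
  toFun := bernRuns k
  measurable' := measurable_bernRuns d k

instance (d k : ℕ) : IsMarkovKernel (bernKernel d k) :=
  ⟨fun x => inferInstanceAs (IsProbabilityMeasure (bernRuns k x))⟩

/-- `Bern_k(P)`: draw a single `x ∼ P`, then release `k` independent runs of `Bern(x)`. -/
def bernProcess {d : ℕ} (k : ℕ) (P : ProbabilityMeasure (Cube d)) :
    ProbabilityMeasure (Fin k → Fin d → Bool) :=
  ⟨(P : Measure (Cube d)).bind (bernKernel d k), inferInstance⟩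

/-- A randomized algorithm: it sends each database to the law of its output in `Θ`. -/
abbrev Algorithm (DB : Type*) (Θ : Type*) [MeasurableSpace Θ] := DB → ProbabilityMeasure Θ

/-- `ε_A(α)`: the supremum of the Rényi divergence over neighboring databases. -/
def rdpLevel {DB Θ : Type*} [MeasurableSpace Θ] (Adj : DB → DB → Prop) (α : ℝ)
    (A : Algorithm DB Θ) : EReal :=
  ⨆ (D : DB) (D' : DB) (_ : Adj D D'), renyiDiv α (A D) (A D')

/-- The Bernoulli post-processing amplification function of a family `𝒜` of algorithms. -/
def post {DB : Type*} {d : ℕ} (Adj : DB → DB → Prop) (𝒜 : Set (Algorithm DB (Cube d)))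
    (α : ℝ) (k : ℕ) (ε : ℝ) : EReal :=
  ⨆ (A : Algorithm DB (Cube d)) (_ : A ∈ 𝒜 ∧ rdpLevel Adj α A ≤ (ε : EReal)),
    rdpLevel Adj α fun D => bernProcess k (A D)

/-- All algorithms with output in `[c, 1 - c]^d`. -/
def boundedAlgorithms (DB : Type*) (d : ℕ) (c : ℝ) : Set (Algorithm DB (Cube d)) :=
  {A | ∀ D, (A D : Measure (Cube d)) {x | ∀ i, (x i : ℝ) ∈ Set.Icc c (1 - c)} = 1}

/-- The `c`-corner distributions: those supported on `{c, 1 - c}^d`. -/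
def cornerDistributions (d : ℕ) (c : ℝ) : Set (ProbabilityMeasure (Cube d)) :=
  {P | (P : Measure (Cube d)) {x | ∀ i, (x i : ℝ) = c ∨ (x i : ℝ) = 1 - c} = 1}

end BernPost

end

/-! The right-hand supremum is attained by one explicit pair: randomized response between the
corners `(1 - c, …, 1 - c)` and `(c, …, c)`, with likelihood ratio `R` tuned to the budget `ε`. That
this pair dominates every admissible pair in the box is `exists_corner_pair`. Conversely, any corner
pair `(P, Q)` is realized by the algorithm that outputs `P` on one database and `Q` on all others.

The comparison is made through the hockey-stick curves `f t = E_t(P, Q)` and `g t = E_t(Q, P)`, `t ≥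
1`. By Taylor's formula the `α`-moment is an increasing affine function of `∫ t^(α-2) f + ∫ t^(-α-1)
g` over `t > 1` (`moment_eq`), the cost of the pair. Post-processing acts on curves pointwise in
`t`. The signed measure `P - tQ` has positive part of mass `f t` and negative part of mass `f t + (t
- 1)`, and any two points of the box are a coinwise degradation of the two extreme corners
(`sum_runWeight_sub_le`). Hence the output curve is at most `cornerGap`, which, symmetrized under
flipping all coins, is a nonnegative combination of tilts `max (f t - τ (t - 1)) 0` with
coefficients and slopes that do not depend on the pair (`cornerGap_eq`). For randomized response
between the extreme corners the output curve is at least this combination.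

It remains to see that tilting preserves domination by randomized response
(`HockeyPair.pairCost_tilt_le`). As `τ` decreases, the cost of a pair grows at a rate given by the
slope moments at the ends `σ`, `ς` of the supports of the two tilted curves. Up to a factor, the
tilted curves satisfy the axioms of `HockeyPair` again, and those of randomized response are again
randomized response. If the pair, in its costlier order, exceeds randomized response at some `τ`,
then its rate is at least as large (`HockeyPair.slope_le`), so the excess would survive down to `τ =
0`, against the hypothesis.

The implication from excess cost to large slope is a finite-dimensional extremal problem. Convexity
puts each curve below its chord, and the remaining axioms bound the common height, so that two-point
pairs are the worst ones; these are treated by a Lagrange multiplier (`twoPointCost_le`). If the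
heavier weight sits on the curve with the shorter support, a single-crossing argument shows that the
order was not the costlier one or that there was no excess (`HockeyPair.cost_le_swap_or`). -/

noncomputable section

namespace BernPost

/-! ### Moments of power weights and divided differences. -/

/-- The closed form of `∫ u in 1..X, u ^ e * (X - u)`. -/
def kappaMoment (e X : ℝ) : ℝ := (X ^ (e + 2) - (e + 2) * X + (e + 1)) / ((e + 1) * (e + 2))

/-- The closed form of `∫ u in 1..X, u ^ e * (u - 1)`. -/
def slopeMoment (e X : ℝ) : ℝ := (X ^ (e + 2) - 1) / (e + 2) - (X ^ (e + 1) - 1) / (e + 1)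

/-- The second divided difference, up to scaling, of `u ^ (e + 2)` at `1, 1, X`. -/
def dividedDiff (e X : ℝ) : ℝ := ∫ v in (0 : ℝ)..1, (1 - v) * (1 + v * (X - 1)) ^ e

theorem integral_rpow_mul_const_sub {e X : ℝ} (h1 : e + 1 ≠ 0) (h2 : e + 2 ≠ 0) (hX : 1 ≤ X) :
    ∫ u in (1 : ℝ)..X, u ^ e * (X - u) = kappaMoment e X := by
  have hd : ∀ u ∈ Set.uIcc 1 X, HasDerivAt
      (fun u : ℝ => X * (u ^ (e + 1) / (e + 1)) - u ^ (e + 2) / (e + 2)) (u ^ e * (X - u)) u := by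
    intro u hu
    rw [Set.uIcc_of_le hX] at hu
    have hu0 : 0 < u := by linarith [hu.1]
    have a1 := (Real.hasDerivAt_rpow_const (x := u) (p := e + 1) (Or.inl hu0.ne')).div_const (e + 1)
    have a2 := (Real.hasDerivAt_rpow_const (x := u) (p := e + 2) (Or.inl hu0.ne')).div_const (e + 2)
    refine ((a1.const_mul X).sub a2).congr_deriv ?_
    rw [show e + 1 - 1 = e by ring, show e + 2 - 1 = e + 1 by ring, Real.rpow_add_one hu0.ne']
    field_simp
  have hc : ContinuousOn (fun u : ℝ => u ^ e * (X - u)) (Set.uIcc 1 X) := by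
    rw [Set.uIcc_of_le hX]
    refine ContinuousOn.mul (fun u hu => ?_) (by fun_prop)
    exact (Real.continuousAt_rpow_const _ _ (Or.inl (by linarith [hu.1]))).continuousWithinAt
  rw [intervalIntegral.integral_eq_sub_of_hasDerivAt hd hc.intervalIntegrable]
  have hX0 : 0 < X := by linarith
  have hX2 : X ^ (e + 2) = X ^ (e + 1) * X := by
    rw [show e + 2 = e + 1 + 1 by ring, Real.rpow_add_one hX0.ne']
  simp only [Real.one_rpow, kappaMoment, hX2]
  field_simp
  ring

theorem integral_rpow_mul_sub_one {e X : ℝ} (h1 : e + 1 ≠ 0) (h2 : e + 2 ≠ 0) (hX : 1 ≤ X) :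
    ∫ u in (1 : ℝ)..X, u ^ e * (u - 1) = slopeMoment e X := by
  have hd : ∀ u ∈ Set.uIcc 1 X, HasDerivAt
      (fun u : ℝ => u ^ (e + 2) / (e + 2) - u ^ (e + 1) / (e + 1)) (u ^ e * (u - 1)) u := by
    intro u hu
    rw [Set.uIcc_of_le hX] at hu
    have hu0 : 0 < u := by linarith [hu.1]
    have a1 := (Real.hasDerivAt_rpow_const (x := u) (p := e + 1) (Or.inl hu0.ne')).div_const (e + 1)
    have a2 := (Real.hasDerivAt_rpow_const (x := u) (p := e + 2) (Or.inl hu0.ne')).div_const (e + 2)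
    refine (a2.sub a1).congr_deriv ?_
    rw [show e + 1 - 1 = e by ring, show e + 2 - 1 = e + 1 by ring, Real.rpow_add_one hu0.ne']
    field_simp
  have hc : ContinuousOn (fun u : ℝ => u ^ e * (u - 1)) (Set.uIcc 1 X) := by
    rw [Set.uIcc_of_le hX]
    refine ContinuousOn.mul (fun u hu => ?_) (by fun_prop)
    exact (Real.continuousAt_rpow_const _ _ (Or.inl (by linarith [hu.1]))).continuousWithinAt
  rw [intervalIntegral.integral_eq_sub_of_hasDerivAt hd hc.intervalIntegrable]
  simp only [Real.one_rpow, slopeMoment]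
  ring

theorem one_add_mul_pos {v X : ℝ} (hv : v ∈ Set.Icc (0 : ℝ) 1) (hX : 0 < X) :
    0 < 1 + v * (X - 1) := by
  obtain ⟨h0, h1⟩ := hv
  rcases eq_or_lt_of_le h0 with rfl | h0
  · simp
  · nlinarith [mul_pos h0 hX]

theorem continuousOn_dividedDiff_integrand (e : ℝ) {X : ℝ} (hX : 0 < X) :
    ContinuousOn (fun v : ℝ => (1 - v) * (1 + v * (X - 1)) ^ e) (Set.Icc 0 1) := by
  refine ContinuousOn.mul (by fun_prop) (ContinuousOn.rpow_const (by fun_prop) fun v hv => ?_)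
  exact Or.inl (one_add_mul_pos hv hX).ne'

theorem intervalIntegrable_dividedDiff (e : ℝ) {X : ℝ} (hX : 0 < X) :
    IntervalIntegrable (fun v : ℝ => (1 - v) * (1 + v * (X - 1)) ^ e) volume 0 1 := by
  refine ContinuousOn.intervalIntegrable ?_
  rw [Set.uIcc_of_le zero_le_one]
  exact continuousOn_dividedDiff_integrand e hX

/-- Splitting off `(X - 1) ^ 2` leaves an integral over a fixed interval, in which monotonicity in
`X` and in `e` can be read off the integrand. -/
theorem sq_mul_dividedDiff {e X : ℝ} (h1 : e + 1 ≠ 0) (h2 : e + 2 ≠ 0) (hX : 0 < X) :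
    (X - 1) ^ 2 * dividedDiff e X = kappaMoment e X := by
  rcases eq_or_ne X 1 with rfl | hX1
  · rw [kappaMoment, Real.one_rpow]; ring
  have hh : X - 1 ≠ 0 := sub_ne_zero.2 hX1
  have hd : ∀ v ∈ Set.uIcc (0 : ℝ) 1, HasDerivAt
      (fun v : ℝ => (1 - v) * ((1 + v * (X - 1)) ^ (e + 1) / ((e + 1) * (X - 1))) +
        (1 + v * (X - 1)) ^ (e + 2) / ((e + 1) * (e + 2) * (X - 1) ^ 2))
      ((1 - v) * (1 + v * (X - 1)) ^ e) v := by
    intro v hv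
    rw [Set.uIcc_of_le zero_le_one] at hv
    have hp := one_add_mul_pos hv hX
    have hl : HasDerivAt (fun v : ℝ => 1 + v * (X - 1)) (X - 1) v := by
      simpa using ((hasDerivAt_id v).mul_const (X - 1)).const_add 1
    have a1 := (hl.rpow_const (p := e + 1) (Or.inl hp.ne')).div_const ((e + 1) * (X - 1))
    have a2 := (hl.rpow_const (p := e + 2) (Or.inl hp.ne')).div_const
      ((e + 1) * (e + 2) * (X - 1) ^ 2)
    have a0 : HasDerivAt (fun v : ℝ => 1 - v) (-1) v := by
      simpa using (hasDerivAt_id v).const_sub 1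
    refine ((a0.mul a1).add a2).congr_deriv ?_
    rw [show e + 1 - 1 = e by ring, show e + 2 - 1 = e + 1 by ring, Real.rpow_add_one hp.ne']
    field_simp
    ring
  rw [dividedDiff, intervalIntegral.integral_eq_sub_of_hasDerivAt hd
    (intervalIntegrable_dividedDiff e hX)]
  have hX' : 1 + 1 * (X - 1) = X := by ring
  simp only [hX', kappaMoment, sub_self, zero_mul, sub_zero, add_zero, Real.one_rpow]
  field_simp
  ring

theorem dividedDiff_anti {e X Y : ℝ} (he : e ≤ 0) (hX : 0 < X) (hXY : X ≤ Y) :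
    dividedDiff e Y ≤ dividedDiff e X := by
  refine intervalIntegral.integral_mono_on zero_le_one
    (intervalIntegrable_dividedDiff e (hX.trans_le hXY)) (intervalIntegrable_dividedDiff e hX)
    fun v hv => ?_
  refine mul_le_mul_of_nonneg_left ?_ (by linarith [hv.2])
  exact Real.rpow_le_rpow_of_nonpos (one_add_mul_pos hv hX)
    (by nlinarith [mul_le_mul_of_nonneg_left hXY hv.1]) he

theorem dividedDiff_nonneg (e : ℝ) {X : ℝ} (hX : 0 < X) : 0 ≤ dividedDiff e X := by
  refine intervalIntegral.integral_nonneg zero_le_one fun v hv => ?_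
  exact mul_nonneg (by linarith [hv.2]) (Real.rpow_nonneg (one_add_mul_pos hv hX).le _)

theorem dividedDiff_le_exponent {e e' X : ℝ} (he : e ≤ e') (hX : 1 ≤ X) :
    dividedDiff e X ≤ dividedDiff e' X := by
  have hX0 : 0 < X := by linarith
  refine intervalIntegral.integral_mono_on zero_le_one
    (intervalIntegrable_dividedDiff e hX0) (intervalIntegrable_dividedDiff e' hX0)
    fun v hv => ?_
  refine mul_le_mul_of_nonneg_left ?_ (by linarith [hv.2])
  exact Real.rpow_le_rpow_of_exponent_le (by nlinarith [hv.1]) he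

theorem dividedDiff_zero (X : ℝ) : dividedDiff 0 X = 1 / 2 := by
  simp only [dividedDiff, Real.rpow_zero, mul_one]
  rw [intervalIntegral.integral_sub (by simp) (by simp)]
  simp; norm_num

/-- This is the symmetry between the two weights under `t ↦ t⁻¹`. For `α ≤ 2` the right side is
nondecreasing in `X`, which makes `X * dividedDiff (-α - 1) X` monotone. -/
theorem mul_dividedDiff_inv {α X : ℝ} (hα : 1 < α) (hX : 1 < X) :
    X * dividedDiff (-α - 1) X = dividedDiff (α - 2) X⁻¹ := by
  have hX0 : 0 < X := by linarith
  have e1 := sq_mul_dividedDiff (e := -α - 1) (X := X) (by linarith) (by linarith) hX0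
  have e2 := sq_mul_dividedDiff (e := α - 2) (X := X⁻¹) (by linarith) (by linarith) (inv_pos.2 hX0)
  have hne : (X - 1) ^ 2 ≠ 0 := pow_ne_zero _ (by linarith)
  have hne' : (X⁻¹ - 1) ^ 2 ≠ 0 := by
    refine pow_ne_zero _ ?_
    have := inv_lt_one_of_one_lt₀ hX
    linarith
  have e3 : kappaMoment (-α - 1) X = X * kappaMoment (α - 2) X⁻¹ := by
    simp only [kappaMoment]
    rw [show -α - 1 + 2 = 1 + -α by ring, show -α - 1 + 1 = -α by ring, show α - 2 + 2 = α by ring,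
      show α - 2 + 1 = α - 1 by ring, Real.rpow_add hX0, Real.rpow_one, Real.inv_rpow hX0.le,
      Real.rpow_neg hX0.le]
    have : (X ^ α) ≠ 0 := (Real.rpow_pos_of_pos hX0 _).ne'
    have : α ≠ 0 := by linarith
    have : α - 1 ≠ 0 := by linarith
    have : 1 + -α ≠ 0 := by linarith
    have : 1 - α ≠ 0 := by linarith
    field_simp
    ring
  have e4 : (X⁻¹ - 1) ^ 2 = (X - 1) ^ 2 / X ^ 2 := by field_simp; ring
  have : (X - 1) ^ 2 * (X * dividedDiff (-α - 1) X) = (X - 1) ^ 2 * dividedDiff (α - 2) X⁻¹ := by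
    calc _ = X * kappaMoment (-α - 1) X := by rw [← e1]; ring
      _ = X ^ 2 * kappaMoment (α - 2) X⁻¹ := by rw [e3]; ring
      _ = _ := by rw [← e2, e4]; field_simp
  exact mul_left_cancel₀ hne this

/-! ### Two-point pairs: cost against slope. -/

/-- The cost of the two-point pair with likelihood ratios `x` and `y⁻¹`. -/
def twoPointCost (α x y : ℝ) : ℝ :=
  ((y - 1) * kappaMoment (α - 2) x + (x - 1) * kappaMoment (-α - 1) y) / (x * y - 1)

theorem hasDerivAt_kappaMoment {e X : ℝ} (h2 : e + 2 ≠ 0) (hX : 0 < X) :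
    HasDerivAt (kappaMoment e) ((X ^ (e + 1) - 1) / (e + 1)) X := by
  have a2 := (Real.hasDerivAt_rpow_const (x := X) (p := e + 2) (Or.inl hX.ne'))
  have := ((a2.sub ((hasDerivAt_id X).const_mul (e + 2))).add_const (e + 1)).div_const
    ((e + 1) * (e + 2))
  refine HasDerivAt.congr_deriv (this.congr_of_eventuallyEq (.of_forall fun u => ?_)) ?_
  · simp [kappaMoment]
  · rw [show e + 2 - 1 = e + 1 by ring]
    rw [← mul_sub, mul_comm (e + 1), mul_div_mul_left _ _ h2]

theorem hasDerivAt_slopeMoment {e X : ℝ} (h1 : e + 1 ≠ 0) (h2 : e + 2 ≠ 0) (hX : 0 < X) :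
    HasDerivAt (slopeMoment e) (X ^ e * (X - 1)) X := by
  have a2 := (Real.hasDerivAt_rpow_const (x := X) (p := e + 2) (Or.inl hX.ne'))
  have a1 := (Real.hasDerivAt_rpow_const (x := X) (p := e + 1) (Or.inl hX.ne'))
  have := ((a2.sub_const 1).div_const (e + 2)).sub ((a1.sub_const 1).div_const (e + 1))
  refine HasDerivAt.congr_deriv (this.congr_of_eventuallyEq (.of_forall fun u => ?_)) ?_
  · simp [slopeMoment]
  · rw [show e + 2 - 1 = e + 1 by ring, show e + 1 - 1 = e by ring, Real.rpow_add_one hX.ne']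
    field_simp

/-- The quotient rule collapses to a single divided difference at `x * y`, so the derivative can be
compared with that of `slopeMoment`, which is `x ^ (α - 2) * (x - 1)`. -/
theorem hasDerivAt_twoPointCost_left {α x y : ℝ} (hα : 1 < α) (hx : 1 < x) (hy : 1 < y) :
    HasDerivAt (fun x => twoPointCost α x y)
      ((y - 1) * x ^ (α - 1) * dividedDiff (-α - 1) (x * y)) x := by
  have hx0 : 0 < x := by linarith
  have hy0 : 0 < y := by linarith
  have hxy : 1 < x * y := by nlinarith
  have hne : x * y - 1 ≠ 0 := by linarith
  have hk := hasDerivAt_kappaMoment (e := α - 2) (X := x) (by linarith) hx0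
  have hn := (hk.const_mul (y - 1)).add
    (((hasDerivAt_id x).sub_const 1).mul_const (kappaMoment (-α - 1) y))
  have hd := ((hasDerivAt_id x).mul_const y).sub_const 1
  refine (hn.div hd hne).congr_deriv ?_
  have hq := sq_mul_dividedDiff (e := -α - 1) (X := x * y) (by linarith) (by linarith) (by linarith)
  have : dividedDiff (-α - 1) (x * y) = kappaMoment (-α - 1) (x * y) / (x * y - 1) ^ 2 := by
    rw [← hq]; field_simp
  rw [this]
  simp only [kappaMoment, id, Pi.add_apply]
  rw [show -α - 1 + 2 = 1 + -α by ring, show -α - 1 + 1 = -α by ring, show α - 2 + 2 = α by ring,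
      show α - 2 + 1 = α - 1 by ring, Real.rpow_add hy0, Real.rpow_one,
      Real.rpow_neg hy0.le, Real.rpow_sub hx0, Real.rpow_one, Real.rpow_add (by linarith),
      Real.rpow_one, Real.rpow_neg (by linarith), Real.mul_rpow hx0.le hy0.le]
  have := (Real.rpow_pos_of_pos hx0 α).ne'
  have := (Real.rpow_pos_of_pos hy0 α).ne'
  have : α ≠ 0 := by linarith
  have : α - 1 ≠ 0 := by linarith
  have : 1 + -α ≠ 0 := by linarith
  have : 1 - α ≠ 0 := by linarith
  field_simp
  ring

theorem hasDerivAt_twoPointCost_right {α x y : ℝ} (hα : 1 < α) (hx : 1 < x) (hy : 1 < y) :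
    HasDerivAt (fun y => twoPointCost α x y)
      ((x - 1) * y ^ (-α) * dividedDiff (α - 2) (x * y)) y := by
  have hx0 : 0 < x := by linarith
  have hy0 : 0 < y := by linarith
  have hxy : 1 < x * y := by nlinarith
  have hne : x * y - 1 ≠ 0 := by linarith
  have hk := hasDerivAt_kappaMoment (e := -α - 1) (X := y) (by linarith) hy0
  have hn := (((hasDerivAt_id y).sub_const 1).mul_const (kappaMoment (α - 2) x)).add
    (hk.const_mul (x - 1))
  have hd := ((hasDerivAt_id y).const_mul x).sub_const 1
  refine (hn.div hd hne).congr_deriv ?_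
  have hq := sq_mul_dividedDiff (e := α - 2) (X := x * y) (by linarith) (by linarith) (by linarith)
  have : dividedDiff (α - 2) (x * y) = kappaMoment (α - 2) (x * y) / (x * y - 1) ^ 2 := by
    rw [← hq]; field_simp
  rw [this]
  simp only [kappaMoment, id, Pi.add_apply]
  rw [show -α - 1 + 2 = 1 + -α by ring, show -α - 1 + 1 = -α by ring, show α - 2 + 2 = α by ring,
      show α - 2 + 1 = α - 1 by ring, Real.rpow_add hy0, Real.rpow_one,
      Real.rpow_neg hy0.le, Real.mul_rpow hx0.le hy0.le]
  have := (Real.rpow_pos_of_pos hx0 α).ne'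
  have := (Real.rpow_pos_of_pos hy0 α).ne'
  have : α ≠ 0 := by linarith
  have : α - 1 ≠ 0 := by linarith
  have : 1 + -α ≠ 0 := by linarith
  have : 1 - α ≠ 0 := by linarith
  field_simp
  ring

/-- The multiplier that trades two-point cost against two-point slope. -/
theorem exists_twoPoint_multiplier {α ρ : ℝ} (hα : 1 < α) (hρ : 1 < ρ) :
    ∃ C : ℝ, 0 ≤ C ∧
      (∀ x y, ρ ≤ x → 1 < y → y ≤ ρ →
        (y - 1) * x * dividedDiff (-α - 1) (x * y) ≤ C * (x - 1)) ∧
      (∀ y, 1 < y → y ≤ ρ → C * (y - 1) ≤ (ρ - 1) * y * dividedDiff (α - 2) (ρ * y)) := by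
  have hρ0 : 0 < ρ := by linarith
  have hb : ∀ X, 0 < X → 0 ≤ dividedDiff (-α - 1) X := fun X hX => dividedDiff_nonneg _ hX
  rcases le_total α 2 with h2 | h2
  -- This `C` makes the first condition an equality at `x = y = ρ`.
  · refine ⟨ρ * dividedDiff (-α - 1) (ρ * ρ), by positivity [hb (ρ * ρ) (by positivity)],
      fun x y hx hy hyρ => ?_, fun y hy hyρ => ?_⟩
    · have hy0 : 0 < y := by linarith
      have s1 : dividedDiff (-α - 1) (x * y) ≤ dividedDiff (-α - 1) (ρ * y) :=
        dividedDiff_anti (by linarith) (by positivity) (by nlinarith)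
      have s2 : ρ * y * dividedDiff (-α - 1) (ρ * y) ≤ ρ * ρ * dividedDiff (-α - 1) (ρ * ρ) := by
        rw [mul_dividedDiff_inv hα (by nlinarith), mul_dividedDiff_inv hα (by nlinarith)]
        exact dividedDiff_anti (by linarith) (by positivity)
          (inv_anti₀ (by positivity) (by nlinarith))
      have hx0 : 0 < x := by linarith
      have n1 := hb (ρ * ρ) (by positivity)
      have s3 : y * dividedDiff (-α - 1) (ρ * y) ≤ ρ * dividedDiff (-α - 1) (ρ * ρ) := by
        refine le_of_mul_le_mul_left ?_ hρ0
        linarith [s2, mul_assoc ρ y (dividedDiff (-α - 1) (ρ * y)),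
          mul_assoc ρ ρ (dividedDiff (-α - 1) (ρ * ρ))]
      set b1 := dividedDiff (-α - 1) (ρ * y)
      set b2 := dividedDiff (-α - 1) (ρ * ρ)
      have t1 : (y - 1) * b1 ≤ (ρ - 1) * b2 := by
        have : y * ((y - 1) * b1) ≤ y * ((ρ - 1) * b2) := by
          calc y * ((y - 1) * b1) = (y - 1) * (y * b1) := by ring
            _ ≤ (y - 1) * (ρ * b2) := mul_le_mul_of_nonneg_left s3 (by linarith)
            _ ≤ y * ((ρ - 1) * b2) := by nlinarith
        exact le_of_mul_le_mul_left this hy0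
      calc (y - 1) * x * dividedDiff (-α - 1) (x * y) ≤ (y - 1) * x * b1 :=
            mul_le_mul_of_nonneg_left s1 (mul_nonneg (by linarith) hx0.le)
        _ = x * ((y - 1) * b1) := by ring
        _ ≤ x * ((ρ - 1) * b2) := mul_le_mul_of_nonneg_left t1 hx0.le
        _ ≤ ρ * b2 * (x - 1) := by nlinarith
    · have hy0 : 0 < y := by linarith
      have s1 : dividedDiff (α - 2) (ρ * ρ) ≤ dividedDiff (α - 2) (ρ * y) :=
        dividedDiff_anti (by linarith) (by positivity) (by nlinarith)
      have s2 : dividedDiff (-α - 1) (ρ * ρ) ≤ dividedDiff (α - 2) (ρ * ρ) :=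
        dividedDiff_le_exponent (by linarith) (by nlinarith)
      have n1 := hb (ρ * ρ) (by positivity)
      calc ρ * dividedDiff (-α - 1) (ρ * ρ) * (y - 1)
          ≤ (ρ - 1) * y * dividedDiff (-α - 1) (ρ * ρ) := by nlinarith
        _ ≤ _ := mul_le_mul_of_nonneg_left (s2.trans s1) (mul_nonneg (by linarith) hy0.le)
  -- For `α ≥ 2` the value at `α = 2` serves: `dividedDiff 0` is constantly `1 / 2`, and `X *
  -- dividedDiff (-3) X = 1 / 2` by the reciprocal symmetry.
  · refine ⟨1 / 2, by norm_num, fun x y hx hy hyρ => ?_, fun y hy hyρ => ?_⟩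
    · have hy0 : 0 < y := by linarith
      have hxy : 1 < x * y := by nlinarith
      have s1 : x * y * dividedDiff (-α - 1) (x * y) ≤ 1 / 2 := by
        have e2 := mul_dividedDiff_inv one_lt_two hxy
        norm_num [dividedDiff_zero] at e2
        calc _ ≤ x * y * dividedDiff (-3) (x * y) :=
              mul_le_mul_of_nonneg_left (dividedDiff_le_exponent (by linarith) hxy.le) (by linarith)
          _ = _ := e2
      have hx0 : 0 < x := by linarith
      have n1 := hb (x * y) (by positivity)
      have s2 : x * dividedDiff (-α - 1) (x * y) ≤ 1 / 2 := by nlinarith [mul_nonneg hx0.le n1]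
      nlinarith
    · have s1 := dividedDiff_le_exponent (e := 0) (e' := α - 2) (X := ρ * y) (by linarith)
        (by nlinarith)
      rw [dividedDiff_zero] at s1
      have : (ρ - 1) * y * (1 / 2) ≤ (ρ - 1) * y * dividedDiff (α - 2) (ρ * y) :=
        mul_le_mul_of_nonneg_left s1 (mul_nonneg (by linarith) (by linarith))
      nlinarith

/-- Lagrange multiplier argument: with `C` from `exists_twoPoint_multiplier`, cost minus `C` times
slope does not decrease along the path `(x, y)`, `(ρ, y)`, `(ρ, ρ)`. Since `C ≥ 0`, the slope
hypothesis removes the multiplier. -/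
theorem twoPointCost_le {α ρ x y : ℝ} (hα : 1 < α) (hρx : ρ ≤ x) (hy : 1 < y) (hyρ : y ≤ ρ)
    (hn : slopeMoment (α - 2) x + slopeMoment (-α - 1) y ≤
      slopeMoment (α - 2) ρ + slopeMoment (-α - 1) ρ) :
    twoPointCost α x y ≤ twoPointCost α ρ ρ := by
  have hρ : 1 < ρ := by linarith
  obtain ⟨C, hC, h1, h2⟩ := exists_twoPoint_multiplier hα hρ
  have d1 : ∀ u ∈ Set.Icc ρ x, HasDerivAt
      (fun u => twoPointCost α u y - C * slopeMoment (α - 2) u)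
      ((y - 1) * u ^ (α - 1) * dividedDiff (-α - 1) (u * y) - C * (u ^ (α - 2) * (u - 1))) u := by
    intro u hu
    exact (hasDerivAt_twoPointCost_left hα (by linarith [hu.1]) hy).sub
      ((hasDerivAt_slopeMoment (by linarith) (by linarith) (by linarith [hu.1])).const_mul C)
  have m1 : AntitoneOn (fun u => twoPointCost α u y - C * slopeMoment (α - 2) u) (Set.Icc ρ x) := by
    refine antitoneOn_of_hasDerivWithinAt_nonpos (convex_Icc _ _)
      (fun u hu => (d1 u hu).continuousAt.continuousWithinAt)
      (fun u hu => (d1 u (interior_subset hu)).hasDerivWithinAt) fun u hu => ?_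
    have hu' := interior_subset hu
    have hu0 : 0 < u := by linarith [hu'.1]
    have := h1 u y hu'.1 hy hyρ
    have hp := Real.rpow_pos_of_pos hu0 (α - 2)
    rw [show α - 1 = α - 2 + 1 by ring, Real.rpow_add_one hu0.ne']
    nlinarith
  have d2 : ∀ u ∈ Set.Icc y ρ, HasDerivAt
      (fun u => twoPointCost α ρ u - C * slopeMoment (-α - 1) u)
      ((ρ - 1) * u ^ (-α) * dividedDiff (α - 2) (ρ * u) - C * (u ^ (-α - 1) * (u - 1))) u := by
    intro u hu
    exact (hasDerivAt_twoPointCost_right hα hρ (by linarith [hu.1])).sub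
      ((hasDerivAt_slopeMoment (by linarith) (by linarith) (by linarith [hu.1])).const_mul C)
  have m2 : MonotoneOn (fun u => twoPointCost α ρ u - C * slopeMoment (-α - 1) u)
      (Set.Icc y ρ) := by
    refine monotoneOn_of_hasDerivWithinAt_nonneg (convex_Icc _ _)
      (fun u hu => (d2 u hu).continuousAt.continuousWithinAt)
      (fun u hu => (d2 u (interior_subset hu)).hasDerivWithinAt) fun u hu => ?_
    have hu' := interior_subset hu
    have hu0 : 0 < u := by linarith [hu'.1]
    have := h2 u (by linarith [hu'.1]) hu'.2
    have hp := Real.rpow_pos_of_pos hu0 (-α - 1)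
    rw [show -α = -α - 1 + 1 by ring, Real.rpow_add_one hu0.ne',
      show -α - 1 + 1 - 1 = -α - 1 by ring]
    nlinarith
  have i1 := m1 (Set.left_mem_Icc.2 hρx) (Set.right_mem_Icc.2 hρx) hρx
  have i2 := m2 (Set.left_mem_Icc.2 hyρ) (Set.right_mem_Icc.2 hyρ) hyρ
  simp only at i1 i2
  nlinarith

/-! ### Abstract hockey-stick pairs and their costs. -/

/-- The shared properties of the hockey-stick curves `γ ↦ E_γ(P, Q)` and `γ ↦ E_γ(Q, P)`,
`1 ≤ γ`. -/
structure HockeyPair (f g : ℝ → ℝ) : Prop where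
  convex_left : ConvexOn ℝ (Set.Ici 1) f
  convex_right : ConvexOn ℝ (Set.Ici 1) g
  nonneg_left : ∀ t, 1 ≤ t → 0 ≤ f t
  nonneg_right : ∀ t, 1 ≤ t → 0 ≤ g t
  eq_one : f 1 = g 1
  le_add : ∀ t, 1 ≤ t → f 1 * (1 + t) - (t - 1) ≤ f t + g t

theorem HockeyPair.symm {f g : ℝ → ℝ} (h : HockeyPair f g) : HockeyPair g f where
  convex_left := h.convex_right
  convex_right := h.convex_left
  nonneg_left := h.nonneg_right
  nonneg_right := h.nonneg_left
  eq_one := h.eq_one.symm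
  le_add t ht := by rw [← h.eq_one, add_comm (g t)]; exact h.le_add t ht

/-- The weighted integrals of `f` that enter the cost are finite. -/
def FiniteCost (α : ℝ) (f : ℝ → ℝ) : Prop :=
  IntegrableOn (fun t : ℝ => t ^ (α - 2) * f t) (Set.Ioi 1) ∧
    IntegrableOn (fun t : ℝ => t ^ (-α - 1) * f t) (Set.Ioi 1)

/-- The nontrivial part of the `α`-moment of a pair with hockey-stick curves `f` and `g`. -/
def pairCost (α : ℝ) (f g : ℝ → ℝ) : ℝ :=
  (∫ t in Set.Ioi (1 : ℝ), t ^ (α - 2) * f t) + ∫ t in Set.Ioi (1 : ℝ), t ^ (-α - 1) * g t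

/-- The hockey-stick curve of randomized response with likelihood ratio `ρ`. -/
def rrCurve (ρ t : ℝ) : ℝ := max (ρ - t) 0 / (1 + ρ)

theorem continuousOn_rpow_Ici (e : ℝ) : ContinuousOn (fun t : ℝ => t ^ e) (Set.Ici 1) :=
  fun _ hu => (Real.continuousAt_rpow_const _ _
    (Or.inl (by linarith [Set.mem_Ici.1 hu]))).continuousWithinAt

theorem integrableOn_rpow_mul_of_bounded_support {e σ : ℝ} {f : ℝ → ℝ}
    (hf : ContinuousOn f (Set.Icc 1 σ)) (h0 : ∀ t, σ < t → f t = 0) :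
    IntegrableOn (fun t : ℝ => t ^ e * f t) (Set.Ioi 1) := by
  have h1 : IntegrableOn (fun t : ℝ => t ^ e * f t) (Set.Ioc 1 σ) := by
    refine IntegrableOn.mono_set ?_ Set.Ioc_subset_Icc_self
    exact ContinuousOn.integrableOn_Icc
      (((continuousOn_rpow_Ici e).mono fun t ht => ht.1).mul hf)
  refine h1.of_forall_sdiff_eq_zero measurableSet_Ioi fun t ht => ?_
  rw [h0 t, mul_zero]
  by_contra h
  exact ht.2 ⟨ht.1, not_lt.1 h⟩

theorem integrableOn_rpow_mul_hinge (e σ : ℝ) :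
    IntegrableOn (fun t : ℝ => t ^ e * max (σ - t) 0) (Set.Ioi 1) :=
  integrableOn_rpow_mul_of_bounded_support (σ := σ) (by fun_prop)
    fun t ht => max_eq_right (by linarith)

theorem integral_rpow_mul_hinge {e σ : ℝ} (h1 : e + 1 ≠ 0) (h2 : e + 2 ≠ 0) (hσ : 1 ≤ σ) :
    ∫ t in Set.Ioi (1 : ℝ), t ^ e * max (σ - t) 0 = kappaMoment e σ := by
  rw [← integral_rpow_mul_const_sub h1 h2 hσ, intervalIntegral.integral_of_le hσ]
  rw [setIntegral_eq_of_subset_of_forall_sdiff_eq_zero measurableSet_Ioi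
    (Set.Ioc_subset_Ioi_self : Set.Ioc 1 σ ⊆ Set.Ioi 1)]
  · refine setIntegral_congr_fun measurableSet_Ioc fun t ht => ?_
    simp only [max_eq_left (sub_nonneg.2 ht.2)]
  · intro t ht
    rw [max_eq_right, mul_zero]
    by_contra h
    exact ht.2 ⟨ht.1, by linarith⟩

theorem finiteCost_const_mul_hinge (α c σ : ℝ) : FiniteCost α fun t => c * max (σ - t) 0 := by
  constructor
  · simp only [mul_left_comm _ c]
    exact (integrableOn_rpow_mul_hinge (α - 2) σ).const_mul c
  · simp only [mul_left_comm _ c]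
    exact (integrableOn_rpow_mul_hinge (-α - 1) σ).const_mul c

theorem pairCost_const_mul_hinge {α c c' σ ς : ℝ} (hα : 1 < α) (hσ : 1 ≤ σ) (hς : 1 ≤ ς) :
    pairCost α (fun t => c * max (σ - t) 0) (fun t => c' * max (ς - t) 0) =
      c * kappaMoment (α - 2) σ + c' * kappaMoment (-α - 1) ς := by
  rw [pairCost, ← integral_rpow_mul_hinge (e := α - 2) (by linarith) (by linarith) hσ,
    ← integral_rpow_mul_hinge (e := -α - 1) (by linarith) (by linarith) hς,
    ← integral_const_mul, ← integral_const_mul]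
  simp only [mul_left_comm _ c, mul_left_comm _ c']

theorem rrCurve_eq (ρ : ℝ) : rrCurve ρ = fun t => (1 + ρ)⁻¹ * max (ρ - t) 0 := by
  ext t; rw [rrCurve, div_eq_inv_mul]

theorem finiteCost_rrCurve (α ρ : ℝ) : FiniteCost α (rrCurve ρ) := by
  rw [rrCurve_eq]; exact finiteCost_const_mul_hinge _ _ _

theorem pairCost_rrCurve {α ρ : ℝ} (hα : 1 < α) (hρ : 1 ≤ ρ) :
    pairCost α (rrCurve ρ) (rrCurve ρ) =
      (1 + ρ)⁻¹ * (kappaMoment (α - 2) ρ + kappaMoment (-α - 1) ρ) := by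
  rw [rrCurve_eq, pairCost_const_mul_hinge hα hρ hρ]; ring

theorem rrCurve_nonneg {ρ : ℝ} (hρ : 1 ≤ ρ) (t : ℝ) : 0 ≤ rrCurve ρ t :=
  div_nonneg (le_max_right _ _) (by linarith)

theorem pairCost_mono {α : ℝ} {f g f' g' : ℝ → ℝ} (hf : FiniteCost α f) (hg : FiniteCost α g)
    (hf' : FiniteCost α f') (hg' : FiniteCost α g') (h : ∀ t, 1 < t → f t ≤ f' t)
    (h' : ∀ t, 1 < t → g t ≤ g' t) : pairCost α f g ≤ pairCost α f' g' := by
  refine add_le_add (setIntegral_mono_on hf.1 hf'.1 measurableSet_Ioi fun t ht => ?_)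
    (setIntegral_mono_on hg.2 hg'.2 measurableSet_Ioi fun t ht => ?_)
  · exact mul_le_mul_of_nonneg_left (h t ht) (Real.rpow_nonneg (by linarith [Set.mem_Ioi.1 ht]) _)
  · exact mul_le_mul_of_nonneg_left (h' t ht) (Real.rpow_nonneg (by linarith [Set.mem_Ioi.1 ht]) _)

/-! ### Comparison of a pair of bounded support with randomized response. -/

theorem chord_le {f : ℝ → ℝ} {σ : ℝ} (hf : ConvexOn ℝ (Set.Ici 1) f) (hσ : 1 < σ)
    (h0 : ∀ t, σ ≤ t → f t = 0) {t : ℝ} (ht : 1 ≤ t) :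
    f t ≤ f 1 / (σ - 1) * max (σ - t) 0 := by
  rcases le_or_gt σ t with h | h
  · rw [h0 t h, max_eq_right (by linarith), mul_zero]
  · have hs : 0 < σ - 1 := by linarith
    rw [max_eq_left (by linarith)]
    have := hf.2 (Set.mem_Ici.2 le_rfl) (Set.mem_Ici.2 hσ.le)
      (div_nonneg (by linarith) hs.le : 0 ≤ (σ - t) / (σ - 1))
      (div_nonneg (by linarith) hs.le : 0 ≤ (t - 1) / (σ - 1))
      (by field_simp; ring)
    rw [h0 σ le_rfl] at this
    have e : ((σ - t) / (σ - 1)) • (1 : ℝ) + ((t - 1) / (σ - 1)) • σ = t := by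
      simp only [smul_eq_mul]; field_simp; ring
    rw [e] at this
    simp only [smul_eq_mul, mul_zero, add_zero] at this
    calc f t ≤ _ := this
      _ = _ := by ring

/-- At `m = min σ ς` the two chord bounds contradict `le_add` unless the common height is at most
`(σ - 1) * (ς - 1) / (σ * ς - 1)`, the height of the two-point pair with likelihood ratios `σ` and
`ς⁻¹`. -/
theorem HockeyPair.height_le {f g : ℝ → ℝ} (h : HockeyPair f g) {σ ς : ℝ} (hσ : 1 < σ)
    (hς : 1 < ς) (hf : ∀ t, σ ≤ t → f t = 0) (hg : ∀ t, ς ≤ t → g t = 0) :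
    f 1 * (σ * ς - 1) ≤ (σ - 1) * (ς - 1) := by
  set m := min σ ς
  have hm : 1 < m := lt_min hσ hς
  have c1 := chord_le h.convex_left hσ hf hm.le
  have c2 := chord_le h.convex_right hς hg hm.le
  rw [max_eq_left (sub_nonneg.2 (min_le_left _ _))] at c1
  rw [max_eq_left (sub_nonneg.2 (min_le_right _ _)), ← h.eq_one] at c2
  have c3 := h.le_add m hm.le
  have hs : 0 < σ - 1 := by linarith
  have hs' : 0 < ς - 1 := by linarith
  have e1 : f 1 / (σ - 1) * (σ - m) = f 1 - f 1 * (m - 1) / (σ - 1) := by field_simp; ring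
  have e2 : f 1 / (ς - 1) * (ς - m) = f 1 - f 1 * (m - 1) / (ς - 1) := by field_simp; ring
  have c4 : (m - 1) * (f 1 * (1 / (σ - 1) + 1 / (ς - 1) + 1)) ≤ (m - 1) * 1 := by
    have : (m - 1) * (f 1 * (1 / (σ - 1) + 1 / (ς - 1) + 1)) =
        f 1 * (m - 1) / (σ - 1) + f 1 * (m - 1) / (ς - 1) + f 1 * (m - 1) := by ring
    rw [this]; linarith
  have c5 := le_of_mul_le_mul_left c4 (by linarith)
  have : f 1 * (σ * ς - 1) =
      (f 1 * (1 / (σ - 1) + 1 / (ς - 1) + 1)) * ((σ - 1) * (ς - 1)) := by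
    field_simp; ring
  rw [this]
  exact mul_le_of_le_one_left (by positivity) c5

/-- The hypothesis on `D` says that the chord starts no higher than `rrCurve ρ` at `t = 1`; it also
reaches zero no later, and both are affine until then. -/
theorem chord_le_rrCurve {D ρ σ t : ℝ} (hD : D * (ρ + 1) ≤ ρ - 1) (hσ : 1 < σ)
    (hσρ : σ ≤ ρ) (ht : 1 ≤ t) : D / (σ - 1) * max (σ - t) 0 ≤ rrCurve ρ t := by
  rcases le_total σ t with h | h
  · rw [max_eq_right (by linarith), mul_zero]; exact rrCurve_nonneg (by linarith) t
  · have hs : 0 < σ - 1 := by linarith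
    rw [rrCurve, max_eq_left (by linarith), max_eq_left (by linarith), le_div_iff₀ (by linarith),
      div_mul_eq_mul_div, div_mul_eq_mul_div, div_le_iff₀ hs]
    have := mul_le_mul_of_nonneg_right hD (sub_nonneg.2 h)
    nlinarith [mul_nonneg (sub_nonneg.2 hσρ) (sub_nonneg.2 ht)]

theorem kappaMoment_nonneg {e X : ℝ} (h1 : e + 1 ≠ 0) (h2 : e + 2 ≠ 0) (hX : 1 ≤ X) :
    0 ≤ kappaMoment e X := by
  rw [← sq_mul_dividedDiff h1 h2 (by linarith)]
  exact mul_nonneg (sq_nonneg _) (dividedDiff_nonneg _ (by linarith))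

theorem slopeMoment_mono {e X Y : ℝ} (h1 : e + 1 ≠ 0) (h2 : e + 2 ≠ 0) (hX : 1 ≤ X)
    (hXY : X ≤ Y) : slopeMoment e X ≤ slopeMoment e Y := by
  refine monotoneOn_of_hasDerivWithinAt_nonneg (convex_Ici (1 : ℝ)) (f := slopeMoment e)
    (f' := fun u => u ^ e * (u - 1))
    (fun u hu => (hasDerivAt_slopeMoment h1 h2 (by linarith [Set.mem_Ici.1 hu])
      ).continuousAt.continuousWithinAt)
    (fun u hu => (hasDerivAt_slopeMoment h1 h2 (by linarith [Set.mem_Ici.1 (interior_subset hu)])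
      ).hasDerivWithinAt) (fun u hu => ?_) hX (hX.trans hXY) hXY
  have := Set.mem_Ici.1 (interior_subset hu)
  exact mul_nonneg (Real.rpow_nonneg (by linarith) _) (by linarith)

/-- When the heavier weight carries the longer support, a small slope forces a small cost. -/
theorem HockeyPair.cost_le_of_slope_le {f g : ℝ → ℝ} (h : HockeyPair f g) {α ρ σ ς : ℝ}
    (hα : 1 < α) (hρ : 1 < ρ) (hσ : 1 < σ) (hς : 1 < ς) (hf : ∀ t, σ ≤ t → f t = 0)
    (hg : ∀ t, ς ≤ t → g t = 0) (hfc : FiniteCost α f) (hgc : FiniteCost α g) (hςσ : ς ≤ σ)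
    (hn : slopeMoment (α - 2) σ + slopeMoment (-α - 1) ς <
      slopeMoment (α - 2) ρ + slopeMoment (-α - 1) ρ) :
    pairCost α f g ≤ pairCost α (rrCurve ρ) (rrCurve ρ) := by
  have hD := h.height_le hσ hς hf hg
  have cf := fun t (ht : 1 < t) => chord_le h.convex_left hσ hf ht.le
  have cg := fun t (ht : 1 < t) => chord_le h.convex_right hς hg ht.le
  rw [← h.eq_one] at cg
  have hD0 := h.nonneg_left 1 le_rfl
  rcases le_or_gt σ ρ with hσρ | hσρ
  -- The height bound increases in `σ` and in `ς` and equals `(ρ - 1) / (ρ + 1)` at `σ = ς = ρ`;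
  -- both curves then lie below `rrCurve ρ`.
  · have hDρ : f 1 * (ρ + 1) ≤ ρ - 1 := by
      have h1 : 0 < σ * ς - 1 := by nlinarith
      refine le_of_mul_le_mul_left (a := σ * ς - 1) ?_ h1
      have h2 := mul_le_mul_of_nonneg_left hD (by linarith : 0 ≤ ρ + 1)
      have h3 : (σ - 1) * (ς - 1) * (ρ + 1) ≤ (σ * ς - 1) * (ρ - 1) := by
        nlinarith [mul_nonneg (by linarith : (0:ℝ) ≤ ρ - σ) (by linarith : (0:ℝ) ≤ ς - 1),
          mul_nonneg (by linarith : (0:ℝ) ≤ ρ - ς) (by linarith : (0:ℝ) ≤ σ - 1)]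
      nlinarith
    exact pairCost_mono hfc hgc (finiteCost_rrCurve _ _) (finiteCost_rrCurve _ _)
      (fun t ht => (cf t ht).trans (chord_le_rrCurve hDρ hσ hσρ ht.le))
      (fun t ht => (cg t ht).trans (chord_le_rrCurve hDρ hς (hςσ.trans hσρ) ht.le))
  -- Slope moments are monotone, so a long `σ` together with a small total slope forces a short `ς`;
  -- this is the configuration of `twoPointCost_le`.
  · have hςρ : ς < ρ := by
      by_contra hc
      have := slopeMoment_mono (e := α - 2) (by linarith) (by linarith) hρ.le hσρ.le
      have := slopeMoment_mono (e := -α - 1) (by linarith) (by linarith) hρ.le (not_lt.1 hc)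
      linarith
    have key := twoPointCost_le hα hσρ.le hς hςρ.le hn.le
    have h1 : 0 < σ * ς - 1 := by nlinarith
    have hs : 0 < σ - 1 := by linarith
    have hs' : 0 < ς - 1 := by linarith
    have k1 := kappaMoment_nonneg (e := α - 2) (by linarith) (by linarith) hσ.le
    have k2 := kappaMoment_nonneg (e := -α - 1) (by linarith) (by linarith) hς.le
    calc pairCost α f g ≤ pairCost α (fun t => f 1 / (σ - 1) * max (σ - t) 0)
          (fun t => f 1 / (ς - 1) * max (ς - t) 0) :=
          pairCost_mono hfc hgc (finiteCost_const_mul_hinge _ _ _)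
            (finiteCost_const_mul_hinge _ _ _) cf cg
      _ = f 1 * (kappaMoment (α - 2) σ / (σ - 1) + kappaMoment (-α - 1) ς / (ς - 1)) := by
          rw [pairCost_const_mul_hinge hα hσ.le hς.le]; ring
      _ ≤ (σ - 1) * (ς - 1) / (σ * ς - 1) *
          (kappaMoment (α - 2) σ / (σ - 1) + kappaMoment (-α - 1) ς / (ς - 1)) :=
          mul_le_mul_of_nonneg_right ((le_div_iff₀ h1).2 hD) (by positivity)
      _ = twoPointCost α σ ς := by rw [twoPointCost]; field_simp
      _ ≤ twoPointCost α ρ ρ := key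
      _ = _ := by
          have h3 : ρ - 1 ≠ 0 := by linarith
          have h4 : 1 + ρ ≠ 0 := by linarith
          rw [pairCost_rrCurve hα hρ.le, twoPointCost,
            show ρ * ρ - 1 = (ρ - 1) * (1 + ρ) by ring]
          field_simp

theorem FiniteCost.sub {α : ℝ} {f g : ℝ → ℝ} (hf : FiniteCost α f) (hg : FiniteCost α g) :
    FiniteCost α fun t => f t - g t := by
  constructor
  · simp only [mul_sub]; exact hf.1.sub hg.1
  · simp only [mul_sub]; exact hf.2.sub hg.2

theorem pairCost_sub {α : ℝ} {f g f' g' : ℝ → ℝ} (hf : FiniteCost α f) (hg : FiniteCost α g)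
    (hf' : FiniteCost α f') (hg' : FiniteCost α g') :
    pairCost α (fun t => f t - f' t) (fun t => g t - g' t) =
      pairCost α f g - pairCost α f' g' := by
  simp only [pairCost, mul_sub]
  rw [integral_sub hf.1 hf'.1, integral_sub hg.2 hg'.2]
  ring

/-- A function that changes sign once, from negative to nonnegative, has a larger integral against
the weight `t ^ (α - 2)` than against `t ^ (-α - 1)` as soon as the latter is nonnegative. -/
theorem integral_le_of_single_crossing {α : ℝ} (hα : 1 < α) {w : ℝ → ℝ} (hw : FiniteCost α w)
    (hup : ∀ s t, 1 ≤ s → s ≤ t → 0 ≤ w s → 0 ≤ w t)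
    (h0 : 0 ≤ ∫ t in Set.Ioi (1 : ℝ), t ^ (-α - 1) * w t) :
    ∫ t in Set.Ioi (1 : ℝ), t ^ (-α - 1) * w t ≤ ∫ t in Set.Ioi (1 : ℝ), t ^ (α - 2) * w t := by
  set S : Set ℝ := {s | 1 ≤ s ∧ 0 ≤ w s}
  by_cases hS : S.Nonempty
  · set χ := sInf S
    have hb : BddBelow S := ⟨1, fun s hs => hs.1⟩
    have hχ : 1 ≤ χ := le_csInf hS fun s hs => hs.1
    have hχ0 : 0 < χ := by linarith
    have hpt : ∀ t ∈ Set.Ioi (1 : ℝ),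
        χ ^ (2 * α - 1) * (t ^ (-α - 1) * w t) ≤ t ^ (α - 2) * w t := by
      intro t ht
      have ht0 : 0 < t := by linarith [Set.mem_Ioi.1 ht]
      have ht1 : 1 ≤ t := le_of_lt ht
      have e : t ^ (α - 2) = t ^ (2 * α - 1) * t ^ (-α - 1) := by
        rw [← Real.rpow_add ht0]; congr 1; ring
      rw [e, mul_assoc]
      have hB := Real.rpow_pos_of_pos ht0 (-α - 1)
      -- The ratio of the two weights is `t ^ (2 * α - 1)`. Replacing it by its value at the
      -- crossing point `χ` can only lower the integrand: the ratio is smaller where `w < 0` and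
      -- larger where `w ≥ 0`.
      rcases lt_trichotomy t χ with hlt | rfl | hgt
      · have hneg : w t < 0 := by
          by_contra hc
          exact absurd (csInf_le hb (show t ∈ S from ⟨ht1, not_lt.1 hc⟩)) (not_le.2 hlt)
        refine mul_le_mul_of_nonpos_right
          (Real.rpow_le_rpow ht0.le hlt.le (by linarith)) ?_
        exact (mul_neg_of_pos_of_neg hB hneg).le
      · rfl
      · obtain ⟨s, hs, hst⟩ := exists_lt_of_csInf_lt hS hgt
        have hnn := hup s t hs.1 hst.le hs.2
        exact mul_le_mul_of_nonneg_right (Real.rpow_le_rpow hχ0.le hgt.le (by linarith))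
          (mul_nonneg hB.le hnn)
    calc _ ≤ χ ^ (2 * α - 1) * ∫ t in Set.Ioi (1 : ℝ), t ^ (-α - 1) * w t :=
          le_mul_of_one_le_left h0 (Real.one_le_rpow hχ (by linarith))
      _ = ∫ t in Set.Ioi (1 : ℝ), χ ^ (2 * α - 1) * (t ^ (-α - 1) * w t) := by
          rw [integral_const_mul]
      _ ≤ _ := setIntegral_mono_on (hw.2.const_mul _) hw.1 measurableSet_Ioi hpt
  · have hneg : ∀ t, 1 < t → w t < 0 := fun t ht => by
      by_contra hc
      exact hS ⟨t, ht.le, not_lt.1 hc⟩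
    exfalso
    have hpos : 0 < ∫ t in Set.Ioi (1 : ℝ), -(t ^ (-α - 1) * w t) := by
      have hp : ∀ t : ℝ, 1 < t → 0 < -(t ^ (-α - 1) * w t) := fun t ht => by
        have := Real.rpow_pos_of_pos (by linarith : 0 < t) (-α - 1)
        nlinarith [hneg t ht]
      have hi : IntegrableOn (fun t : ℝ => -(t ^ (-α - 1) * w t)) (Set.Ioi 1) := hw.2.neg
      refine (setIntegral_pos_iff_support_of_nonneg_ae ?_ hi).2 ?_
      · exact (ae_restrict_iff' measurableSet_Ioi).2 (.of_forall fun t ht => (hp t ht).le)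
      · have : Function.support (fun t : ℝ => -(t ^ (-α - 1) * w t)) ∩ Set.Ioi 1 = Set.Ioi 1 :=
          Set.inter_eq_right.2 fun t ht => (hp t ht).ne'
        rw [this]; simp
    rw [integral_neg] at hpos
    linarith

theorem integral_rpow_mul_mono_exponent {α : ℝ} (hα : 1 < α) {w : ℝ → ℝ} (hw : FiniteCost α w)
    (h0 : ∀ t, 1 < t → 0 ≤ w t) :
    ∫ t in Set.Ioi (1 : ℝ), t ^ (-α - 1) * w t ≤ ∫ t in Set.Ioi (1 : ℝ), t ^ (α - 2) * w t :=
  setIntegral_mono_on hw.2 hw.1 measurableSet_Ioi fun t ht =>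
    mul_le_mul_of_nonneg_right (Real.rpow_le_rpow_of_exponent_le (le_of_lt ht) (by linarith))
      (h0 t ht)

theorem pairCost_swap_sub {α : ℝ} {f g : ℝ → ℝ} (hf : FiniteCost α f) (hg : FiniteCost α g) :
    pairCost α g f - pairCost α f g =
      (∫ t in Set.Ioi (1 : ℝ), t ^ (α - 2) * (g t - f t)) -
        ∫ t in Set.Ioi (1 : ℝ), t ^ (-α - 1) * (g t - f t) := by
  simp only [pairCost, mul_sub]
  rw [integral_sub hg.1 hf.1, integral_sub hg.2 hf.2]
  ring

/-- When the heavier weight carries the shorter support, and that support is shorter than the one of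
randomized response, the cost is dominated by the swapped cost or by that of randomized response. -/
theorem HockeyPair.cost_le_swap_or {f g : ℝ → ℝ} (h : HockeyPair f g) {α ρ σ : ℝ}
    (hα : 1 < α) (hσ : 1 < σ) (hσρ : σ < ρ) (hf : ∀ t, σ ≤ t → f t = 0)
    (hfc : FiniteCost α f) (hgc : FiniteCost α g) :
    pairCost α f g ≤ pairCost α g f ∨ pairCost α f g ≤ pairCost α (rrCurve ρ) (rrCurve ρ) := by
  have cf := fun t (ht : 1 ≤ t) => chord_le h.convex_left hσ hf ht
  have hs : 0 < σ - 1 := by linarith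
  -- The threshold `(σ - 1) / (σ + 1)` is the height of randomized response of ratio `σ`. Above it,
  -- the chord bound on `f` and `le_add` give `f ≤ g`, so moving the heavier weight to `g` does not
  -- lower the cost.
  rcases le_total (σ - 1) (f 1 * (σ + 1)) with hD | hD
  · left
    rw [← sub_nonneg, pairCost_swap_sub hfc hgc, sub_nonneg]
    refine integral_rpow_mul_mono_exponent hα (hgc.sub hfc) fun t ht => ?_
    rcases le_total σ t with hσt | hσt
    · rw [hf t hσt, sub_zero]; exact h.nonneg_right t ht.le
    · have c1 := cf t ht.le
      have c2 := h.le_add t ht.le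
      rw [max_eq_left (by linarith), div_mul_eq_mul_div, le_div_iff₀ hs] at c1
      have : 0 ≤ (g t - f t) * (σ - 1) := by
        nlinarith [mul_le_mul_of_nonneg_right c2 hs.le,
          mul_nonneg (sub_nonneg.2 hD) (sub_nonneg.2 ht.le)]
      exact nonneg_of_mul_nonneg_left this hs
  · by_cases hL : pairCost α f g ≤ pairCost α (rrCurve ρ) (rrCurve ρ)
    · exact Or.inr hL
    left
    have hρ : 1 < ρ := hσ.trans hσρ
    have hDρ : f 1 * (ρ + 1) < ρ - 1 := by
      have : (σ + 1) * (f 1 * (ρ + 1)) < (σ + 1) * (ρ - 1) := by nlinarith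
      exact lt_of_mul_lt_mul_left this (by linarith)
    have hfr : ∀ t, 1 ≤ t → f t ≤ rrCurve ρ t := fun t ht =>
      (cf t ht).trans (chord_le_rrCurve hDρ.le hσ hσρ.le ht)
    have hrc := finiteCost_rrCurve α ρ
    have hsub := pairCost_sub hfc hgc hrc hrc
    -- Single crossing: `g` is convex and starts strictly below `rrCurve ρ`, which is affine up to
    -- `ρ` and zero afterwards.
    have hup : ∀ s t, 1 ≤ s → s ≤ t → 0 ≤ g s - rrCurve ρ s → 0 ≤ g t - rrCurve ρ t := by
      intro s t hs1 hst hws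
      rcases le_or_gt ρ t with hρt | hρt
      · rw [rrCurve, max_eq_right (by linarith), zero_div, sub_zero]
        exact h.nonneg_right t (by linarith)
      · have hρ1 : 0 < 1 + ρ := by linarith
        rw [rrCurve, max_eq_left (by linarith), sub_nonneg, div_le_iff₀ hρ1] at hws ⊢
        have hg1 : g 1 * (1 + ρ) < ρ - 1 := by rw [← h.eq_one]; linarith
        rcases eq_or_lt_of_le hs1 with rfl | hs1
        · linarith
        rcases eq_or_lt_of_le hst with rfl | hst
        · exact hws
        have ht1 : 0 < t - 1 := by linarith
        have := h.convex_right.2 (Set.mem_Ici.2 le_rfl) (Set.mem_Ici.2 (by linarith : 1 ≤ t))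
          (div_nonneg (by linarith) ht1.le : 0 ≤ (t - s) / (t - 1))
          (div_nonneg (by linarith) ht1.le : 0 ≤ (s - 1) / (t - 1))
          (by field_simp; ring)
        have e : ((t - s) / (t - 1)) • (1 : ℝ) + ((s - 1) / (t - 1)) • t = s := by
          simp only [smul_eq_mul]; field_simp; ring
        rw [e, smul_eq_mul, smul_eq_mul, div_mul_eq_mul_div, div_mul_eq_mul_div, ← add_div,
          le_div_iff₀ ht1] at this
        have q1 := mul_le_mul_of_nonneg_right this hρ1.le
        have q2 := mul_le_mul_of_nonneg_right hws ht1.le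
        have q3 := mul_lt_mul_of_pos_left hg1 (sub_pos.2 hst)
        have q4 : (s - 1) * (ρ - t) ≤ (s - 1) * (g t * (1 + ρ)) := by nlinarith
        exact le_of_mul_le_mul_left q4 (by linarith)
    have hgr := hgc.sub hrc
    -- Since `f ≤ rrCurve ρ`, any excess cost must come from the `g` term.
    have hB : 0 ≤ ∫ t in Set.Ioi (1 : ℝ), t ^ (-α - 1) * (g t - rrCurve ρ t) := by
      have h1 : ∫ t in Set.Ioi (1 : ℝ), t ^ (α - 2) * (f t - rrCurve ρ t) ≤ 0 := by
        refine setIntegral_nonpos measurableSet_Ioi fun t ht => ?_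
        have := Real.rpow_nonneg (by linarith [Set.mem_Ioi.1 ht] : 0 ≤ t) (α - 2)
        nlinarith [hfr t (le_of_lt ht)]
      have h2 : 0 < pairCost α (fun t => f t - rrCurve ρ t) (fun t => g t - rrCurve ρ t) := by
        rw [hsub]; linarith
      rw [pairCost] at h2
      linarith
    have hA := integral_le_of_single_crossing hα hgr hup hB
    have hF := integral_rpow_mul_mono_exponent hα (hrc.sub hfc)
      fun t ht => sub_nonneg.2 (hfr t ht.le)
    rw [← sub_nonneg, pairCost_swap_sub hfc hgc, sub_nonneg]
    -- Writing `g - f = (g - rrCurve ρ) + (rrCurve ρ - f)`, both summands have a larger integral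
    -- against the heavier weight.
    have e1 : ∀ e : ℝ, IntegrableOn (fun t : ℝ => t ^ e * (g t - rrCurve ρ t)) (Set.Ioi 1) →
        IntegrableOn (fun t : ℝ => t ^ e * (rrCurve ρ t - f t)) (Set.Ioi 1) →
        ∫ t in Set.Ioi (1 : ℝ), t ^ e * (g t - f t) =
          (∫ t in Set.Ioi (1 : ℝ), t ^ e * (g t - rrCurve ρ t)) +
            ∫ t in Set.Ioi (1 : ℝ), t ^ e * (rrCurve ρ t - f t) := by
      intro e i1 i2
      rw [← integral_add i1 i2]
      congr 1; ext t; ring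
    rw [e1 _ hgr.1 (hrc.sub hfc).1, e1 _ hgr.2 (hrc.sub hfc).2]
    linarith

/-- If the larger of the two costs exceeds that of randomized response, then so does its slope. -/
theorem HockeyPair.slope_le {f g : ℝ → ℝ} (h : HockeyPair f g) {α ρ σ ς : ℝ}
    (hα : 1 < α) (hρ : 1 < ρ) (hσ : 1 < σ) (hς : 1 < ς) (hf : ∀ t, σ ≤ t → f t = 0)
    (hg : ∀ t, ς ≤ t → g t = 0) (hfc : FiniteCost α f) (hgc : FiniteCost α g)
    (hL : pairCost α (rrCurve ρ) (rrCurve ρ) < max (pairCost α f g) (pairCost α g f)) :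
    (pairCost α g f ≤ pairCost α f g ∧ slopeMoment (α - 2) ρ + slopeMoment (-α - 1) ρ ≤
      slopeMoment (α - 2) σ + slopeMoment (-α - 1) ς) ∨
    (pairCost α f g ≤ pairCost α g f ∧ slopeMoment (α - 2) ρ + slopeMoment (-α - 1) ρ ≤
      slopeMoment (α - 2) ς + slopeMoment (-α - 1) σ) := by
  -- Exchanging the two curves exchanges the two alternatives.
  wlog hςσ : ς ≤ σ generalizing f g σ ς
  · exact (this h.symm hς hσ hg hf hgc hfc (by rwa [max_comm]) (le_of_not_ge hςσ)).symm
  rcases le_or_gt (pairCost α g f) (pairCost α f g) with hle | hlt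
  · left
    refine ⟨hle, ?_⟩
    rw [max_eq_left hle] at hL
    by_contra hc
    exact absurd (h.cost_le_of_slope_le hα hρ hσ hς hf hg hfc hgc hςσ (not_le.1 hc)) (not_le.2 hL)
  · right
    refine ⟨hlt.le, ?_⟩
    rw [max_eq_right hlt.le] at hL
    by_contra hc
    -- Here the costlier order puts the heavier weight on the curve `g`, whose support is the
    -- shorter one unless `ς = σ`.
    rcases eq_or_lt_of_le hςσ with rfl | hςσ
    · exact absurd (h.symm.cost_le_of_slope_le hα hρ hς hσ hg hf hgc hfc le_rfl (not_le.1 hc))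
        (not_le.2 hL)
    · have hςρ : ς < ρ := by
        by_contra hc'
        have := slopeMoment_mono (e := α - 2) (by linarith) (by linarith) hρ.le (not_lt.1 hc')
        have := slopeMoment_mono (e := -α - 1) (by linarith) (by linarith) hρ.le
          ((not_lt.1 hc').trans hςσ.le)
        linarith
      rcases h.symm.cost_le_swap_or hα hς hςρ hg hgc hfc with h1 | h1 <;> linarith

/-! ### Tilted curves and the effect of the tilt on the cost. -/

/-- The hockey-stick curve after noise of strength `τ`, up to normalization. -/
def tilt (f : ℝ → ℝ) (τ t : ℝ) : ℝ := max (f t - τ * (t - 1)) 0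

theorem tilt_nonneg (f : ℝ → ℝ) (τ t : ℝ) : 0 ≤ tilt f τ t := le_max_right _ _

theorem tilt_anti {f : ℝ → ℝ} {τ τ' t : ℝ} (h : τ' ≤ τ) (ht : 1 ≤ t) :
    tilt f τ t ≤ tilt f τ' t :=
  max_le_max (by nlinarith) le_rfl

theorem tilt_zero {f : ℝ → ℝ} {t : ℝ} (h : 0 ≤ f t) : tilt f 0 t = f t := by
  rw [tilt, zero_mul, sub_zero, max_eq_left h]

theorem tilt_le {f : ℝ → ℝ} {τ t : ℝ} (hτ : 0 ≤ τ) (ht : 1 ≤ t) (h : 0 ≤ f t) :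
    tilt f τ t ≤ f t :=
  (tilt_anti hτ ht).trans_eq (tilt_zero h)

theorem continuousOn_tilt {f : ℝ → ℝ} (hf : ContinuousOn f (Set.Ici 1)) (τ : ℝ) :
    ContinuousOn (tilt f τ) (Set.Ici 1) := by
  unfold tilt; fun_prop

theorem aestronglyMeasurable_rpow_mul {f : ℝ → ℝ} (hf : ContinuousOn f (Set.Ici 1)) (e : ℝ) :
    AEStronglyMeasurable (fun t : ℝ => t ^ e * f t) (volume.restrict (Set.Ioi 1)) :=
  (((continuousOn_rpow_Ici e).mul hf).mono Set.Ioi_subset_Ici_self).aestronglyMeasurable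
    measurableSet_Ioi

theorem integrableOn_rpow_mul_mono {e : ℝ} {f f' : ℝ → ℝ}
    (hf : IntegrableOn (fun t : ℝ => t ^ e * f t) (Set.Ioi 1))
    (hc : ContinuousOn f' (Set.Ici 1)) (h0 : ∀ t, 1 < t → 0 ≤ f' t)
    (h1 : ∀ t, 1 < t → f' t ≤ f t) :
    IntegrableOn (fun t : ℝ => t ^ e * f' t) (Set.Ioi 1) := by
  refine Integrable.mono' hf (aestronglyMeasurable_rpow_mul hc e)
    ((ae_restrict_iff' measurableSet_Ioi).2 (.of_forall fun t ht => ?_))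
  have hp : 0 ≤ t ^ e := Real.rpow_nonneg (by linarith [Set.mem_Ioi.1 ht]) e
  rw [Real.norm_of_nonneg (mul_nonneg hp (h0 t ht))]
  exact mul_le_mul_of_nonneg_left (h1 t ht) hp

theorem FiniteCost.mono {α : ℝ} {f f' : ℝ → ℝ} (hf : FiniteCost α f)
    (hc : ContinuousOn f' (Set.Ici 1)) (h0 : ∀ t, 1 < t → 0 ≤ f' t)
    (h1 : ∀ t, 1 < t → f' t ≤ f t) : FiniteCost α f' :=
  ⟨integrableOn_rpow_mul_mono hf.1 hc h0 h1, integrableOn_rpow_mul_mono hf.2 hc h0 h1⟩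

theorem FiniteCost.tilt {α : ℝ} {f : ℝ → ℝ} (hf : FiniteCost α f)
    (hc : ContinuousOn f (Set.Ici 1)) (h0 : ∀ t, 1 ≤ t → 0 ≤ f t) {τ : ℝ} (hτ : 0 ≤ τ) :
    FiniteCost α (tilt f τ) :=
  hf.mono (continuousOn_tilt hc τ) (fun t _ => tilt_nonneg f τ t)
    fun t ht => tilt_le hτ ht.le (h0 t ht.le)

theorem FiniteCost.const_mul {α : ℝ} {f : ℝ → ℝ} (hf : FiniteCost α f) (c : ℝ) :
    FiniteCost α fun t => c * f t := by
  constructor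
  · simp only [mul_left_comm _ c]; exact hf.1.const_mul c
  · simp only [mul_left_comm _ c]; exact hf.2.const_mul c

theorem pairCost_const_mul (α c : ℝ) (f g : ℝ → ℝ) :
    pairCost α (fun t => c * f t) (fun t => c * g t) = c * pairCost α f g := by
  simp only [pairCost, mul_left_comm _ c, integral_const_mul, mul_add]

theorem pairCost_congr {α : ℝ} {f g f' g' : ℝ → ℝ} (h : ∀ t, 1 < t → f t = f' t)
    (h' : ∀ t, 1 < t → g t = g' t) : pairCost α f g = pairCost α f' g' := by
  unfold pairCost
  congr 1
  · exact setIntegral_congr_fun measurableSet_Ioi fun t ht => by simp only [h t ht]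
  · exact setIntegral_congr_fun measurableSet_Ioi fun t ht => by simp only [h' t ht]

/-- Lowering `τ` raises the integral at least at the rate given by the support. -/
theorem integral_tilt_add_slope_le {e : ℝ} (he1 : e + 1 ≠ 0) (he2 : e + 2 ≠ 0) {f : ℝ → ℝ}
    {τ τ' σ : ℝ} (hτ : τ' ≤ τ) (hσ : 1 ≤ σ) (hpos : ∀ t, 1 ≤ t → t ≤ σ → 0 ≤ f t - τ * (t - 1))
    (hi : IntegrableOn (fun t : ℝ => t ^ e * tilt f τ t) (Set.Ioi 1))
    (hi' : IntegrableOn (fun t : ℝ => t ^ e * tilt f τ' t) (Set.Ioi 1)) :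
    (∫ t in Set.Ioi (1 : ℝ), t ^ e * tilt f τ t) + (τ - τ') * slopeMoment e σ ≤
      ∫ t in Set.Ioi (1 : ℝ), t ^ e * tilt f τ' t := by
  rw [← le_sub_iff_add_le', ← integral_sub hi' hi, ← integral_rpow_mul_sub_one he1 he2 hσ,
    intervalIntegral.integral_of_le hσ, ← integral_const_mul]
  have hnn : ∀ t : ℝ, 1 < t → 0 ≤ t ^ e := fun t ht => Real.rpow_nonneg (by linarith) e
  calc ∫ t in Set.Ioc 1 σ, (τ - τ') * (t ^ e * (t - 1))
      ≤ ∫ t in Set.Ioc 1 σ, (t ^ e * tilt f τ' t - t ^ e * tilt f τ t) := by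
        refine setIntegral_mono_on ?_ ((hi'.sub hi).mono_set Set.Ioc_subset_Ioi_self)
          measurableSet_Ioc fun t ht => ?_
        · refine IntegrableOn.mono_set (ContinuousOn.integrableOn_Icc ?_) Set.Ioc_subset_Icc_self
          exact continuousOn_const.mul (((continuousOn_rpow_Ici e).mono fun t ht => ht.1).mul
            (by fun_prop))
        · have h1 := hpos t ht.1.le ht.2
          have h2 : tilt f τ t = f t - τ * (t - 1) := max_eq_left h1
          have h3 : f t - τ' * (t - 1) ≤ tilt f τ' t := le_max_left _ _
          have := hnn t ht.1
          rw [← mul_sub, mul_left_comm]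
          refine mul_le_mul_of_nonneg_left ?_ this
          rw [h2]; linarith
    _ ≤ _ := by
        refine setIntegral_mono_set (hi'.sub hi) ?_ (Set.Ioc_subset_Ioi_self.eventuallyLE)
        refine (ae_restrict_iff' measurableSet_Ioi).2 (.of_forall fun t ht => ?_)
        simp only [Pi.zero_apply, ← mul_sub]
        exact mul_nonneg (hnn t ht) (sub_nonneg.2 (tilt_anti hτ (le_of_lt ht)))

/-- Lowering `τ` raises the integral at most at the rate given by the larger support. -/
theorem integral_tilt_le_add_slope {e : ℝ} (he1 : e + 1 ≠ 0) (he2 : e + 2 ≠ 0) {f : ℝ → ℝ}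
    {τ τ' σ : ℝ} (hτ : τ' ≤ τ) (hσ : 1 ≤ σ) (hpos : ∀ t, 1 ≤ t → t ≤ σ → 0 ≤ f t - τ' * (t - 1))
    (hz : ∀ t, σ ≤ t → f t - τ' * (t - 1) ≤ 0)
    (hi : IntegrableOn (fun t : ℝ => t ^ e * tilt f τ t) (Set.Ioi 1))
    (hi' : IntegrableOn (fun t : ℝ => t ^ e * tilt f τ' t) (Set.Ioi 1)) :
    (∫ t in Set.Ioi (1 : ℝ), t ^ e * tilt f τ' t) ≤
      (∫ t in Set.Ioi (1 : ℝ), t ^ e * tilt f τ t) + (τ - τ') * slopeMoment e σ := by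
  rw [← sub_le_iff_le_add', ← integral_sub hi' hi, ← integral_rpow_mul_sub_one he1 he2 hσ,
    intervalIntegral.integral_of_le hσ, ← integral_const_mul]
  rw [setIntegral_eq_of_subset_of_forall_sdiff_eq_zero measurableSet_Ioi
    (Set.Ioc_subset_Ioi_self : Set.Ioc 1 σ ⊆ Set.Ioi 1)]
  · refine setIntegral_mono_on ((hi'.sub hi).mono_set Set.Ioc_subset_Ioi_self) ?_
      measurableSet_Ioc fun t ht => ?_
    · refine IntegrableOn.mono_set (ContinuousOn.integrableOn_Icc ?_) Set.Ioc_subset_Icc_self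
      exact continuousOn_const.mul (((continuousOn_rpow_Ici e).mono fun t ht => ht.1).mul
        (by fun_prop))
    · have h1 := hpos t ht.1.le ht.2
      have h2 : tilt f τ' t = f t - τ' * (t - 1) := max_eq_left h1
      have h3 : f t - τ * (t - 1) ≤ tilt f τ t := le_max_left _ _
      have : 0 ≤ t ^ e := Real.rpow_nonneg (by linarith [ht.1]) e
      rw [← mul_sub, mul_left_comm]
      refine mul_le_mul_of_nonneg_left ?_ this
      rw [h2]; linarith
  · intro t ht
    have hσt : σ ≤ t := by
      by_contra h
      exact ht.2 ⟨ht.1, (not_le.1 h).le⟩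
    have h1 : tilt f τ' t = 0 := max_eq_right (hz t hσt)
    have h2 : tilt f τ t = 0 :=
      le_antisymm ((tilt_anti hτ (hσ.trans hσt)).trans_eq h1) (tilt_nonneg _ _ _)
    rw [h1, h2, sub_self]

/-- For antitone `f` the tilted difference is strictly decreasing, positive at `1` and nonpositive
at `1 + f 1 / τ`; `σ` is its zero. -/
theorem exists_tilt_support {f : ℝ → ℝ} (hc : ContinuousOn f (Set.Ici 1))
    (ha : AntitoneOn f (Set.Ici 1)) (h1 : 0 < f 1) {τ : ℝ} (hτ : 0 < τ) :
    ∃ σ, 1 < σ ∧ (∀ t, 1 ≤ t → t ≤ σ → 0 ≤ f t - τ * (t - 1)) ∧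
      ∀ t, σ ≤ t → f t - τ * (t - 1) ≤ 0 := by
  have hb : 1 ≤ 1 + f 1 / τ := by have := div_pos h1 hτ; linarith
  have hend : f (1 + f 1 / τ) - τ * (1 + f 1 / τ - 1) ≤ 0 := by
    have : f (1 + f 1 / τ) ≤ f 1 := ha (Set.mem_Ici.2 le_rfl) hb hb
    have e : τ * (1 + f 1 / τ - 1) = f 1 := by field_simp; ring
    rw [e]; linarith
  have hcont : ContinuousOn (fun t => f t - τ * (t - 1)) (Set.Icc 1 (1 + f 1 / τ)) :=
    (hc.mono fun t ht => ht.1).sub (by fun_prop)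
  have hmem : (0 : ℝ) ∈ Set.Icc (f (1 + f 1 / τ) - τ * (1 + f 1 / τ - 1))
      (f 1 - τ * (1 - 1)) := ⟨hend, by simpa using h1.le⟩
  obtain ⟨σ, hσ, h0⟩ := intermediate_value_Icc' hb hcont hmem
  simp only at h0
  refine ⟨σ, ?_, fun t ht hts => ?_, fun t hst => ?_⟩
  · refine lt_of_le_of_ne hσ.1 fun h => ?_
    rw [← h] at h0; simp at h0; linarith
  · have := ha (Set.mem_Ici.2 ht) (Set.mem_Ici.2 hσ.1) hts
    nlinarith
  · have := ha (Set.mem_Ici.2 hσ.1) (Set.mem_Ici.2 (hσ.1.trans hst)) hst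
    nlinarith

/-- The factor `1 + 2 * τ` is dictated by `le_add`: the two tilts together subtract `2 * τ * (t -
1)`, in addition to the `t - 1` already there. -/
theorem HockeyPair.normalized_tilt {f g : ℝ → ℝ} (h : HockeyPair f g) {τ : ℝ} (hτ : 0 ≤ τ) :
    HockeyPair (fun t => (1 + 2 * τ)⁻¹ * tilt f τ t) (fun t => (1 + 2 * τ)⁻¹ * tilt g τ t) := by
  have hκ : 0 < 1 + 2 * τ := by linarith
  have hκ' : 0 ≤ (1 + 2 * τ)⁻¹ := (inv_pos.2 hκ).le
  have hcv : ∀ f : ℝ → ℝ, ConvexOn ℝ (Set.Ici 1) f →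
      ConvexOn ℝ (Set.Ici 1) fun t => (1 + 2 * τ)⁻¹ * tilt f τ t := by
    intro f hf
    have hl : ConvexOn ℝ (Set.Ici 1) fun t : ℝ => -τ * t + τ := by
      refine ⟨convex_Ici 1, fun x _ y _ a b _ _ hab => ?_⟩
      simp only [smul_eq_mul]
      have : τ = (a + b) * τ := by rw [hab, one_mul]
      nlinarith
    have h2 : ConvexOn ℝ (Set.Ici 1) (tilt f τ) := by
      have := (hf.add hl).sup (convexOn_const (0 : ℝ) (convex_Ici 1))
      refine this.congr fun t _ => ?_
      simp only [Pi.sup_apply, Pi.add_apply, tilt]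
      congr 1; ring
    exact h2.smul hκ'
  have e1 : ∀ f : ℝ → ℝ, 0 ≤ f 1 → tilt f τ 1 = f 1 := fun f hf => by
    rw [tilt, sub_self, mul_zero, sub_zero, max_eq_left hf]
  refine ⟨hcv f h.convex_left, hcv g h.convex_right,
    fun t _ => mul_nonneg hκ' (tilt_nonneg _ _ _), fun t _ => mul_nonneg hκ' (tilt_nonneg _ _ _),
    ?_, fun t ht => ?_⟩
  · rw [e1 f (h.nonneg_left 1 le_rfl), e1 g (h.nonneg_right 1 le_rfl), h.eq_one]
  · rw [e1 f (h.nonneg_left 1 le_rfl)]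
    have i1 : f t - τ * (t - 1) ≤ tilt f τ t := le_max_left _ _
    have i2 : g t - τ * (t - 1) ≤ tilt g τ t := le_max_left _ _
    have i3 := h.le_add t ht
    have e : (1 + 2 * τ)⁻¹ * f 1 * (1 + t) - (t - 1) =
        (1 + 2 * τ)⁻¹ * (f 1 * (1 + t) - (1 + 2 * τ) * (t - 1)) := by field_simp
    rw [e, ← mul_add]
    refine mul_le_mul_of_nonneg_left ?_ hκ'
    linarith

/-- The likelihood ratio of randomized response after noise of strength `τ`. -/
def noisyRatio (R τ : ℝ) : ℝ := (R + τ * (1 + R)) / (1 + τ * (1 + R))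

theorem one_lt_noisyRatio {R τ : ℝ} (hR : 1 < R) (hτ : 0 ≤ τ) : 1 < noisyRatio R τ := by
  have : 0 ≤ τ * (1 + R) := mul_nonneg hτ (by linarith)
  rw [noisyRatio, lt_div_iff₀ (by linarith)]; linarith

theorem rrCurve_sub_eq {R τ t : ℝ} (hR : 1 < R) (hτ : 0 ≤ τ) (ht : t ≤ R) :
    rrCurve R t - τ * (t - 1) =
      (1 + 2 * τ) * ((noisyRatio R τ - t) / (1 + noisyRatio R τ)) := by
  have h1 : 0 ≤ τ * (1 + R) := mul_nonneg hτ (by linarith)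
  have h2 : 1 + τ * (1 + R) ≠ 0 := by linarith
  have h3 : 1 + R ≠ 0 := by linarith
  have h4 : 1 + noisyRatio R τ = (1 + R) * (1 + 2 * τ) / (1 + τ * (1 + R)) := by
    rw [noisyRatio]; field_simp; ring
  have h5 : 1 + 2 * τ ≠ 0 := by linarith
  rw [h4, rrCurve, max_eq_left (by linarith), noisyRatio]
  field_simp
  ring

theorem noisyRatio_le {R τ : ℝ} (hR : 1 < R) (hτ : 0 ≤ τ) : noisyRatio R τ ≤ R := by
  have : 0 ≤ τ * (1 + R) := mul_nonneg hτ (by linarith)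
  rw [noisyRatio, div_le_iff₀ (by linarith)]
  nlinarith

theorem rrCurve_sub_nonneg {R τ t : ℝ} (hR : 1 < R) (hτ : 0 ≤ τ) (ht : t ≤ noisyRatio R τ) :
    0 ≤ rrCurve R t - τ * (t - 1) := by
  rw [rrCurve_sub_eq hR hτ (ht.trans (noisyRatio_le hR hτ))]
  have := one_lt_noisyRatio hR hτ
  exact mul_nonneg (by linarith) (div_nonneg (by linarith) (by linarith))

theorem rrCurve_sub_nonpos {R τ t : ℝ} (hR : 1 < R) (hτ : 0 ≤ τ) (ht : noisyRatio R τ ≤ t) :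
    rrCurve R t - τ * (t - 1) ≤ 0 := by
  have h1 := one_lt_noisyRatio hR hτ
  rcases le_total t R with h | h
  · rw [rrCurve_sub_eq hR hτ h]
    exact mul_nonpos_of_nonneg_of_nonpos (by linarith)
      (div_nonpos_of_nonpos_of_nonneg (by linarith) (by linarith))
  · rw [rrCurve, max_eq_right (by linarith), zero_div]
    nlinarith

/-- Subtracting a line from the affine piece of `rrCurve R` moves its zero to `noisyRatio R τ`; the
leftover factor is the one of `HockeyPair.normalized_tilt`. -/
theorem tilt_rrCurve {R τ : ℝ} (hR : 1 < R) (hτ : 0 ≤ τ) (t : ℝ) :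
    tilt (rrCurve R) τ t = (1 + 2 * τ) * rrCurve (noisyRatio R τ) t := by
  rcases le_total t (noisyRatio R τ) with h | h
  · rw [tilt, max_eq_left (rrCurve_sub_nonneg hR hτ h),
      rrCurve_sub_eq hR hτ (h.trans (noisyRatio_le hR hτ)), rrCurve, max_eq_left (by linarith)]
  · rw [tilt, max_eq_right (rrCurve_sub_nonpos hR hτ h), rrCurve, max_eq_right (by linarith),
      zero_div, mul_zero]

theorem continuous_rrCurve (R : ℝ) : Continuous (rrCurve R) := by
  unfold rrCurve; fun_prop

theorem continuousOn_integral_tilt {e : ℝ} {f : ℝ → ℝ} (hc : ContinuousOn f (Set.Ici 1))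
    (h0 : ∀ t, 1 ≤ t → 0 ≤ f t) (hi : IntegrableOn (fun t : ℝ => t ^ e * f t) (Set.Ioi 1)) :
    ContinuousOn (fun τ => ∫ t in Set.Ioi (1 : ℝ), t ^ e * tilt f τ t) (Set.Ici 0) := by
  refine continuousOn_of_dominated (bound := fun t => t ^ e * f t)
    (fun τ _ => aestronglyMeasurable_rpow_mul (continuousOn_tilt hc τ) e) (fun τ hτ => ?_) hi
    (.of_forall fun t => ?_)
  · refine (ae_restrict_iff' measurableSet_Ioi).2 (.of_forall fun t ht => ?_)
    have hp : 0 ≤ t ^ e := Real.rpow_nonneg (by linarith [Set.mem_Ioi.1 ht]) e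
    rw [Real.norm_of_nonneg (mul_nonneg hp (tilt_nonneg _ _ _))]
    exact mul_le_mul_of_nonneg_left (tilt_le hτ (le_of_lt ht) (h0 t (le_of_lt ht))) hp
  · unfold tilt; fun_prop

theorem continuousOn_pairCost_tilt {α : ℝ} {f g : ℝ → ℝ} (hfc : ContinuousOn f (Set.Ici 1))
    (hgc : ContinuousOn g (Set.Ici 1)) (hf0 : ∀ t, 1 ≤ t → 0 ≤ f t) (hg0 : ∀ t, 1 ≤ t → 0 ≤ g t)
    (hf : FiniteCost α f) (hg : FiniteCost α g) :
    ContinuousOn (fun τ => pairCost α (tilt f τ) (tilt g τ)) (Set.Ici 0) :=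
  (continuousOn_integral_tilt hfc hf0 hf.1).add (continuousOn_integral_tilt hgc hg0 hg.2)

theorem pairCost_tilt_add_slope_le {α : ℝ} (hα : 1 < α) {f g : ℝ → ℝ}
    {τ τ' σ ς : ℝ} (hτ : τ' ≤ τ) (hσ : 1 ≤ σ) (hς : 1 ≤ ς)
    (hf : ∀ t, 1 ≤ t → t ≤ σ → 0 ≤ f t - τ * (t - 1))
    (hg : ∀ t, 1 ≤ t → t ≤ ς → 0 ≤ g t - τ * (t - 1))
    (hfi : FiniteCost α (tilt f τ)) (hgi : FiniteCost α (tilt g τ))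
    (hfi' : FiniteCost α (tilt f τ')) (hgi' : FiniteCost α (tilt g τ')) :
    pairCost α (tilt f τ) (tilt g τ) +
        (τ - τ') * (slopeMoment (α - 2) σ + slopeMoment (-α - 1) ς) ≤
      pairCost α (tilt f τ') (tilt g τ') := by
  have h1 := integral_tilt_add_slope_le (e := α - 2) (by linarith) (by linarith) hτ hσ hf
    hfi.1 hfi'.1
  have h2 := integral_tilt_add_slope_le (e := -α - 1) (by linarith) (by linarith) hτ hς hg
    hgi.2 hgi'.2
  rw [pairCost, pairCost]; linarith

theorem pairCost_tilt_rrCurve_le {α R τ τ' : ℝ} (hα : 1 < α) (hR : 1 < R) (hτ' : 0 ≤ τ')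
    (hτ : τ' ≤ τ) :
    pairCost α (tilt (rrCurve R) τ') (tilt (rrCurve R) τ') ≤
      pairCost α (tilt (rrCurve R) τ) (tilt (rrCurve R) τ) +
        (τ - τ') * (slopeMoment (α - 2) (noisyRatio R τ') +
          slopeMoment (-α - 1) (noisyRatio R τ')) := by
  have hfi : ∀ τ, 0 ≤ τ → FiniteCost α (tilt (rrCurve R) τ) := fun τ hτ =>
    (finiteCost_rrCurve α R).tilt (continuous_rrCurve R).continuousOn
      (fun t _ => rrCurve_nonneg hR.le t) hτ
  have hσ := (one_lt_noisyRatio hR hτ').le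
  have h1 := integral_tilt_le_add_slope (e := α - 2) (by linarith) (by linarith) hτ hσ
    (fun t _ => rrCurve_sub_nonneg hR hτ') (fun t => rrCurve_sub_nonpos hR hτ')
    (hfi τ (hτ'.trans hτ)).1 (hfi τ' hτ').1
  have h2 := integral_tilt_le_add_slope (e := -α - 1) (by linarith) (by linarith) hτ hσ
    (fun t _ => rrCurve_sub_nonneg hR hτ') (fun t => rrCurve_sub_nonpos hR hτ')
    (hfi τ (hτ'.trans hτ)).2 (hfi τ' hτ').2
  rw [pairCost, pairCost]; linarith

/-! ### Tilting preserves domination by randomized response. -/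

/-- Noise preserves the domination of a pair by randomized response. -/
theorem HockeyPair.pairCost_tilt_le {f g : ℝ → ℝ} (h : HockeyPair f g) {α R : ℝ} (hα : 1 < α)
    (hR : 1 ≤ R) (hfc : ContinuousOn f (Set.Ici 1)) (hgc : ContinuousOn g (Set.Ici 1))
    (hfa : AntitoneOn f (Set.Ici 1)) (hga : AntitoneOn g (Set.Ici 1))
    (hf : FiniteCost α f) (hg : FiniteCost α g)
    (hfg : pairCost α f g ≤ pairCost α (rrCurve R) (rrCurve R))
    (hgf : pairCost α g f ≤ pairCost α (rrCurve R) (rrCurve R)) {τ₀ : ℝ} (hτ₀ : 0 ≤ τ₀) :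
    pairCost α (tilt f τ₀) (tilt g τ₀) ≤
      pairCost α (tilt (rrCurve R) τ₀) (tilt (rrCurve R) τ₀) := by
  have hft : ∀ τ, 0 ≤ τ → FiniteCost α (tilt f τ) := fun τ => hf.tilt hfc h.nonneg_left
  have hgt : ∀ τ, 0 ≤ τ → FiniteCost α (tilt g τ) := fun τ => hg.tilt hgc h.nonneg_right
  rcases eq_or_lt_of_le hR with rfl | hR
  -- For `R = 1` randomized response has zero cost, so the pair starts with nonpositive cost, and
  -- tilting only lowers it.
  · have z : ∀ t : ℝ, 1 < t → rrCurve 1 t = 0 := fun t ht => by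
      rw [rrCurve, max_eq_right (by linarith), zero_div]
    have z' : ∀ t : ℝ, 1 < t → tilt (rrCurve 1) τ₀ t = 0 := fun t ht =>
      max_eq_right (by rw [z t ht]; nlinarith)
    rw [pairCost_congr z' z', ← pairCost_congr z z]
    exact (pairCost_mono (hft τ₀ hτ₀) (hgt τ₀ hτ₀) hf hg
      (fun t ht => tilt_le hτ₀ ht.le (h.nonneg_left t ht.le))
      (fun t ht => tilt_le hτ₀ ht.le (h.nonneg_right t ht.le))).trans hfg
  have tz : ∀ f : ℝ → ℝ, (∀ t, 1 ≤ t → 0 ≤ f t) → ∀ t, 1 < t → tilt f 0 t = f t :=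
    fun f hf t ht => tilt_zero (hf t ht.le)
  set I : ℝ → ℝ := fun τ => pairCost α (tilt f τ) (tilt g τ)
  set I' : ℝ → ℝ := fun τ => pairCost α (tilt g τ) (tilt f τ)
  set L : ℝ → ℝ := fun τ => pairCost α (tilt (rrCurve R) τ) (tilt (rrCurve R) τ)
  set n : ℝ → ℝ := fun τ =>
    slopeMoment (α - 2) (noisyRatio R τ) + slopeMoment (-α - 1) (noisyRatio R τ)
  set Φ : ℝ → ℝ := fun τ => max (I τ) (I' τ) - L τ
  have hΦ0 : Φ 0 ≤ 0 := by
    simp only [Φ, I, I', L, sub_nonpos]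
    rw [pairCost_congr (tz _ h.nonneg_left) (tz _ h.nonneg_right),
      pairCost_congr (tz _ h.nonneg_right) (tz _ h.nonneg_left),
      pairCost_congr (tz _ fun t _ => rrCurve_nonneg hR.le t)
        (tz _ fun t _ => rrCurve_nonneg hR.le t)]
    exact max_le hfg hgf
  suffices hmain : Φ τ₀ ≤ 0 by
    have : I τ₀ - L τ₀ ≤ Φ τ₀ := sub_le_sub_right (le_max_left _ _) _
    have h2 : I τ₀ ≤ L τ₀ := by linarith
    exact h2
  by_contra hcon
  have hpos : 0 < Φ τ₀ := not_le.1 hcon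
  have hτpos : 0 < τ₀ := lt_of_le_of_ne hτ₀ fun h0 => by rw [← h0] at hpos; linarith
  have hΦc : ContinuousOn Φ (Set.Ici 0) := by
    have c1 := continuousOn_pairCost_tilt hfc hgc h.nonneg_left h.nonneg_right hf hg
    have c2 := continuousOn_pairCost_tilt hgc hfc h.nonneg_right h.nonneg_left hg hf
    have c3 := continuousOn_pairCost_tilt (α := α) (continuous_rrCurve R).continuousOn
      (continuous_rrCurve R).continuousOn (fun t _ => rrCurve_nonneg hR.le t)
      (fun t _ => rrCurve_nonneg hR.le t) (finiteCost_rrCurve α R) (finiteCost_rrCurve α R)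
    exact (ContinuousOn.sup c1 c2).sub c3
  have hnc : ∀ τ, 0 < τ → ContinuousAt n τ := by
    intro τ hτ
    have h1 : ContinuousAt (noisyRatio R) τ := by
      have : 0 ≤ τ * (1 + R) := mul_nonneg hτ.le (by linarith)
      unfold noisyRatio
      exact ContinuousAt.div (by fun_prop) (by fun_prop) (by linarith)
    have h2 := one_lt_noisyRatio hR hτ.le
    exact ((hasDerivAt_slopeMoment (e := α - 2) (by linarith) (by linarith)
      (by linarith)).continuousAt.comp h1).add
      ((hasDerivAt_slopeMoment (e := -α - 1) (by linarith) (by linarith)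
      (by linarith)).continuousAt.comp h1)
  -- Going down from `τ` to `τ'`, the costlier order gains at least its slope at `τ`, which is at
  -- least `n τ` because `Φ τ > 0`, while randomized response gains at most `n τ'`, its slope at the
  -- lower end.
  have hstep : ∀ τ, 0 < τ → 0 < Φ τ → ∀ τ', 0 ≤ τ' → τ' ≤ τ →
      Φ τ + (τ - τ') * (n τ - n τ') ≤ Φ τ' := by
    intro τ hτ hΦτ τ' hτ' hle
    have hL := pairCost_tilt_rrCurve_le hα hR hτ' hle
    have hκ : 0 < 1 + 2 * τ := by linarith
    -- With `f 1 = 0` both tilted curves vanish for `t > 1` and no excess is possible.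
    have hf1 : 0 < f 1 := by
      by_contra hc
      have hf0 : f 1 = 0 := le_antisymm (not_lt.1 hc) (h.nonneg_left 1 le_rfl)
      have zf : ∀ t : ℝ, 1 < t → tilt f τ t = 0 := fun t ht =>
        le_antisymm (((tilt_le hτ.le ht.le (h.nonneg_left t ht.le)).trans
          (hfa (Set.mem_Ici.2 le_rfl) (Set.mem_Ici.2 ht.le) ht.le)).trans_eq hf0)
          (tilt_nonneg _ _ _)
      have zg : ∀ t : ℝ, 1 < t → tilt g τ t = 0 := fun t ht =>
        le_antisymm (((tilt_le hτ.le ht.le (h.nonneg_right t ht.le)).trans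
          (hga (Set.mem_Ici.2 le_rfl) (Set.mem_Ici.2 ht.le) ht.le)).trans_eq
            (h.eq_one.symm.trans hf0)) (tilt_nonneg _ _ _)
      have hLn : 0 ≤ L τ := by
        have nn : ∀ e : ℝ, 0 ≤ ∫ t in Set.Ioi (1 : ℝ), t ^ e * tilt (rrCurve R) τ t := fun e =>
          setIntegral_nonneg measurableSet_Ioi fun t ht =>
            mul_nonneg (Real.rpow_nonneg (by linarith [Set.mem_Ioi.1 ht]) e) (tilt_nonneg _ _ _)
        exact add_nonneg (nn _) (nn _)
      have e1 : I τ = 0 := by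
        simp only [I]; rw [pairCost_congr zf zg]; simp [pairCost]
      have e2 : I' τ = 0 := by
        simp only [I']; rw [pairCost_congr zg zf]; simp [pairCost]
      simp only [Φ, e1, e2, max_self] at hΦτ
      linarith
    obtain ⟨σ, hσ, hσp, hσz⟩ := exists_tilt_support hfc hfa hf1 hτ
    obtain ⟨ς, hς, hςp, hςz⟩ := exists_tilt_support hgc hga (h.eq_one ▸ hf1) hτ
    -- After division by `1 + 2 * τ` the excess is one over randomized response of ratio `noisyRatio
    -- R τ`, which is the form used by `HockeyPair.slope_le`.
    have hlt : pairCost α (rrCurve (noisyRatio R τ)) (rrCurve (noisyRatio R τ)) <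
        max (pairCost α (fun t => (1 + 2 * τ)⁻¹ * tilt f τ t)
          (fun t => (1 + 2 * τ)⁻¹ * tilt g τ t))
          (pairCost α (fun t => (1 + 2 * τ)⁻¹ * tilt g τ t)
          (fun t => (1 + 2 * τ)⁻¹ * tilt f τ t)) := by
      rw [pairCost_const_mul, pairCost_const_mul,
        ← mul_max_of_nonneg _ _ (inv_pos.2 hκ).le, lt_inv_mul_iff₀ hκ,
        ← pairCost_const_mul]
      simp only [← tilt_rrCurve hR hτ.le]
      have h2 : L τ < max (I τ) (I' τ) := by
        have : 0 < max (I τ) (I' τ) - L τ := hΦτ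
        linarith
      exact h2
    have hs := (h.normalized_tilt hτ.le).slope_le hα (one_lt_noisyRatio hR hτ.le) hσ hς
      (fun t ht => by rw [tilt, max_eq_right (hσz t ht), mul_zero])
      (fun t ht => by rw [tilt, max_eq_right (hςz t ht), mul_zero])
      ((hft τ hτ.le).const_mul _) ((hgt τ hτ.le).const_mul _) hlt
    rw [pairCost_const_mul, pairCost_const_mul,
      mul_le_mul_iff_right₀ (inv_pos.2 hκ), mul_le_mul_iff_right₀ (inv_pos.2 hκ)] at hs
    have hd : 0 ≤ τ - τ' := by linarith
    rcases hs with ⟨hmax, hn⟩ | ⟨hmax, hn⟩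
    · have h1 := pairCost_tilt_add_slope_le hα hle hσ.le hς.le hσp hςp (hft τ hτ.le) (hgt τ hτ.le)
        (hft τ' hτ') (hgt τ' hτ')
      have h2 : I τ' ≤ max (I τ') (I' τ') := le_max_left _ _
      have h3 : max (I τ) (I' τ) = I τ := max_eq_left hmax
      have h4 := mul_le_mul_of_nonneg_left hn hd
      simp only [Φ, h3]
      simp only [I, I', L, n] at *
      nlinarith
    · have h1 := pairCost_tilt_add_slope_le hα hle hς.le hσ.le hςp hσp (hgt τ hτ.le) (hft τ hτ.le)
        (hgt τ' hτ') (hft τ' hτ')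
      have h2 : I' τ' ≤ max (I τ') (I' τ') := le_max_right _ _
      have h3 : max (I τ) (I' τ) = I' τ := max_eq_right hmax
      have h4 := mul_le_mul_of_nonneg_left hn hd
      simp only [Φ, h3]
      simp only [I, I', L, n] at *
      nlinarith
  clear_value Φ n I I' L
  -- The slack `η` absorbs the difference `n τ - n τ'` over short steps and is small enough that
  -- half of the excess is left at `τ = 0`.
  set η : ℝ := Φ τ₀ / (2 * τ₀)
  have hη : 0 < η := div_pos hpos (by linarith)
  set s : Set ℝ := {u | Φ τ₀ - η * u ≤ Φ (max (τ₀ - u) 0)}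
  have hηu : ∀ u, u ≤ τ₀ → Φ τ₀ / 2 ≤ Φ τ₀ - η * u := fun u hu => by
    have : η * u ≤ η * τ₀ := mul_le_mul_of_nonneg_left hu hη.le
    have e : η * τ₀ = Φ τ₀ / 2 := by simp only [η]; field_simp
    linarith
  -- Continuous induction in `u = τ₀ - τ`; the truncation in `s` keeps the argument of `Φ` in its
  -- domain of continuity, so that `s` is closed.
  have hsub : Set.Icc 0 τ₀ ⊆ s := by
    refine IsClosed.Icc_subset_of_forall_mem_nhdsWithin ?_ ?_ ?_
    · have hcl : IsClosed s := isClosed_le (by fun_prop)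
        (hΦc.comp_continuous (by fun_prop) fun u => Set.mem_Ici.2 (le_max_right _ _))
      exact hcl.inter isClosed_Icc
    · simp [s, max_eq_left hτ₀]
    · rintro u ⟨hus, hu0, huτ⟩
      have hτu : 0 < τ₀ - u := by linarith
      simp only [s, Set.mem_ofPred_eq, max_eq_left hτu.le] at hus
      have hΦu : 0 < Φ (τ₀ - u) := by linarith [hηu u huτ.le]
      have hcn : ContinuousAt (fun u' => n (τ₀ - u')) u :=
        ContinuousAt.comp (f := fun u' => τ₀ - u') (hnc _ hτu) (by fun_prop)
      have ev1 : ∀ᶠ u' in nhdsWithin u (Set.Ioi u), n (τ₀ - u') < n (τ₀ - u) + η :=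
        (hcn.eventually_lt continuousAt_const (by simpa using hη)).filter_mono nhdsWithin_le_nhds
      have ev2 : ∀ᶠ u' in nhdsWithin u (Set.Ioi u), u' < τ₀ :=
        (eventually_lt_nhds huτ).filter_mono nhdsWithin_le_nhds
      filter_upwards [ev1, ev2, self_mem_nhdsWithin] with u' h1 h2 h3
      have h3' : u < u' := h3
      have := hstep (τ₀ - u) hτu hΦu (τ₀ - u') (by linarith) (by linarith)
      simp only [s, Set.mem_ofPred_eq, max_eq_left (by linarith : 0 ≤ τ₀ - u')]
      nlinarith
  have hend : Φ τ₀ - η * τ₀ ≤ Φ (max (τ₀ - τ₀) 0) := hsub (Set.right_mem_Icc.2 hτ₀)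
  rw [sub_self, max_self] at hend
  linarith [hηu τ₀ le_rfl]

/-! ### Hockey-stick curves of pairs of probability measures. -/

section Pairs

variable {X : Type*} [MeasurableSpace X]

/-- The likelihood ratio `dP/dQ` as a real function. -/
def ratio (P Q : Measure X) (x : X) : ℝ := (P.rnDeriv Q x).toReal

/-- The hockey-stick divergence `E_t(P, Q)`. -/
def hockeyStick (P Q : Measure X) (t : ℝ) : ℝ := ∫ x, max (ratio P Q x - t) 0 ∂Q

/-- The hockey-stick divergence `E_t(Q, P)`, computed with respect to `Q`. -/
def revHockeyStick (P Q : Measure X) (t : ℝ) : ℝ := ∫ x, max (1 - t * ratio P Q x) 0 ∂Q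

theorem ratio_nonneg (P Q : Measure X) (x : X) : 0 ≤ ratio P Q x := ENNReal.toReal_nonneg

theorem measurable_ratio (P Q : Measure X) : Measurable (ratio P Q) :=
  (Measure.measurable_rnDeriv P Q).ennreal_toReal

variable {P Q : Measure X} [IsProbabilityMeasure P] [IsProbabilityMeasure Q]

theorem integrable_ratio (P Q : Measure X) [IsProbabilityMeasure P] : Integrable (ratio P Q) Q :=
  Measure.integrable_toReal_rnDeriv

theorem integrable_hockey (P Q : Measure X) [IsProbabilityMeasure P] [IsProbabilityMeasure Q]
    (t : ℝ) : Integrable (fun x => max (ratio P Q x - t) 0) Q :=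
  ((integrable_ratio P Q).sub (integrable_const t)).pos_part

theorem integrable_revHockey (P Q : Measure X) [IsProbabilityMeasure P] [IsProbabilityMeasure Q]
    (t : ℝ) : Integrable (fun x => max (1 - t * ratio P Q x) 0) Q :=
  ((integrable_const 1).sub ((integrable_ratio P Q).const_mul t)).pos_part

theorem integral_ratio (h : P ≪ Q) : ∫ x, ratio P Q x ∂Q = 1 := by
  unfold ratio
  rw [Measure.integral_toReal_rnDeriv h, probReal_univ]

theorem hockeyStick_nonneg (P Q : Measure X) (t : ℝ) : 0 ≤ hockeyStick P Q t :=
  integral_nonneg fun _ => le_max_right _ _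

theorem revHockeyStick_nonneg (P Q : Measure X) (t : ℝ) : 0 ≤ revHockeyStick P Q t :=
  integral_nonneg fun _ => le_max_right _ _

theorem convexOn_hinge (a b : ℝ) : ConvexOn ℝ Set.univ fun t : ℝ => max (a + b * t) 0 := by
  have hl : ConvexOn ℝ Set.univ fun t : ℝ => a + b * t := by
    refine ⟨convex_univ, fun x _ y _ u v _ _ huv => ?_⟩
    simp only [smul_eq_mul]
    have : a = (u + v) * a := by rw [huv, one_mul]
    nlinarith
  exact hl.sup (convexOn_const (0 : ℝ) convex_univ)

theorem convexOn_integral {Y : Type*} [MeasurableSpace Y] {μ : Measure Y} {F : ℝ → Y → ℝ}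
    (hF : ∀ y, ConvexOn ℝ Set.univ fun t => F t y) (hi : ∀ t, Integrable (F t) μ) :
    ConvexOn ℝ Set.univ fun t => ∫ y, F t y ∂μ := by
  refine ⟨convex_univ, fun x _ y _ a b ha hb hab => ?_⟩
  simp only [smul_eq_mul]
  rw [← integral_const_mul, ← integral_const_mul,
    ← integral_add ((hi x).const_mul a) ((hi y).const_mul b)]
  refine integral_mono (hi _) (((hi x).const_mul a).add ((hi y).const_mul b)) fun z => ?_
  exact (hF z).2 trivial trivial ha hb hab

theorem convexOn_hockeyStick : ConvexOn ℝ Set.univ (hockeyStick P Q) := by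
  refine convexOn_integral (fun x => ?_) (integrable_hockey P Q)
  refine (convexOn_hinge (ratio P Q x) (-1)).congr fun t _ => ?_
  simp only; congr 1; ring

theorem convexOn_revHockeyStick : ConvexOn ℝ Set.univ (revHockeyStick P Q) := by
  refine convexOn_integral (fun x => ?_) (integrable_revHockey P Q)
  refine (convexOn_hinge 1 (-ratio P Q x)).congr fun t _ => ?_
  simp only; congr 1; ring

theorem continuous_hockeyStick : Continuous (hockeyStick P Q) :=
  continuousOn_univ.1 (convexOn_hockeyStick.continuousOn isOpen_univ)

theorem continuous_revHockeyStick : Continuous (revHockeyStick P Q) :=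
  continuousOn_univ.1 (convexOn_revHockeyStick.continuousOn isOpen_univ)

theorem antitone_hockeyStick : Antitone (hockeyStick P Q) := fun s t hst =>
  integral_mono (integrable_hockey P Q t) (integrable_hockey P Q s) fun _ =>
    max_le_max (by linarith) le_rfl

theorem antitone_revHockeyStick : Antitone (revHockeyStick P Q) := fun s t hst =>
  integral_mono (integrable_revHockey P Q t) (integrable_revHockey P Q s) fun x =>
    max_le_max (by nlinarith [ratio_nonneg P Q x]) le_rfl

/-- The positive and negative parts of `P - tQ` differ in mass by `1 - t`. The case `t = 1` is the
symmetry of total variation; general `t` supplies the weight `e'` in `integral_ratio_sub_mul_le`. -/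
theorem integral_neg_part_eq (h : P ≪ Q) (t : ℝ) :
    ∫ x, max (t - ratio P Q x) 0 ∂Q = hockeyStick P Q t + t - 1 := by
  have e : ∀ x, max (t - ratio P Q x) 0 = max (ratio P Q x - t) 0 - (ratio P Q x - t) := by
    intro x
    rcases le_total (ratio P Q x) t with hx | hx
    · rw [max_eq_left (by linarith), max_eq_right (by linarith)]; ring
    · rw [max_eq_right (by linarith), max_eq_left (by linarith)]; ring
  have hs : Integrable (fun x => ratio P Q x - t) Q :=
    (integrable_ratio P Q).sub (integrable_const t)
  simp_rw [e]
  rw [integral_sub (integrable_hockey P Q t) hs,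
    integral_sub (integrable_ratio P Q) (integrable_const t), integral_ratio h]
  simp [hockeyStick]
  ring

theorem hockeyPair (h : P ≪ Q) : HockeyPair (hockeyStick P Q) (revHockeyStick P Q) where
  convex_left := convexOn_hockeyStick.subset (Set.subset_univ _) (convex_Ici 1)
  convex_right := convexOn_revHockeyStick.subset (Set.subset_univ _) (convex_Ici 1)
  nonneg_left t _ := hockeyStick_nonneg P Q t
  nonneg_right t _ := revHockeyStick_nonneg P Q t
  eq_one := by
    have := integral_neg_part_eq h 1
    simp only [add_sub_cancel_right] at this
    rw [← this, revHockeyStick]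
    simp only [one_mul]
  le_add t ht := by
    have h1 := integral_neg_part_eq h 1
    simp only [add_sub_cancel_right] at h1
    have i1 := integrable_hockey P Q 1
    have i1' : Integrable (fun x => max (1 - ratio P Q x) 0) Q := by
      simpa using integrable_revHockey P Q 1
    have i2 := integrable_ratio P Q
    -- Since `∫ |r - 1| = 2 * E_1` and `∫ (1 + r) = 2` for the ratio `r`, the bound becomes
    -- pointwise in `r`.
    have e : hockeyStick P Q 1 * (1 + t) - (t - 1) =
        ∫ x, ((1 + t) / 2 * (max (ratio P Q x - 1) 0 + max (1 - ratio P Q x) 0) -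
          (t - 1) / 2 * (1 + ratio P Q x)) ∂Q := by
      have j1 : Integrable (fun x => (1 + t) / 2 *
          (max (ratio P Q x - 1) 0 + max (1 - ratio P Q x) 0)) Q := (i1.add i1').const_mul _
      have j2 : Integrable (fun x => (t - 1) / 2 * (1 + ratio P Q x)) Q :=
        ((integrable_const 1).add i2).const_mul _
      rw [integral_sub j1 j2,
        integral_const_mul, integral_const_mul, integral_add i1 i1',
        integral_add (integrable_const 1) i2, h1, integral_ratio h]
      simp only [hockeyStick, integral_const, probReal_univ, smul_eq_mul]
      ring
    rw [e, hockeyStick, revHockeyStick,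
      ← integral_add (integrable_hockey P Q t) (integrable_revHockey P Q t)]
    refine integral_mono (((i1.add i1').const_mul _).sub (((integrable_const 1).add i2).const_mul _))
      ((integrable_hockey P Q t).add (integrable_revHockey P Q t)) fun x => ?_
    simp only
    have hr := ratio_nonneg P Q x
    rcases le_total (ratio P Q x) 1 with hx | hx
    · rw [max_eq_right (by linarith : ratio P Q x - 1 ≤ 0),
        max_eq_left (by linarith : 0 ≤ 1 - ratio P Q x)]
      have a1 : 1 - t * ratio P Q x ≤ max (1 - t * ratio P Q x) 0 := le_max_left _ _
      have a2 : 0 ≤ max (ratio P Q x - t) 0 := le_max_right _ _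
      nlinarith
    · rw [max_eq_left (by linarith : 0 ≤ ratio P Q x - 1),
        max_eq_right (by linarith : 1 - ratio P Q x ≤ 0)]
      have a1 : 0 ≤ max (1 - t * ratio P Q x) 0 := le_max_right _ _
      have a2 : ratio P Q x - t ≤ max (ratio P Q x - t) 0 := le_max_left _ _
      nlinarith

theorem ratio_pos_ae (h : Q ≪ P) : ∀ᵐ x ∂Q, 0 < ratio P Q x := by
  filter_upwards [Measure.rnDeriv_pos' h, Measure.rnDeriv_lt_top P Q] with x h1 h2
  exact ENNReal.toReal_pos h1.ne' h2.ne

/-- Change of measure `dP = r dQ`, with `r * max (r⁻¹ - t) 0 = max (1 - t * r) 0`. -/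
theorem hockeyStick_swap (h : P ≪ Q) (h' : Q ≪ P) (t : ℝ) :
    hockeyStick Q P t = revHockeyStick P Q t := by
  rw [hockeyStick, revHockeyStick, ← integral_rnDeriv_smul h]
  refine integral_congr_ae ?_
  filter_upwards [ratio_pos_ae h', h' (Measure.inv_rnDeriv h)] with x hx hx'
  have e : ratio Q P x = (ratio P Q x)⁻¹ := by
    rw [ratio, ratio, ← hx', Pi.inv_apply, ENNReal.toReal_inv]
  change ratio P Q x • max (ratio Q P x - t) 0 = _
  rw [smul_eq_mul, mul_max_of_nonneg _ _ hx.le, mul_zero, e, mul_sub, mul_inv_cancel₀ hx.ne',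
    mul_comm t]

theorem real_sub_eq_setIntegral (h : P ≪ Q) (t : ℝ) (S : Set X) :
    P.real S - t * Q.real S = ∫ x in S, (ratio P Q x - t) ∂Q := by
  rw [integral_sub (integrable_ratio P Q).integrableOn (integrable_const t), setIntegral_const,
    smul_eq_mul, mul_comm (Q.real S)]
  congr 1
  exact (Measure.setIntegral_toReal_rnDeriv h S).symm

theorem real_sub_le_hockeyStick (h : P ≪ Q) (t : ℝ) (S : Set X) :
    P.real S - t * Q.real S ≤ hockeyStick P Q t := by
  rw [real_sub_eq_setIntegral h t]
  calc ∫ x in S, (ratio P Q x - t) ∂Q ≤ ∫ x in S, max (ratio P Q x - t) 0 ∂Q :=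
        integral_mono ((integrable_ratio P Q).sub (integrable_const t)).integrableOn
          (integrable_hockey P Q t).integrableOn fun x => le_max_left _ _
    _ ≤ _ := setIntegral_le_integral (integrable_hockey P Q t)
        (.of_forall fun x => le_max_right _ _)

/-- The Neyman–Pearson set `{t ≤ dP/dQ}` is optimal. -/
theorem exists_real_sub_eq_hockeyStick (h : P ≪ Q) (t : ℝ) :
    ∃ S, MeasurableSet S ∧ P.real S - t * Q.real S = hockeyStick P Q t := by
  have hS : MeasurableSet {x | t ≤ ratio P Q x} :=
    measurableSet_le measurable_const (measurable_ratio P Q)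
  refine ⟨_, hS, ?_⟩
  rw [real_sub_eq_setIntegral h t, hockeyStick, ← integral_indicator hS]
  congr 1
  ext x
  by_cases hx : t ≤ ratio P Q x
  · rw [Set.indicator_of_mem (by exact hx), max_eq_left (by linarith)]
  · rw [Set.indicator_of_notMem (by exact hx), max_eq_right (by linarith)]

/-! ### The `α`-moment as a functional of the two curves. -/

/-- The `α`-moment in terms of the two hockey-stick curves, pointwise in the likelihood ratio. -/
theorem rpow_eq_lintegral_hinge {α r : ℝ} (hα : 1 < α) (hr : 0 < r) :
    ENNReal.ofReal (r ^ α) + ENNReal.ofReal (α - 1) = ENNReal.ofReal α * ENNReal.ofReal r +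
      ENNReal.ofReal (α * (α - 1)) * ∫⁻ t in Set.Ioi (1 : ℝ),
        (ENNReal.ofReal (t ^ (α - 2) * max (r - t) 0) +
          ENNReal.ofReal (t ^ (-α - 1) * max (1 - t * r) 0)) := by
  have hα0 : 0 < α := by linarith
  have hα1 : 0 < α - 1 := by linarith
  have hnn : ∀ e : ℝ, ∀ F : ℝ → ℝ, (∀ t, 0 ≤ F t) →
      0 ≤ᵐ[volume.restrict (Set.Ioi (1 : ℝ))] fun t => t ^ e * F t := fun e F hF =>
    (ae_restrict_iff' measurableSet_Ioi).2 (.of_forall fun t ht =>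
      mul_nonneg (Real.rpow_nonneg (by linarith [Set.mem_Ioi.1 ht]) e) (hF t))
  have i1 := integrableOn_rpow_mul_hinge (α - 2) r
  have e2 : ∀ t : ℝ, t ^ (-α - 1) * max (1 - t * r) 0 =
      r * (t ^ (-α - 1) * max (r⁻¹ - t) 0) := fun t => by
    rw [mul_left_comm, mul_max_of_nonneg _ _ hr.le, mul_zero, mul_sub, mul_inv_cancel₀ hr.ne',
      mul_comm r t]
  have i2 := (integrableOn_rpow_mul_hinge (-α - 1) r⁻¹).const_mul r
  have m1 : Measurable fun t : ℝ => ENNReal.ofReal (t ^ (α - 2) * max (r - t) 0) := by fun_prop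
  rw [lintegral_add_left m1, ← ofReal_integral_eq_lintegral_ofReal i1
    (hnn _ (fun t => max (r - t) 0) fun t => le_max_right _ _)]
  simp_rw [e2]
  rw [← ofReal_integral_eq_lintegral_ofReal i2
    (by
      filter_upwards [hnn (-α - 1) (fun t => max (r⁻¹ - t) 0) fun t => le_max_right _ _] with t ht
      exact mul_nonneg hr.le ht), integral_const_mul]
  have z : ∀ e σ : ℝ, σ ≤ 1 → ∫ t in Set.Ioi (1 : ℝ), t ^ e * max (σ - t) 0 = 0 := fun e σ hσ => by
    rw [setIntegral_congr_fun (g := fun _ => (0 : ℝ)) measurableSet_Ioi fun t ht => ?_]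
    · simp
    · simp only [max_eq_right (by linarith [Set.mem_Ioi.1 ht] : σ - t ≤ 0), mul_zero]
  have hra : 0 ≤ r ^ α := Real.rpow_nonneg hr.le α
  have hcc : 0 ≤ α * (α - 1) := by positivity
  rw [← ENNReal.ofReal_add hra hα1.le, ← ENNReal.ofReal_mul hα0.le]
  -- Taylor's formula for `r ^ α` at `1`: only the first hinge is active for `r ≥ 1`, only the
  -- second for `r ≤ 1`.
  rcases le_total 1 r with h1 | h1
  · rw [z _ _ (inv_le_one_of_one_le₀ h1), mul_zero, ENNReal.ofReal_zero, add_zero,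
      integral_rpow_mul_hinge (by linarith) (by linarith) h1, ← ENNReal.ofReal_mul hcc,
      ← ENNReal.ofReal_add (by positivity)
        (mul_nonneg hcc (kappaMoment_nonneg (by linarith) (by linarith) h1))]
    congr 1
    rw [kappaMoment, show α - 2 + 2 = α by ring, show α - 2 + 1 = α - 1 by ring]
    have : α - 1 ≠ 0 := hα1.ne'
    field_simp
    ring
  · have h1' := (one_le_inv₀ hr).2 h1
    rw [z _ _ h1, ENNReal.ofReal_zero, zero_add,
      integral_rpow_mul_hinge (by linarith) (by linarith) h1', ← ENNReal.ofReal_mul hcc,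
      ← ENNReal.ofReal_add (by positivity)
        (mul_nonneg hcc (mul_nonneg hr.le (kappaMoment_nonneg (by linarith) (by linarith) h1')))]
    congr 1
    rw [kappaMoment, show -α - 1 + 2 = -(α - 1) by ring, show -α - 1 + 1 = -α by ring,
      Real.inv_rpow hr.le, Real.rpow_neg hr.le, inv_inv, Real.rpow_sub hr, Real.rpow_one]
    have : α - 1 ≠ 0 := hα1.ne'
    field_simp
    ring

/-- The nontrivial part of the `α`-moment, with values in `[0, ∞]`. -/
def curveCost (α : ℝ) (f g : ℝ → ℝ) : ℝ≥0∞ :=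
  ∫⁻ t in Set.Ioi (1 : ℝ), (ENNReal.ofReal (t ^ (α - 2) * f t) +
    ENNReal.ofReal (t ^ (-α - 1) * g t))

theorem curveCost_mono {α : ℝ} {f g f' g' : ℝ → ℝ} (h : ∀ t, 1 < t → f t ≤ f' t)
    (h' : ∀ t, 1 < t → g t ≤ g' t) : curveCost α f g ≤ curveCost α f' g' := by
  refine setLIntegral_mono' measurableSet_Ioi fun t ht => ?_
  have hp : ∀ e : ℝ, 0 ≤ t ^ e := fun e => Real.rpow_nonneg (by linarith [Set.mem_Ioi.1 ht]) e
  exact add_le_add (ENNReal.ofReal_le_ofReal (mul_le_mul_of_nonneg_left (h t ht) (hp _)))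
    (ENNReal.ofReal_le_ofReal (mul_le_mul_of_nonneg_left (h' t ht) (hp _)))

/-- The `α`-moment of the likelihood ratio in terms of the hockey-stick curves. -/
theorem moment_eq (h : P ≪ Q) (h' : Q ≪ P) {α : ℝ} (hα : 1 < α) :
    (∫⁻ x, P.rnDeriv Q x ^ α ∂Q) + ENNReal.ofReal (α - 1) = ENNReal.ofReal α +
      ENNReal.ofReal (α * (α - 1)) * curveCost α (hockeyStick P Q) (revHockeyStick P Q) := by
  have hα0 : 0 < α := by linarith
  have mr := measurable_ratio P Q
  have e1 : ∫⁻ x, P.rnDeriv Q x ^ α ∂Q = ∫⁻ x, ENNReal.ofReal (ratio P Q x ^ α) ∂Q := by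
    refine lintegral_congr_ae ?_
    filter_upwards [Measure.rnDeriv_lt_top P Q] with x hx
    rw [← ENNReal.ofReal_rpow_of_nonneg (ratio_nonneg P Q x) hα0.le, ratio,
      ENNReal.ofReal_toReal hx.ne]
  have e2 : ∫⁻ x, ENNReal.ofReal (ratio P Q x) ∂Q = 1 := by
    rw [← ofReal_integral_eq_lintegral_ofReal (integrable_ratio P Q)
      (.of_forall fun x => ratio_nonneg P Q x), integral_ratio h, ENNReal.ofReal_one]
  set F : X → ℝ → ℝ≥0∞ := fun x t =>
    ENNReal.ofReal (t ^ (α - 2) * max (ratio P Q x - t) 0) +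
      ENNReal.ofReal (t ^ (-α - 1) * max (1 - t * ratio P Q x) 0)
  have mF : Measurable (Function.uncurry F) := by
    have m0 : Measurable fun p : X × ℝ => ratio P Q p.1 := mr.comp measurable_fst
    have hF : Function.uncurry F = fun p : X × ℝ =>
      ENNReal.ofReal (p.2 ^ (α - 2) * max (ratio P Q p.1 - p.2) 0) +
        ENNReal.ofReal (p.2 ^ (-α - 1) * max (1 - p.2 * ratio P Q p.1) 0) := rfl
    rw [hF]
    fun_prop
  have e3 : ∫⁻ x, (∫⁻ t in Set.Ioi (1 : ℝ), F x t) ∂Q =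
      curveCost α (hockeyStick P Q) (revHockeyStick P Q) := by
    rw [lintegral_lintegral_swap mF.aemeasurable, curveCost]
    refine setLIntegral_congr_fun measurableSet_Ioi fun t ht => ?_
    have hp : ∀ e : ℝ, 0 ≤ t ^ e := fun e => Real.rpow_nonneg (by linarith [Set.mem_Ioi.1 ht]) e
    have mm : Measurable fun x => ENNReal.ofReal (t ^ (α - 2) * max (ratio P Q x - t) 0) := by
      fun_prop
    simp only [F]
    rw [lintegral_add_left mm,
      ← ofReal_integral_eq_lintegral_ofReal ((integrable_hockey P Q t).const_mul _)
        (.of_forall fun x => mul_nonneg (hp _) (le_max_right _ _)),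
      ← ofReal_integral_eq_lintegral_ofReal ((integrable_revHockey P Q t).const_mul _)
        (.of_forall fun x => mul_nonneg (hp _) (le_max_right _ _)),
      integral_const_mul, integral_const_mul]
    rfl
  have mI : Measurable fun x => ∫⁻ t in Set.Ioi (1 : ℝ), F x t := mF.lintegral_prod_right'
  have mo : Measurable fun x => ENNReal.ofReal (ratio P Q x ^ α) := by fun_prop
  calc (∫⁻ x, P.rnDeriv Q x ^ α ∂Q) + ENNReal.ofReal (α - 1)
      = ∫⁻ x, (ENNReal.ofReal (ratio P Q x ^ α) + ENNReal.ofReal (α - 1)) ∂Q := by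
        rw [lintegral_add_left mo, e1]; simp
    _ = ∫⁻ x, (ENNReal.ofReal α * ENNReal.ofReal (ratio P Q x) +
          ENNReal.ofReal (α * (α - 1)) * ∫⁻ t in Set.Ioi (1 : ℝ), F x t) ∂Q := by
        refine lintegral_congr_ae ?_
        filter_upwards [ratio_pos_ae h'] with x hx using rpow_eq_lintegral_hinge hα hx
    _ = _ := by
        rw [lintegral_add_left (by fun_prop), lintegral_const_mul _ (by fun_prop),
          lintegral_const_mul _ mI, e2, e3, mul_one]

theorem moment_le_moment {X' : Type*} [MeasurableSpace X'] {P' Q' : Measure X'}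
    [IsProbabilityMeasure P'] [IsProbabilityMeasure Q'] (h₁ : P ≪ Q) (h₂ : Q ≪ P) (h₁' : P' ≪ Q')
    (h₂' : Q' ≪ P') {α : ℝ} (hα : 1 < α)
    (h : curveCost α (hockeyStick P Q) (revHockeyStick P Q) ≤
      curveCost α (hockeyStick P' Q') (revHockeyStick P' Q')) :
    ∫⁻ x, P.rnDeriv Q x ^ α ∂Q ≤ ∫⁻ x, P'.rnDeriv Q' x ^ α ∂Q' := by
  have h0 : ENNReal.ofReal (α - 1) ≠ ∞ := ENNReal.ofReal_ne_top
  rw [← ENNReal.add_le_add_iff_right h0, moment_eq h₁ h₂ hα, moment_eq h₁' h₂' hα]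
  gcongr

theorem curveCost_eq_ofReal {α : ℝ} {f g : ℝ → ℝ} (hf : FiniteCost α f) (hg : FiniteCost α g)
    (hf0 : ∀ t, 1 ≤ t → 0 ≤ f t) (hg0 : ∀ t, 1 ≤ t → 0 ≤ g t) :
    curveCost α f g = ENNReal.ofReal (pairCost α f g) := by
  have nn : ∀ (e : ℝ) (F : ℝ → ℝ), (∀ t, 1 ≤ t → 0 ≤ F t) → ∀ t ∈ Set.Ioi (1 : ℝ),
      0 ≤ t ^ e * F t := fun e F hF t ht =>
    mul_nonneg (Real.rpow_nonneg (by linarith [Set.mem_Ioi.1 ht]) e) (hF t (le_of_lt ht))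
  have nn' : ∀ (e : ℝ) (F : ℝ → ℝ), (∀ t, 1 ≤ t → 0 ≤ F t) →
      0 ≤ᵐ[volume.restrict (Set.Ioi (1 : ℝ))] fun t => t ^ e * F t := fun e F hF =>
    (ae_restrict_iff' measurableSet_Ioi).2 (.of_forall (nn e F hF))
  rw [pairCost, ENNReal.ofReal_add (setIntegral_nonneg measurableSet_Ioi (nn _ f hf0))
    (setIntegral_nonneg measurableSet_Ioi (nn _ g hg0)),
    ofReal_integral_eq_lintegral_ofReal hf.1 (nn' _ f hf0),
    ofReal_integral_eq_lintegral_ofReal hg.2 (nn' _ g hg0), curveCost,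
    lintegral_add_left' hf.1.aestronglyMeasurable.aemeasurable.ennreal_ofReal]

theorem integrableOn_of_lintegral_ne_top {e : ℝ} {f : ℝ → ℝ} (hc : ContinuousOn f (Set.Ici 1))
    (h0 : ∀ t, 1 ≤ t → 0 ≤ f t)
    (h : ∫⁻ t in Set.Ioi (1 : ℝ), ENNReal.ofReal (t ^ e * f t) ≠ ∞) :
    IntegrableOn (fun t : ℝ => t ^ e * f t) (Set.Ioi 1) := by
  refine ⟨aestronglyMeasurable_rpow_mul hc e, ?_⟩
  rw [hasFiniteIntegral_iff_ofReal]
  · exact h.lt_top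
  · exact (ae_restrict_iff' measurableSet_Ioi).2 (.of_forall fun t ht =>
      mul_nonneg (Real.rpow_nonneg (by linarith [Set.mem_Ioi.1 ht]) e) (h0 t (le_of_lt ht)))

/-- Both orders are needed, since each curve must be integrable against both weights. -/
theorem finiteCost_of_curveCost_ne_top {α : ℝ} {f g : ℝ → ℝ} (hfc : ContinuousOn f (Set.Ici 1))
    (hgc : ContinuousOn g (Set.Ici 1)) (hf0 : ∀ t, 1 ≤ t → 0 ≤ f t) (hg0 : ∀ t, 1 ≤ t → 0 ≤ g t)
    (h : curveCost α f g ≠ ∞) (h' : curveCost α g f ≠ ∞) : FiniteCost α f ∧ FiniteCost α g := by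
  have a1 : ∀ f g : ℝ → ℝ, curveCost α f g ≠ ∞ →
      (∫⁻ t in Set.Ioi (1 : ℝ), ENNReal.ofReal (t ^ (α - 2) * f t)) ≠ ∞ := fun f g h =>
    ne_top_of_le_ne_top h (lintegral_mono fun t => le_self_add)
  have a2 : ∀ f g : ℝ → ℝ, curveCost α f g ≠ ∞ →
      (∫⁻ t in Set.Ioi (1 : ℝ), ENNReal.ofReal (t ^ (-α - 1) * g t)) ≠ ∞ := fun f g h =>
    ne_top_of_le_ne_top h (lintegral_mono fun t => le_add_self)
  exact ⟨⟨integrableOn_of_lintegral_ne_top hfc hf0 (a1 _ _ h),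
    integrableOn_of_lintegral_ne_top hfc hf0 (a2 _ _ h')⟩,
    ⟨integrableOn_of_lintegral_ne_top hgc hg0 (a1 _ _ h'),
    integrableOn_of_lintegral_ne_top hgc hg0 (a2 _ _ h)⟩⟩

end Pairs

theorem curveCost_rrCurve {α ρ : ℝ} (hρ : 1 ≤ ρ) :
    curveCost α (rrCurve ρ) (rrCurve ρ) =
      ENNReal.ofReal (pairCost α (rrCurve ρ) (rrCurve ρ)) :=
  curveCost_eq_ofReal (finiteCost_rrCurve α ρ) (finiteCost_rrCurve α ρ)
    (fun t _ => rrCurve_nonneg hρ t) fun t _ => rrCurve_nonneg hρ t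

/-! ### Coin tables and degradation of the extreme corners. -/

/-- The probability that a coin of bias `p` shows `b`. -/
def coinWeight (p : ℝ) (b : Bool) : ℝ := if b then p else 1 - p

/-- The probability of the table `b` under `k` runs of `d` coins of biases `x`. -/
def runWeight {d k : ℕ} (x : Fin d → ℝ) (b : Fin k → Fin d → Bool) : ℝ :=
  ∏ j, ∏ i, coinWeight (x i) (b j i)

theorem coinWeight_nonneg {p : ℝ} (h0 : 0 ≤ p) (h1 : p ≤ 1) (b : Bool) : 0 ≤ coinWeight p b := by
  cases b <;> simp [coinWeight] <;> linarith

theorem runWeight_nonneg {d k : ℕ} {x : Fin d → ℝ} (h0 : ∀ i, 0 ≤ x i) (h1 : ∀ i, x i ≤ 1)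
    (b : Fin k → Fin d → Bool) : 0 ≤ runWeight x b :=
  Finset.prod_nonneg fun _ _ => Finset.prod_nonneg fun i _ => coinWeight_nonneg (h0 i) (h1 i) _

theorem coinWeight_not (p : ℝ) (b : Bool) : coinWeight p (!b) = coinWeight (1 - p) b := by
  cases b <;> simp [coinWeight]

theorem real_bernRuns_singleton {d k : ℕ} (x : Cube d) (b : Fin k → Fin d → Bool) :
    (bernRuns k x).real {b} = runWeight (fun i => (x i : ℝ)) b := by
  unfold bernRuns runWeight
  rw [Measure.real, Measure.pi_singleton, ENNReal.toReal_prod]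
  refine Finset.prod_congr rfl fun j _ => ?_
  rw [bern_singleton, ENNReal.toReal_prod]
  refine Finset.prod_congr rfl fun i _ => ?_
  rw [coinWeight]
  split_ifs
  · exact ENNReal.toReal_ofReal (x i).2.1
  · exact ENNReal.toReal_ofReal (by linarith [(x i).2.2])

open Classical in
theorem real_bernRuns {d k : ℕ} (x : Cube d) (S : Set (Fin k → Fin d → Bool)) :
    (bernRuns k x).real S = ∑ b with b ∈ S, runWeight (fun i => (x i : ℝ)) b := by
  have hS : S = ((Finset.univ.filter fun b => b ∈ S : Finset _) : Set (Fin k → Fin d → Bool)) := by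
    ext b; simp
  conv_lhs => rw [hS, ← sum_measureReal_singleton]
  exact Finset.sum_congr rfl fun b _ => real_bernRuns_singleton x b

theorem prod_prod_sum_eq {d k : ℕ} (F : Fin k → Fin d → Bool → ℝ) :
    ∏ j, ∏ i, ∑ a, F j i a = ∑ a : Fin k → Fin d → Bool, ∏ j, ∏ i, F j i (a j i) := by
  simp_rw [Finset.prod_univ_sum, Fintype.piFinset_univ]

/-- Flipping coins of biases `u` or `v` according to the outcome of a coin of bias `p`. -/
theorem sum_coinWeight_mul (p u v : ℝ) (b : Bool) :
    ∑ a, coinWeight p a * coinWeight (if a then u else v) b =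
      coinWeight (p * u + (1 - p) * v) b := by
  cases b
  · simp [coinWeight]; ring
  · simp [coinWeight]

theorem sum_coinWeight (p : ℝ) : ∑ b, coinWeight p b = 1 := by simp [coinWeight]

/-- The runs arise from runs with constant bias `p` by a coinwise channel that does not depend on
`p`; taking `p = 1 - c` and `p = c` gives two inputs of the same channel. -/
theorem runWeight_eq_sum {d k : ℕ} (p : ℝ) (u v : Fin d → ℝ) (b : Fin k → Fin d → Bool) :
    runWeight (fun i => p * u i + (1 - p) * v i) b =
      ∑ a : Fin k → Fin d → Bool, runWeight (fun _ : Fin d => p) a *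
        ∏ j, ∏ i, coinWeight (if a j i then u i else v i) (b j i) := by
  unfold runWeight
  simp_rw [← sum_coinWeight_mul, prod_prod_sum_eq, ← Finset.prod_mul_distrib]

/-- The hinge gap between the laws of the runs from the two extreme corners. -/
def cornerGap (d k : ℕ) (c e e' : ℝ) : ℝ :=
  ∑ a : Fin k → Fin d → Bool, max (e * runWeight (fun _ : Fin d => 1 - c) a -
    e' * runWeight (fun _ : Fin d => c) a) 0

theorem cornerGap_nonneg (d k : ℕ) (c e e' : ℝ) : 0 ≤ cornerGap d k c e e' :=
  Finset.sum_nonneg fun _ _ => le_max_right _ _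

/-- Every pair of biases in `[c, 1 - c]^d` is a degraded version of the pair of extreme corners. -/
theorem sum_runWeight_sub_le {d k : ℕ} {c : ℝ} (hc0 : 0 ≤ c) (hc : c < 1 / 2) {x y : Fin d → ℝ}
    (hx : ∀ i, x i ∈ Set.Icc c (1 - c)) (hy : ∀ i, y i ∈ Set.Icc c (1 - c)) (e e' : ℝ)
    (s : Finset (Fin k → Fin d → Bool)) :
    ∑ b ∈ s, (e * runWeight x b - e' * runWeight y b) ≤ cornerGap d k c e e' := by
  have hcc : 0 < 1 - 2 * c := by linarith
  have hcc' : 1 - 2 * c ≠ 0 := hcc.ne'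
  have hw : ∀ p q : ℝ, p ∈ Set.Icc c (1 - c) → q ∈ Set.Icc c (1 - c) →
      0 ≤ ((1 - c) * p - c * q) / (1 - 2 * c) ∧ ((1 - c) * p - c * q) / (1 - 2 * c) ≤ 1 := by
    rintro p q ⟨hp, hp'⟩ ⟨hq, hq'⟩
    exact ⟨div_nonneg (by nlinarith) hcc.le, (div_le_one hcc).2 (by nlinarith)⟩
  -- `u` and `v` solve `x = (1 - c) u + c v`, `y = c u + (1 - c) v`; the box constraint is what
  -- keeps them in `[0, 1]`.
  set u : Fin d → ℝ := fun i => ((1 - c) * x i - c * y i) / (1 - 2 * c) with hu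
  set v : Fin d → ℝ := fun i => ((1 - c) * y i - c * x i) / (1 - 2 * c) with hv
  have ex : x = fun i => (1 - c) * u i + (1 - (1 - c)) * v i := by
    ext i; simp only [hu, hv]; rw [mul_div_assoc', mul_div_assoc', ← add_div, eq_div_iff hcc']; ring
  have ey : y = fun i => c * u i + (1 - c) * v i := by
    ext i; simp only [hu, hv]; rw [mul_div_assoc', mul_div_assoc', ← add_div, eq_div_iff hcc']; ring
  set W : (Fin k → Fin d → Bool) → (Fin k → Fin d → Bool) → ℝ := fun a b =>
    ∏ j, ∏ i, coinWeight (if a j i then u i else v i) (b j i) with hW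
  have hW0 : ∀ a b, 0 ≤ W a b := fun a b =>
    Finset.prod_nonneg fun j _ => Finset.prod_nonneg fun i _ => by
      have h1 := hw _ _ (hx i) (hy i)
      have h2 := hw _ _ (hy i) (hx i)
      split_ifs
      · exact coinWeight_nonneg h1.1 h1.2 _
      · exact coinWeight_nonneg h2.1 h2.2 _
  have hW1 : ∀ a, ∑ b, W a b = 1 := fun a => by
    simp only [hW]
    rw [← prod_prod_sum_eq]
    simp only [sum_coinWeight, Finset.prod_const_one]
  have hx' : ∀ b, runWeight x b = ∑ a, runWeight (fun _ : Fin d => 1 - c) a * W a b := fun b => by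
    conv_lhs => rw [ex]
    exact runWeight_eq_sum _ u v b
  have hy' : ∀ b, runWeight y b = ∑ a, runWeight (fun _ : Fin d => c) a * W a b := fun b => by
    conv_lhs => rw [ey]
    exact runWeight_eq_sum _ u v b
  have hswap : ∑ b ∈ s, (e * runWeight x b - e' * runWeight y b) =
      ∑ a, (e * runWeight (fun _ : Fin d => 1 - c) a - e' * runWeight (fun _ : Fin d => c) a) *
        ∑ b ∈ s, W a b := by
    simp_rw [hx', hy', Finset.mul_sum, ← Finset.sum_sub_distrib]
    rw [Finset.sum_comm]
    refine Finset.sum_congr rfl fun a _ => Finset.sum_congr rfl fun b _ => by ring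
  rw [hswap, cornerGap]
  refine Finset.sum_le_sum fun a _ => ?_
  have hs0 : 0 ≤ ∑ b ∈ s, W a b := Finset.sum_nonneg fun b _ => hW0 a b
  have hs1 : ∑ b ∈ s, W a b ≤ 1 := (hW1 a).symm ▸
    Finset.sum_le_sum_of_subset_of_nonneg (Finset.subset_univ s) fun b _ _ => hW0 a b
  refine (mul_le_mul_of_nonneg_right (le_max_left _ 0) hs0).trans ?_
  exact mul_le_of_le_one_right (le_max_right _ _) hs1

theorem hinge_add_hinge_swap {p q e s : ℝ} (he : 0 ≤ e) (hs : 0 ≤ s) (hp : 0 ≤ p) (hq : 0 ≤ q) :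
    max (e * p - (e + s) * q) 0 + max (e * q - (e + s) * p) 0 =
      |p - q| * max (e - min p q / |p - q| * s) 0 := by
  wlog h : q ≤ p generalizing p q
  · rw [add_comm, this hq hp (not_le.1 h).le, abs_sub_comm, min_comm]
  have h2 : e * q - (e + s) * p ≤ 0 := by nlinarith
  rw [max_eq_right h2, add_zero, abs_of_nonneg (by linarith), min_eq_right h]
  -- For `p = q` the quotient takes the value `0`, which is harmless: both sides vanish.
  rcases h.eq_or_lt with rfl | h
  · rw [sub_self, zero_mul, max_eq_right (by nlinarith)]
  · have : 0 < p - q := by linarith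
    rw [mul_max_of_nonneg _ _ this.le, mul_zero]
    congr 1
    field_simp
    ring

theorem runWeight_not {d k : ℕ} (c : ℝ) (b : Fin k → Fin d → Bool) :
    runWeight (fun _ : Fin d => c) (fun j i => !b j i) = runWeight (fun _ : Fin d => 1 - c) b := by
  simp only [runWeight, coinWeight_not]

/-- The involution of the outcome tables that flips every coin. -/
def flipTable (d k : ℕ) : Equiv.Perm (Fin k → Fin d → Bool) :=
  Function.Involutive.toPerm (fun b j i => !b j i) fun b => by ext; simp

theorem cornerGap_swap (d k : ℕ) (c e e' : ℝ) :
    ∑ a : Fin k → Fin d → Bool, max (e * runWeight (fun _ : Fin d => c) a -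
      e' * runWeight (fun _ : Fin d => 1 - c) a) 0 = cornerGap d k c e e' := by
  rw [cornerGap, ← Equiv.sum_comp (flipTable d k)]
  refine Finset.sum_congr rfl fun a _ => ?_
  have h1 : runWeight (fun _ : Fin d => c) (flipTable d k a) = runWeight (fun _ : Fin d => 1 - c) a :=
    runWeight_not c a
  have h2 : runWeight (fun _ : Fin d => 1 - c) (flipTable d k a) = runWeight (fun _ : Fin d => c) a := by
    have := runWeight_not (1 - c) a
    rwa [sub_sub_cancel] at this
  rw [h1, h2]

/-- Half the gap between the two corner likelihoods of the table `a`. -/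
def tableGap {d k : ℕ} (c : ℝ) (a : Fin k → Fin d → Bool) : ℝ :=
  2⁻¹ * |runWeight (fun _ : Fin d => 1 - c) a - runWeight (fun _ : Fin d => c) a|

/-- The slope at which the table `a` tilts the input hockey-stick curve. -/
def tableSlope {d k : ℕ} (c : ℝ) (a : Fin k → Fin d → Bool) : ℝ :=
  min (runWeight (fun _ : Fin d => 1 - c) a) (runWeight (fun _ : Fin d => c) a) /
    |runWeight (fun _ : Fin d => 1 - c) a - runWeight (fun _ : Fin d => c) a|

theorem tableGap_nonneg {d k : ℕ} (c : ℝ) (a : Fin k → Fin d → Bool) : 0 ≤ tableGap c a :=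
  mul_nonneg (by norm_num) (abs_nonneg _)

theorem tableSlope_nonneg {d k : ℕ} {c : ℝ} (hc0 : 0 ≤ c) (hc : c < 1 / 2)
    (a : Fin k → Fin d → Bool) : 0 ≤ tableSlope c a :=
  div_nonneg (le_min (runWeight_nonneg (fun _ => by linarith) (fun _ => by linarith) a)
    (runWeight_nonneg (fun _ => by linarith) (fun _ => by linarith) a)) (abs_nonneg _)

/-- Averaging the gap with its copy under flipping all coins, hence the `2⁻¹` in `tableGap`, pairs
the two hinges of each table as in `hinge_add_hinge_swap`. -/
theorem cornerGap_eq {d k : ℕ} {c : ℝ} (hc0 : 0 ≤ c) (hc : c < 1 / 2) (f : ℝ → ℝ) {t : ℝ}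
    (hf : 0 ≤ f t) (ht : 1 ≤ t) : cornerGap d k c (f t) (f t + (t - 1)) =
      ∑ a : Fin k → Fin d → Bool, tableGap c a * tilt f (tableSlope c a) t := by
  have h2 : cornerGap d k c (f t) (f t + (t - 1)) = 2⁻¹ * (cornerGap d k c (f t) (f t + (t - 1)) +
      cornerGap d k c (f t) (f t + (t - 1))) := by ring
  rw [h2]
  nth_rw 2 [← cornerGap_swap]
  rw [cornerGap, ← Finset.sum_add_distrib, Finset.mul_sum]
  refine Finset.sum_congr rfl fun a _ => ?_
  rw [hinge_add_hinge_swap hf (by linarith)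
    (runWeight_nonneg (fun _ => by linarith) (fun _ => by linarith) a)
    (runWeight_nonneg (fun _ => by linarith) (fun _ => by linarith) a), ← mul_assoc]
  rfl

/-! ### From gaps between points to hockey-stick bounds for mixtures. -/

section Averaging

variable {X Y : Type*} [MeasurableSpace X] [MeasurableSpace Y] {P Q : Measure X}
  [IsProbabilityMeasure P] [IsProbabilityMeasure Q]

/-- A test function averaged against `P - t Q` is bounded by its largest two-point gap. -/
theorem integral_ratio_sub_mul_le (h : P ≪ Q) {t : ℝ} (ht : 1 ≤ t) {B : Set X}
    (hB : ∀ᵐ x ∂Q, x ∈ B) {κ : X → ℝ} (hm : Measurable κ) (h0 : ∀ x, 0 ≤ κ x) (h1 : ∀ x, κ x ≤ 1)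
    {H : ℝ} (hH : 0 ≤ H)
    (hgap : ∀ x ∈ B, ∀ y ∈ B,
      hockeyStick P Q t * κ x - (hockeyStick P Q t + (t - 1)) * κ y ≤ H) :
    ∫ x, (ratio P Q x - t) * κ x ∂Q ≤ H := by
  set e := hockeyStick P Q t with he
  set e' := e + (t - 1) with he'
  have hneg : ∫ x, max (t - ratio P Q x) 0 ∂Q = e' := by
    rw [integral_neg_part_eq h t]; ring
  have ip := integrable_hockey P Q t
  have iN : Integrable (fun x => max (t - ratio P Q x) 0) Q :=
    ((integrable_const t).sub (integrable_ratio P Q)).pos_part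
  have bdd : ∀ᵐ x ∂Q, ‖κ x‖ ≤ 1 := .of_forall fun x => by
    rw [Real.norm_of_nonneg (h0 x)]; exact h1 x
  have ipk : Integrable (fun x => max (ratio P Q x - t) 0 * κ x) Q :=
    ip.mul_bdd hm.aestronglyMeasurable bdd
  have iNk : Integrable (fun x => max (t - ratio P Q x) 0 * κ x) Q :=
    iN.mul_bdd hm.aestronglyMeasurable bdd
  have hsplit : ∫ x, (ratio P Q x - t) * κ x ∂Q =
      (∫ x, max (ratio P Q x - t) 0 * κ x ∂Q) - ∫ x, max (t - ratio P Q x) 0 * κ x ∂Q := by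
    rw [← integral_sub ipk iNk]
    refine integral_congr_ae (.of_forall fun x => ?_)
    simp only
    rw [← sub_mul]
    congr 1
    rcases le_total (ratio P Q x) t with hx | hx
    · rw [max_eq_right (by linarith), max_eq_left (by linarith)]; ring
    · rw [max_eq_left (by linarith), max_eq_right (by linarith)]; ring
  have hN0 : 0 ≤ ∫ x, max (t - ratio P Q x) 0 * κ x ∂Q :=
    integral_nonneg fun x => mul_nonneg (le_max_right _ _) (h0 x)
  rw [hsplit]
  rcases (hockeyStick_nonneg P Q t).eq_or_lt with hz | hpos
  · have : ∫ x, max (ratio P Q x - t) 0 * κ x ∂Q ≤ ∫ x, max (ratio P Q x - t) 0 ∂Q :=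
      integral_mono ipk ip fun x => mul_le_of_le_one_right (le_max_right _ _) (h1 x)
    change _ ≤ hockeyStick P Q t at this
    linarith
  · have he0 : 0 < e := hpos
    have he'0 : 0 < e' := by linarith
    set A := ∫ x, max (ratio P Q x - t) 0 * κ x ∂Q with hA
    -- The gap bound is averaged over the positive part of `P - tQ` (mass `e`) with `y` fixed, and
    -- next over the negative part (mass `e'`).
    have step : ∀ y ∈ B, A ≤ H + e' * κ y := fun y hy => by
      have : e * A ≤ e * (H + e' * κ y) := by
        rw [hA, ← integral_const_mul]
        calc ∫ x, e * (max (ratio P Q x - t) 0 * κ x) ∂Q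
            ≤ ∫ x, max (ratio P Q x - t) 0 * (H + e' * κ y) ∂Q := by
              refine integral_mono_ae (ipk.const_mul e) (ip.mul_const _) ?_
              filter_upwards [hB] with x hx
              have hb := hgap x hx y hy
              rw [mul_left_comm]
              exact mul_le_mul_of_nonneg_left (by linarith) (le_max_right _ _)
          _ = _ := by rw [integral_mul_const]; rfl
      exact le_of_mul_le_mul_left this he0
    have : e' * A ≤ e' * (H + ∫ x, max (t - ratio P Q x) 0 * κ x ∂Q) := by
      calc e' * A = ∫ x, max (t - ratio P Q x) 0 * A ∂Q := by rw [integral_mul_const, hneg]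
        _ ≤ ∫ x, (max (t - ratio P Q x) 0 * H + e' * (max (t - ratio P Q x) 0 * κ x)) ∂Q := by
            refine integral_mono_ae (iN.mul_const _)
              ((iN.mul_const _).add (iNk.const_mul _)) ?_
            filter_upwards [hB] with x hx
            have := mul_le_mul_of_nonneg_left (step x hx) (le_max_right (t - ratio P Q x) 0)
            linarith
        _ = _ := by
            rw [integral_add (iN.mul_const _) (iNk.const_mul _), integral_mul_const, hneg,
              integral_const_mul]
            ring
    have := le_of_mul_le_mul_left this he'0
    linarith

theorem real_bind (P : Measure X) [IsProbabilityMeasure P] (κ : Kernel X Y) [IsMarkovKernel κ]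
    {S : Set Y} (hS : MeasurableSet S) : (P.bind κ).real S = ∫ x, (κ x).real S ∂P := by
  rw [Measure.real, Measure.bind_apply hS κ.measurable.aemeasurable]
  exact (integral_toReal (κ.measurable_coe hS).aemeasurable
    (.of_forall fun x => measure_lt_top _ _)).symm

/-- The optimal set for the output pair pulls back to a test function on the inputs, to which
`integral_ratio_sub_mul_le` applies. -/
theorem hockeyStick_bind_le (h : P ≪ Q) {t : ℝ} (ht : 1 ≤ t) {B : Set X}
    (hB : ∀ᵐ x ∂Q, x ∈ B) (κ : Kernel X Y) [IsMarkovKernel κ] {H : ℝ} (hH : 0 ≤ H)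
    (hgap : ∀ S, MeasurableSet S → ∀ x ∈ B, ∀ y ∈ B,
      hockeyStick P Q t * (κ x).real S - (hockeyStick P Q t + (t - 1)) * (κ y).real S ≤ H) :
    hockeyStick (P.bind κ) (Q.bind κ) t ≤ H := by
  obtain ⟨S, hS, hSe⟩ := exists_real_sub_eq_hockeyStick (h.comp_right κ) t
  have hm : Measurable fun x => (κ x).real S := (κ.measurable_coe hS).ennreal_toReal
  have h0 : ∀ x, 0 ≤ (κ x).real S := fun x => measureReal_nonneg
  have h1 : ∀ x, (κ x).real S ≤ 1 := fun x => measureReal_le_one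
  have bdd : ∀ᵐ x ∂Q, ‖(κ x).real S‖ ≤ 1 := .of_forall fun x => by
    rw [Real.norm_of_nonneg (h0 x)]; exact h1 x
  have i1 : Integrable (fun x => ratio P Q x * (κ x).real S) Q :=
    (integrable_ratio P Q).mul_bdd hm.aestronglyMeasurable bdd
  have i2 : Integrable (fun x => t * (κ x).real S) Q :=
    (integrable_const t).mul_bdd hm.aestronglyMeasurable bdd
  have e1 : ∫ x, (κ x).real S ∂P = ∫ x, ratio P Q x * (κ x).real S ∂Q :=
    (integral_rnDeriv_smul (f := fun x => (κ x).real S) h).symm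
  rw [← hSe, real_bind P κ hS, real_bind Q κ hS, ← integral_const_mul, e1, ← integral_sub i1 i2]
  simp_rw [← sub_mul]
  exact integral_ratio_sub_mul_le h ht hB hm h0 h1 hH (hgap S hS)

end Averaging

theorem hockeyStick_bern_le {d : ℕ} (k : ℕ) {c : ℝ} (hc0 : 0 ≤ c) (hc : c < 1 / 2)
    {P Q : Measure (Cube d)} [IsProbabilityMeasure P] [IsProbabilityMeasure Q] (h : P ≪ Q)
    (hB : ∀ᵐ x ∂Q, ∀ i, (x i : ℝ) ∈ Set.Icc c (1 - c)) {t : ℝ} (ht : 1 ≤ t) :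
    hockeyStick (P.bind (bernKernel d k)) (Q.bind (bernKernel d k)) t ≤
      cornerGap d k c (hockeyStick P Q t) (hockeyStick P Q t + (t - 1)) := by
  classical
  refine hockeyStick_bind_le h ht (B := {x | ∀ i, (x i : ℝ) ∈ Set.Icc c (1 - c)}) hB _
    (cornerGap_nonneg d k c _ _) fun S _ x hx y hy => ?_
  change _ * (bernRuns k x).real S - _ * (bernRuns k y).real S ≤ _
  rw [real_bernRuns, real_bernRuns, Finset.mul_sum, Finset.mul_sum, ← Finset.sum_sub_distrib]
  exact sum_runWeight_sub_le hc0 hc hx hy _ _ _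

/-! ### Randomized response between two points. -/

/-- Randomized response between `x` and `y` with likelihood ratio `R`. -/
def randomizedResponse {X : Type*} [MeasurableSpace X] (R : ℝ) (x y : X) : Measure X :=
  ENNReal.ofReal (R / (1 + R)) • Measure.dirac x + ENNReal.ofReal (1 / (1 + R)) • Measure.dirac y

section RandomizedResponse

variable {X : Type*} [MeasurableSpace X] {R : ℝ}

theorem isProbabilityMeasure_randomizedResponse (hR : 1 ≤ R) (x y : X) :
    IsProbabilityMeasure (randomizedResponse R x y) := by
  refine ⟨?_⟩
  simp only [randomizedResponse, Measure.add_apply, Measure.smul_apply, measure_univ, smul_eq_mul,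
    mul_one]
  rw [← ENNReal.ofReal_add (by positivity) (by positivity), ← ENNReal.ofReal_one]
  congr 1
  field_simp
  ring

theorem integral_randomizedResponse (hR : 1 ≤ R) (x y : X) {F : X → ℝ}
    (hF : StronglyMeasurable F) : ∫ z, F z ∂(randomizedResponse R x y) =
      R / (1 + R) * F x + 1 / (1 + R) * F y := by
  have i : ∀ z : X, Integrable F (Measure.dirac z) := fun z => by
    refine ⟨hF.aestronglyMeasurable, ?_⟩
    rw [HasFiniteIntegral, lintegral_dirac' _ hF.measurable.enorm]
    exact enorm_lt_top
  rw [randomizedResponse, integral_add_measure ((i x).smul_measure ENNReal.ofReal_ne_top)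
    ((i y).smul_measure ENNReal.ofReal_ne_top), integral_smul_measure, integral_smul_measure,
    integral_dirac' _ _ hF, integral_dirac' _ _ hF, ENNReal.toReal_ofReal (by positivity),
    ENNReal.toReal_ofReal (by positivity), smul_eq_mul, smul_eq_mul]

theorem randomizedResponse_absolutelyContinuous (hR : 1 ≤ R) (x y : X) :
    randomizedResponse R x y ≪ randomizedResponse R y x := by
  have h1 : ENNReal.ofReal (R / (1 + R)) ≠ 0 := by
    rw [ENNReal.ofReal_ne_zero_iff]; positivity
  have h2 : ENNReal.ofReal (1 / (1 + R)) ≠ 0 := by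
    rw [ENNReal.ofReal_ne_zero_iff]; positivity
  intro s hs
  simp only [randomizedResponse, Measure.add_apply, Measure.smul_apply, smul_eq_mul, add_eq_zero,
    mul_eq_zero, h1, h2, false_or] at hs ⊢
  exact hs.symm

theorem randomizedResponse_eq_one (hR : 1 ≤ R) {x y : X} {s : Set X} (hx : x ∈ s) (hy : y ∈ s) :
    randomizedResponse R x y s = 1 := by
  have := isProbabilityMeasure_randomizedResponse hR x y
  rw [← measure_univ (μ := randomizedResponse R x y)]
  simp [randomizedResponse, Measure.dirac_apply_of_mem hx, Measure.dirac_apply_of_mem hy]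

theorem hockeyStick_randomizedResponse_le (hR : 1 ≤ R) (x y : X) {t : ℝ} (ht : 1 ≤ t) :
    hockeyStick (randomizedResponse R x y) (randomizedResponse R y x) t ≤ rrCurve R t := by
  have := isProbabilityMeasure_randomizedResponse hR x y
  have := isProbabilityMeasure_randomizedResponse hR y x
  obtain ⟨S, hS, hSe⟩ := exists_real_sub_eq_hockeyStick
    (randomizedResponse_absolutelyContinuous hR x y) t
  have hi : StronglyMeasurable (S.indicator (1 : X → ℝ)) := stronglyMeasurable_one.indicator hS
  rw [← hSe, ← integral_indicator_one hS, ← integral_indicator_one hS,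
    integral_randomizedResponse hR x y hi, integral_randomizedResponse hR y x hi]
  have b : ∀ z, 0 ≤ S.indicator (1 : X → ℝ) z ∧ S.indicator (1 : X → ℝ) z ≤ 1 := fun z => by
    by_cases hz : z ∈ S <;> simp [hz]
  set u := S.indicator (1 : X → ℝ) x
  set v := S.indicator (1 : X → ℝ) y
  have hR0 : 0 < 1 + R := by linarith
  rw [rrCurve, le_div_iff₀ hR0]
  have e : (R / (1 + R) * u + 1 / (1 + R) * v - t * (R / (1 + R) * v + 1 / (1 + R) * u)) * (1 + R) =
      (R - t) * u + (1 - t * R) * v := by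
    field_simp; ring
  rw [e]
  have h1 : (1 - t * R) * v ≤ 0 := mul_nonpos_of_nonpos_of_nonneg (by nlinarith) (b y).1
  have h2 : (R - t) * u ≤ max (R - t) 0 :=
    (mul_le_mul_of_nonneg_right (le_max_left _ 0) (b x).1).trans
      (mul_le_of_le_one_right (le_max_right _ _) (b x).2)
  linarith

/-- For `t ≤ R` the input difference is `rrCurve R t • δ_x - (rrCurve R t + (t - 1)) • δ_y`, so the
set of tables with nonnegative output difference gives the left side. For `t ≥ R` the left side is
zero. -/
theorem le_hockeyStick_randomizedResponse_bern (hR : 1 ≤ R) {d : ℕ} (k : ℕ) (x y : Cube d)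
    {t : ℝ} (ht : 1 ≤ t) :
    ∑ b : Fin k → Fin d → Bool, max (rrCurve R t * runWeight (fun i => (x i : ℝ)) b -
      (rrCurve R t + (t - 1)) * runWeight (fun i => (y i : ℝ)) b) 0 ≤
      hockeyStick ((randomizedResponse R x y).bind (bernKernel d k))
        ((randomizedResponse R y x).bind (bernKernel d k)) t := by
  classical
  have := isProbabilityMeasure_randomizedResponse hR x y
  have := isProbabilityMeasure_randomizedResponse hR y x
  have hac := (randomizedResponse_absolutelyContinuous hR x y).comp_right (bernKernel d k)
  have hw : ∀ (z : Cube d) (b : Fin k → Fin d → Bool), 0 ≤ runWeight (fun i => (z i : ℝ)) b :=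
    fun z b => runWeight_nonneg (fun i => (z i).2.1) (fun i => (z i).2.2) b
  rcases le_total t R with htR | htR
  · set S : Set (Fin k → Fin d → Bool) := {b | 0 ≤ rrCurve R t * runWeight (fun i => (x i : ℝ)) b -
      (rrCurve R t + (t - 1)) * runWeight (fun i => (y i : ℝ)) b} with hSdef
    have hS : MeasurableSet S := S.toFinite.measurableSet
    refine le_trans (le_of_eq ?_) (real_sub_le_hockeyStick hac t S)
    have hm : StronglyMeasurable fun z => (bernKernel d k z).real S :=
      ((bernKernel d k).measurable_coe hS).ennreal_toReal.stronglyMeasurable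
    rw [real_bind _ _ hS, real_bind _ _ hS, integral_randomizedResponse hR x y hm,
      integral_randomizedResponse hR y x hm]
    have hR0 : 0 < 1 + R := by linarith
    have hr : rrCurve R t = (R - t) / (1 + R) := by rw [rrCurve, max_eq_left (by linarith)]
    have e : R / (1 + R) * (bernKernel d k x).real S + 1 / (1 + R) * (bernKernel d k y).real S -
        t * (R / (1 + R) * (bernKernel d k y).real S + 1 / (1 + R) * (bernKernel d k x).real S) =
        rrCurve R t * (bernKernel d k x).real S -
          (rrCurve R t + (t - 1)) * (bernKernel d k y).real S := by
      rw [hr]; field_simp; ring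
    rw [e]
    change _ = _ * (bernRuns k x).real S - _ * (bernRuns k y).real S
    rw [real_bernRuns, real_bernRuns, Finset.mul_sum, Finset.mul_sum, ← Finset.sum_sub_distrib,
      Finset.sum_filter]
    refine Finset.sum_congr rfl fun b _ => ?_
    by_cases hb : b ∈ S
    · rw [if_pos hb, max_eq_left hb]
    · rw [if_neg hb, max_eq_right (not_le.1 hb).le]
  · have hr : rrCurve R t = 0 := by rw [rrCurve, max_eq_right (by linarith), zero_div]
    rw [Finset.sum_eq_zero fun b _ => ?_]
    · exact hockeyStick_nonneg _ _ _
    · rw [hr]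
      refine max_eq_right ?_
      have := mul_nonneg (by linarith : 0 ≤ t - 1) (hw y b)
      linarith

end RandomizedResponse

/-! ### Extremality of randomized response after Bernoulli post-processing. -/

theorem FiniteCost.sum {ι : Type*} {s : Finset ι} {α : ℝ} {F : ι → ℝ → ℝ}
    (hF : ∀ a ∈ s, FiniteCost α (F a)) : FiniteCost α fun t => ∑ a ∈ s, F a t := by
  constructor
  · simp only [Finset.mul_sum]; exact integrable_finsetSum _ fun a ha => (hF a ha).1
  · simp only [Finset.mul_sum]; exact integrable_finsetSum _ fun a ha => (hF a ha).2

theorem pairCost_sum {ι : Type*} {s : Finset ι} {α : ℝ} {F G : ι → ℝ → ℝ}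
    (hF : ∀ a ∈ s, FiniteCost α (F a)) (hG : ∀ a ∈ s, FiniteCost α (G a)) :
    pairCost α (fun t => ∑ a ∈ s, F a t) (fun t => ∑ a ∈ s, G a t) =
      ∑ a ∈ s, pairCost α (F a) (G a) := by
  simp only [pairCost, Finset.mul_sum]
  rw [integral_finsetSum _ fun a ha => (hF a ha).1, integral_finsetSum _ fun a ha => (hG a ha).2,
    Finset.sum_add_distrib]

theorem pairCost_nonneg {α : ℝ} {f g : ℝ → ℝ} (hf : ∀ t, 1 ≤ t → 0 ≤ f t)
    (hg : ∀ t, 1 ≤ t → 0 ≤ g t) : 0 ≤ pairCost α f g :=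
  add_nonneg (setIntegral_nonneg measurableSet_Ioi fun t ht =>
      mul_nonneg (Real.rpow_nonneg (by linarith [Set.mem_Ioi.1 ht]) _) (hf t (le_of_lt ht)))
    (setIntegral_nonneg measurableSet_Ioi fun t ht =>
      mul_nonneg (Real.rpow_nonneg (by linarith [Set.mem_Ioi.1 ht]) _) (hg t (le_of_lt ht)))

theorem FiniteCost.sum_tilt {d k : ℕ} {α c : ℝ} (hc0 : 0 ≤ c) (hc : c < 1 / 2) {f : ℝ → ℝ}
    (hf : FiniteCost α f) (hfc : ContinuousOn f (Set.Ici 1)) (h0 : ∀ t, 1 ≤ t → 0 ≤ f t)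
    (a : Fin k → Fin d → Bool) :
    FiniteCost α fun t => tableGap c a * BernPost.tilt f (tableSlope c a) t :=
  (hf.tilt hfc h0 (tableSlope_nonneg hc0 hc a)).const_mul _

theorem curveCost_sum_tilt {d k : ℕ} {α c : ℝ} (hc0 : 0 ≤ c) (hc : c < 1 / 2) {f g : ℝ → ℝ}
    (hf : FiniteCost α f) (hg : FiniteCost α g) (hfc : ContinuousOn f (Set.Ici 1))
    (hgc : ContinuousOn g (Set.Ici 1)) (hf0 : ∀ t, 1 ≤ t → 0 ≤ f t) (hg0 : ∀ t, 1 ≤ t → 0 ≤ g t) :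
    curveCost α (fun t => ∑ a : Fin k → Fin d → Bool, tableGap c a * tilt f (tableSlope c a) t)
        (fun t => ∑ a : Fin k → Fin d → Bool, tableGap c a * tilt g (tableSlope c a) t) =
      ENNReal.ofReal (∑ a : Fin k → Fin d → Bool, tableGap c a *
        pairCost α (tilt f (tableSlope c a)) (tilt g (tableSlope c a))) := by
  have nn : ∀ (F : ℝ → ℝ) (t : ℝ), 0 ≤ ∑ a : Fin k → Fin d → Bool,
      tableGap c a * tilt F (tableSlope c a) t := fun F t =>
    Finset.sum_nonneg fun a _ => mul_nonneg (tableGap_nonneg c a) (tilt_nonneg _ _ _)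
  rw [curveCost_eq_ofReal (FiniteCost.sum fun a _ => hf.sum_tilt hc0 hc hfc hf0 a)
    (FiniteCost.sum fun a _ => hg.sum_tilt hc0 hc hgc hg0 a) (fun t _ => nn f t) fun t _ => nn g t,
    pairCost_sum (fun a _ => hf.sum_tilt hc0 hc hfc hf0 a)
      fun a _ => hg.sum_tilt hc0 hc hgc hg0 a]
  simp only [pairCost_const_mul]

/-- The corner `(p, …, p)` of the cube. -/
def diagonalPoint (d : ℕ) (p : unitInterval) : Cube d := fun _ => p

/-- Among the input pairs in `[c, 1 - c]^d`, randomized response between the extreme corners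
maximizes the moment of the output pair. -/
theorem curveCost_bern_le {d : ℕ} (k : ℕ) {c : ℝ} (hc0 : 0 ≤ c) (hc : c < 1 / 2) {α R : ℝ}
    (hα : 1 < α) (hR : 1 ≤ R) {P Q : Measure (Cube d)} [IsProbabilityMeasure P]
    [IsProbabilityMeasure Q] (h : P ≪ Q) (h' : Q ≪ P)
    (hQ : ∀ᵐ x ∂Q, ∀ i, (x i : ℝ) ∈ Set.Icc c (1 - c))
    (hPQ : curveCost α (hockeyStick P Q) (revHockeyStick P Q) ≤
      curveCost α (rrCurve R) (rrCurve R))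
    (hQP : curveCost α (hockeyStick Q P) (revHockeyStick Q P) ≤
      curveCost α (rrCurve R) (rrCurve R)) {p q : unitInterval} (hp : (p : ℝ) = 1 - c)
    (hq : (q : ℝ) = c) {P' Q' : Measure (Cube d)}
    (hP' : P' = randomizedResponse R (diagonalPoint d p) (diagonalPoint d q))
    (hQ' : Q' = randomizedResponse R (diagonalPoint d q) (diagonalPoint d p)) :
    curveCost α (hockeyStick (P.bind (bernKernel d k)) (Q.bind (bernKernel d k)))
        (revHockeyStick (P.bind (bernKernel d k)) (Q.bind (bernKernel d k))) ≤
      curveCost α (hockeyStick (P'.bind (bernKernel d k)) (Q'.bind (bernKernel d k)))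
        (revHockeyStick (P'.bind (bernKernel d k)) (Q'.bind (bernKernel d k))) := by
  set f := hockeyStick P Q with hf
  set g := revHockeyStick P Q with hg
  have e1 : hockeyStick Q P = g := funext fun t => hockeyStick_swap h h' t
  have e2 : revHockeyStick Q P = f := funext fun t => (hockeyStick_swap h' h t).symm
  rw [e1, e2] at hQP
  have hrr := curveCost_rrCurve (α := α) hR
  have hf0 : ∀ t, 1 ≤ t → 0 ≤ f t := fun t _ => hockeyStick_nonneg P Q t
  have hg0 : ∀ t, 1 ≤ t → 0 ≤ g t := fun t _ => revHockeyStick_nonneg P Q t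
  have hr0 : ∀ t, 1 ≤ t → 0 ≤ rrCurve R t := fun t _ => rrCurve_nonneg hR t
  have hfc : ContinuousOn f (Set.Ici 1) := continuous_hockeyStick.continuousOn
  have hgc : ContinuousOn g (Set.Ici 1) := continuous_revHockeyStick.continuousOn
  have hrc : ContinuousOn (rrCurve R) (Set.Ici 1) := (continuous_rrCurve R).continuousOn
  have hne : curveCost α (rrCurve R) (rrCurve R) ≠ ∞ := by rw [hrr]; exact ENNReal.ofReal_ne_top
  obtain ⟨hff, hgf⟩ := finiteCost_of_curveCost_ne_top hfc hgc hf0 hg0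
    (ne_top_of_le_ne_top hne hPQ) (ne_top_of_le_ne_top hne hQP)
  have hrf := finiteCost_rrCurve α R
  rw [hrr, curveCost_eq_ofReal hff hgf hf0 hg0,
    ENNReal.ofReal_le_ofReal_iff (pairCost_nonneg hr0 hr0)] at hPQ
  rw [hrr, curveCost_eq_ofReal hgf hff hg0 hf0,
    ENNReal.ofReal_le_ofReal_iff (pairCost_nonneg hr0 hr0)] at hQP
  have hP := h.ae_le hQ
  have hprob' : IsProbabilityMeasure P' := hP' ▸ isProbabilityMeasure_randomizedResponse hR _ _
  have hprob'' : IsProbabilityMeasure Q' := hQ' ▸ isProbabilityMeasure_randomizedResponse hR _ _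
  have hac : P' ≪ Q' := by rw [hP', hQ']; exact randomizedResponse_absolutelyContinuous hR _ _
  have hac' : Q' ≪ P' := by rw [hP', hQ']; exact randomizedResponse_absolutelyContinuous hR _ _
  calc _ ≤ curveCost α
        (fun t => ∑ a : Fin k → Fin d → Bool, tableGap c a * tilt f (tableSlope c a) t)
        (fun t => ∑ a : Fin k → Fin d → Bool, tableGap c a * tilt g (tableSlope c a) t) := by
        refine curveCost_mono (fun t ht => ?_) fun t ht => ?_
        · rw [← cornerGap_eq hc0 hc f (hf0 t ht.le) ht.le]
          exact hockeyStick_bern_le k hc0 hc h hQ ht.le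
        · rw [← cornerGap_eq hc0 hc g (hg0 t ht.le) ht.le,
            ← hockeyStick_swap (h.comp_right _) (h'.comp_right _), ← e1]
          exact hockeyStick_bern_le k hc0 hc h' hP ht.le
    _ ≤ curveCost α
        (fun t => ∑ a : Fin k → Fin d → Bool, tableGap c a * tilt (rrCurve R) (tableSlope c a) t)
        (fun t => ∑ a : Fin k → Fin d → Bool,
          tableGap c a * tilt (rrCurve R) (tableSlope c a) t) := by
        rw [curveCost_sum_tilt hc0 hc hff hgf hfc hgc hf0 hg0,
          curveCost_sum_tilt hc0 hc hrf hrf hrc hrc hr0 hr0]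
        refine ENNReal.ofReal_le_ofReal (Finset.sum_le_sum fun a _ => ?_)
        exact mul_le_mul_of_nonneg_left ((hockeyPair h).pairCost_tilt_le hα hR hfc hgc
          (antitone_hockeyStick.antitoneOn _) (antitone_revHockeyStick.antitoneOn _) hff hgf hPQ hQP
          (tableSlope_nonneg hc0 hc a)) (tableGap_nonneg c a)
    _ ≤ _ := by
        refine curveCost_mono (fun t ht => ?_) fun t ht => ?_
        · rw [← cornerGap_eq hc0 hc (rrCurve R) (hr0 t ht.le) ht.le, hP', hQ']
          refine le_trans (le_of_eq ?_) (le_hockeyStick_randomizedResponse_bern hR k _ _ ht.le)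
          simp only [cornerGap, diagonalPoint, hp, hq]
        · rw [← cornerGap_eq hc0 hc (rrCurve R) (hr0 t ht.le) ht.le,
            ← hockeyStick_swap (hac.comp_right _) (hac'.comp_right _), hP', hQ']
          refine le_trans (le_of_eq ?_) (le_hockeyStick_randomizedResponse_bern hR k _ _ ht.le)
          rw [← cornerGap_swap]
          simp only [diagonalPoint, hp, hq]

/-! ### Matching the likelihood ratio to the Rényi budget. -/

theorem one_add_pairCost_rrCurve {α R : ℝ} (hα : 1 < α) (hR : 1 ≤ R) :
    1 + α * (α - 1) * pairCost α (rrCurve R) (rrCurve R) = (R ^ α + R ^ (1 - α)) / (1 + R) := by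
  have hR0 : 0 < R := by linarith
  rw [pairCost_rrCurve hα hR, kappaMoment, kappaMoment, show α - 2 + 2 = α by ring,
    show α - 2 + 1 = α - 1 by ring, show -α - 1 + 2 = 1 - α by ring, show -α - 1 + 1 = -α by ring]
  have h1 : α - 1 ≠ 0 := by linarith
  have h2 : 1 - α ≠ 0 := by linarith
  have h3 : α ≠ 0 := by linarith
  have h4 : 1 + R ≠ 0 := by linarith
  have h5 : (1 - α) = -(α - 1) := by ring
  generalize R ^ α = A
  generalize R ^ (1 - α) = B
  rw [h5]
  field_simp
  ring

theorem exists_randomizedResponse_ratio {α N : ℝ} (hα : 1 < α) (hN : 1 ≤ N) :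
    ∃ R, 1 ≤ R ∧ 1 + α * (α - 1) * pairCost α (rrCurve R) (rrCurve R) = N := by
  have hα1 : 0 < α - 1 := by linarith
  -- With `b ^ (α - 1) = 2 * N` and `1 + b ≤ 2 * b`, the moment at `b` is at least `N`, while at `1`
  -- it is `1 ≤ N`.
  set b := (2 * N) ^ (α - 1)⁻¹ with hb
  have hb1 : 1 ≤ b := Real.one_le_rpow (by linarith) (inv_nonneg.2 hα1.le)
  have hbp : b ^ (α - 1) = 2 * N := Real.rpow_inv_rpow (by linarith) hα1.ne'
  have hcont : ContinuousOn (fun R : ℝ => (R ^ α + R ^ (1 - α)) / (1 + R)) (Set.Icc 1 b) := by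
    refine ContinuousOn.div ?_ (by fun_prop) fun R hR => by linarith [hR.1]
    exact ((continuousOn_rpow_Ici α).add (continuousOn_rpow_Ici (1 - α))).mono fun R hR => hR.1
  have hmem : N ∈ Set.Icc ((fun R : ℝ => (R ^ α + R ^ (1 - α)) / (1 + R)) 1)
      ((fun R : ℝ => (R ^ α + R ^ (1 - α)) / (1 + R)) b) := by
    constructor
    · simp only [Real.one_rpow]; linarith
    · simp only
      have hb0 : 0 < b := by linarith
      have e : b ^ α = b * (2 * N) := by
        rw [← hbp, Real.rpow_sub hb0, Real.rpow_one]; field_simp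
      rw [le_div_iff₀ (by linarith), e]
      have : 0 ≤ b ^ (1 - α) := Real.rpow_nonneg hb0.le _
      nlinarith
  obtain ⟨R, hR, hRN⟩ := intermediate_value_Icc hb1 hcont hmem
  exact ⟨R, hR.1, by rw [one_add_pairCost_rrCurve hα hR.1]; exact hRN⟩

section Renyi

variable {X : Type*} [MeasurableSpace X] {α : ℝ} {P Q : ProbabilityMeasure X}

theorem absolutelyContinuous_of_renyiDiv_le {ε : ℝ} (h : renyiDiv α P Q ≤ (ε : EReal)) :
    (P : Measure X) ≪ Q := by
  by_contra hac
  rw [renyiDiv, if_neg hac, top_le_iff] at h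
  exact EReal.coe_ne_top ε h

theorem renyiDiv_le_iff (hα : 1 < α) (hac : (P : Measure X) ≪ Q) (ε : ℝ) :
    renyiDiv α P Q ≤ (ε : EReal) ↔
      ∫⁻ x, ((P : Measure X).rnDeriv (Q : Measure X) x) ^ α ∂(Q : Measure X) ≤
        ENNReal.ofReal (Real.exp ((α - 1) * ε)) := by
  have hα1 : 0 < α - 1 := by linarith
  rw [renyiDiv, if_pos hac, ← ENNReal.log_le_log_iff, ENNReal.log_ofReal_of_pos (Real.exp_pos _),
    Real.log_exp]
  set L := ENNReal.log (∫⁻ x, ((P : Measure X).rnDeriv (Q : Measure X) x) ^ α ∂(Q : Measure X))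
  have hp : (0 : EReal) ≤ ((α - 1 : ℝ) : EReal) := EReal.coe_nonneg.2 hα1.le
  have hp' : (0 : EReal) ≤ (((α - 1)⁻¹ : ℝ) : EReal) := EReal.coe_nonneg.2 (inv_pos.2 hα1).le
  constructor
  · intro h
    have := mul_le_mul_of_nonneg_left h hp
    rwa [← mul_assoc, ← EReal.coe_mul, mul_inv_cancel₀ hα1.ne', EReal.coe_one, one_mul,
      ← EReal.coe_mul] at this
  · intro h
    have := mul_le_mul_of_nonneg_left h hp'
    rwa [← EReal.coe_mul, inv_mul_cancel_left₀ hα1.ne'] at this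

theorem renyiDiv_le_renyiDiv {X' : Type*} [MeasurableSpace X'] {P' Q' : ProbabilityMeasure X'}
    (hα : 1 < α) (hac : (P : Measure X) ≪ Q) (hac' : (P' : Measure X') ≪ Q')
    (h : ∫⁻ x, ((P : Measure X).rnDeriv (Q : Measure X) x) ^ α ∂(Q : Measure X) ≤
      ∫⁻ x, ((P' : Measure X').rnDeriv (Q' : Measure X') x) ^ α ∂(Q' : Measure X')) :
    renyiDiv α P Q ≤ renyiDiv α P' Q' := by
  rw [renyiDiv, renyiDiv, if_pos hac, if_pos hac']
  exact mul_le_mul_of_nonneg_left (ENNReal.log_le_log_iff.2 h)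
    (EReal.coe_nonneg.2 (inv_nonneg.2 (by linarith)))

theorem renyiDiv_self (α : ℝ) (P : ProbabilityMeasure X) : renyiDiv α P P = 0 := by
  have : ∫⁻ x, ((P : Measure X).rnDeriv (P : Measure X) x) ^ α ∂(P : Measure X) = 1 := by
    rw [lintegral_congr_ae (g := fun _ => 1)]
    · simp
    · filter_upwards [Measure.rnDeriv_self (P : Measure X)] with x hx
      rw [hx, ENNReal.one_rpow]
  rw [renyiDiv, if_pos Measure.AbsolutelyContinuous.rfl, this, ENNReal.log_one, mul_zero]

/-- Both sides bound the same moment: `hN` says that the affine formula of `moment_eq`, at the cost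
of `rrCurve R`, gives exactly the budget. -/
theorem renyiDiv_le_iff_curveCost_le (hα : 1 < α) (hac : (P : Measure X) ≪ Q)
    (hac' : (Q : Measure X) ≪ P) {ε R : ℝ} (hR : 1 ≤ R)
    (hN : 1 + α * (α - 1) * pairCost α (rrCurve R) (rrCurve R) = Real.exp ((α - 1) * ε)) :
    renyiDiv α P Q ≤ (ε : EReal) ↔
      curveCost α (hockeyStick (P : Measure X) Q) (revHockeyStick (P : Measure X) Q) ≤
        curveCost α (rrCurve R) (rrCurve R) := by
  have hα1 : 0 < α - 1 := by linarith
  have hk : 0 < α * (α - 1) := mul_pos (by linarith) hα1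
  have hr0 : ∀ t, 1 ≤ t → 0 ≤ rrCurve R t := fun t _ => rrCurve_nonneg hR t
  have hkey : ENNReal.ofReal (Real.exp ((α - 1) * ε)) + ENNReal.ofReal (α - 1) = ENNReal.ofReal α +
      ENNReal.ofReal (α * (α - 1)) * curveCost α (rrCurve R) (rrCurve R) := by
    have := pairCost_nonneg (α := α) hr0 hr0
    rw [curveCost_rrCurve hR, ← ENNReal.ofReal_mul hk.le, ← hN,
      ← ENNReal.ofReal_add (by positivity) hα1.le,
      ← ENNReal.ofReal_add (by linarith) (by positivity)]
    congr 1; ring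
  rw [renyiDiv_le_iff hα hac, ← ENNReal.add_le_add_iff_right (ENNReal.ofReal_ne_top (r := α - 1)),
    moment_eq hac hac' hα, hkey, ENNReal.add_le_add_iff_left ENNReal.ofReal_ne_top,
    ENNReal.mul_le_mul_iff_right (ENNReal.ofReal_ne_zero_iff.2 hk) ENNReal.ofReal_ne_top]

end Renyi

/-! ### The extremal corner pair and the theorem. -/

theorem cornerDistributions_ae {d : ℕ} {c : ℝ} (hc : c < 1 / 2) {P : ProbabilityMeasure (Cube d)}
    (hP : P ∈ cornerDistributions d c) :
    (P : Measure (Cube d)) {x | ∀ i, (x i : ℝ) ∈ Set.Icc c (1 - c)} = 1 := by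
  refine le_antisymm prob_le_one ?_
  rw [← show (P : Measure (Cube d)) {x | ∀ i, (x i : ℝ) = c ∨ (x i : ℝ) = 1 - c} = 1 from hP]
  refine measure_mono fun x hx i => ?_
  rcases hx i with h | h <;> rw [h] <;> constructor <;> linarith

theorem ae_mem_box {d : ℕ} {c : ℝ} {P : Measure (Cube d)} [IsProbabilityMeasure P]
    (hP : P {x | ∀ i, (x i : ℝ) ∈ Set.Icc c (1 - c)} = 1) :
    ∀ᵐ x ∂P, ∀ i, (x i : ℝ) ∈ Set.Icc c (1 - c) := by
  have hm : MeasurableSet {x : Cube d | ∀ i, (x i : ℝ) ∈ Set.Icc c (1 - c)} := by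
    rw [Set.ofPred_forall]
    refine MeasurableSet.iInter fun i => ?_
    exact (measurable_subtype_coe.comp (measurable_pi_apply i)) measurableSet_Icc
  exact (mem_ae_iff_prob_eq_one hm).2 hP

/-- The corner pair that bounds the Rényi divergence after Bernoulli post-processing. -/
theorem exists_corner_pair {d : ℕ} (k : ℕ) {c : ℝ} (hc0 : 0 ≤ c) (hc : c < 1 / 2) {α ε : ℝ}
    (hα : 1 < α) (hε : 0 ≤ ε) :
    ∃ P' Q' : ProbabilityMeasure (Cube d), P' ∈ cornerDistributions d c ∧
      Q' ∈ cornerDistributions d c ∧ renyiDiv α P' Q' ≤ (ε : EReal) ∧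
      renyiDiv α Q' P' ≤ (ε : EReal) ∧ ∀ P Q : ProbabilityMeasure (Cube d),
        (Q : Measure (Cube d)) {x | ∀ i, (x i : ℝ) ∈ Set.Icc c (1 - c)} = 1 →
        renyiDiv α P Q ≤ (ε : EReal) → renyiDiv α Q P ≤ (ε : EReal) →
        renyiDiv α (bernProcess k P) (bernProcess k Q) ≤
          renyiDiv α (bernProcess k P') (bernProcess k Q') := by
  obtain ⟨R, hR, hN⟩ := exists_randomizedResponse_ratio hα
    (Real.one_le_exp (mul_nonneg (by linarith : 0 ≤ α - 1) hε))
  set p : unitInterval := ⟨1 - c, by linarith, by linarith⟩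
  set q : unitInterval := ⟨c, by linarith, by linarith⟩
  set x := diagonalPoint d p
  set y := diagonalPoint d q
  set P' : ProbabilityMeasure (Cube d) :=
    ⟨randomizedResponse R x y, isProbabilityMeasure_randomizedResponse hR _ _⟩
  set Q' : ProbabilityMeasure (Cube d) :=
    ⟨randomizedResponse R y x, isProbabilityMeasure_randomizedResponse hR _ _⟩
  have hx : x ∈ {x : Cube d | ∀ i, (x i : ℝ) = c ∨ (x i : ℝ) = 1 - c} := fun _ => Or.inr rfl
  have hy : y ∈ {x : Cube d | ∀ i, (x i : ℝ) = c ∨ (x i : ℝ) = 1 - c} := fun _ => Or.inl rfl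
  have hac : (P' : Measure (Cube d)) ≪ Q' := randomizedResponse_absolutelyContinuous hR x y
  have hac' : (Q' : Measure (Cube d)) ≪ P' := randomizedResponse_absolutelyContinuous hR y x
  have hle : ∀ t, 1 < t → hockeyStick (P' : Measure (Cube d)) Q' t ≤ rrCurve R t :=
    fun t ht => hockeyStick_randomizedResponse_le hR x y ht.le
  have hle' : ∀ t, 1 < t → hockeyStick (Q' : Measure (Cube d)) P' t ≤ rrCurve R t :=
    fun t ht => hockeyStick_randomizedResponse_le hR y x ht.le
  refine ⟨P', Q', randomizedResponse_eq_one hR hx hy, randomizedResponse_eq_one hR hy hx, ?_, ?_, ?_⟩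
  · rw [renyiDiv_le_iff_curveCost_le hα hac hac' hR hN]
    exact curveCost_mono hle fun t ht => (hockeyStick_swap hac hac' t).symm.trans_le (hle' t ht)
  · rw [renyiDiv_le_iff_curveCost_le hα hac' hac hR hN]
    exact curveCost_mono hle' fun t ht => (hockeyStick_swap hac' hac t).symm.trans_le (hle t ht)
  · intro P Q hQ h1 h2
    have h := absolutelyContinuous_of_renyiDiv_le h1
    have h' := absolutelyContinuous_of_renyiDiv_le h2
    rw [renyiDiv_le_iff_curveCost_le hα h h' hR hN] at h1
    rw [renyiDiv_le_iff_curveCost_le hα h' h hR hN] at h2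
    have hb : ∀ {P Q : ProbabilityMeasure (Cube d)}, (P : Measure (Cube d)) ≪ Q →
        (bernProcess k P : Measure (Fin k → Fin d → Bool)) ≪ bernProcess k Q :=
      fun h => h.comp_right (bernKernel d k)
    refine renyiDiv_le_renyiDiv hα (hb h) (hb hac) ?_
    refine moment_le_moment (hb h) (hb h') (hb hac) (hb hac') hα ?_
    exact curveCost_bern_le k hc0 hc hα hR h h' (ae_mem_box hQ) h1 h2 (p := p) (q := q) rfl rfl
      rfl rfl

end BernPost

end

theorem theorem3 {DB : Type*} (Adj : DB → DB → Prop) (hsymm : ∀ D D' : DB, Adj D D' → Adj D' D)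
    (hadj : ∃ D D' : DB, D ≠ D' ∧ Adj D D')
    (d k : ℕ) (c : ℝ) (hc0 : 0 ≤ c) (hc : c < 1 / 2)
    (α : ℝ) (hα : 1 < α) (ε : ℝ) (hε : 0 ≤ ε) :
    BernPost.post Adj (BernPost.boundedAlgorithms DB d c) α k ε =
      ⨆ (P : ProbabilityMeasure (BernPost.Cube d))
        (Q : ProbabilityMeasure (BernPost.Cube d))
        (_ : P ∈ BernPost.cornerDistributions d c ∧ Q ∈ BernPost.cornerDistributions d c ∧
          BernPost.renyiDiv α P Q ≤ (ε : EReal) ∧ BernPost.renyiDiv α Q P ≤ (ε : EReal)),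
        BernPost.renyiDiv α (BernPost.bernProcess k P) (BernPost.bernProcess k Q) := by
  classical
  apply le_antisymm
  · refine iSup₂_le fun A hA => iSup₂_le fun D D' => iSup_le fun hD => ?_
    obtain ⟨P', Q', hP', hQ', h1, h2, hmax⟩ :=
      BernPost.exists_corner_pair (d := d) k hc0 hc hα hε
    have hlev : ∀ E E', Adj E E' → BernPost.renyiDiv α (A E) (A E') ≤ (ε : EReal) :=
      fun E E' hE => by
        have h := hA.2
        simp only [BernPost.rdpLevel, iSup_le_iff] at h
        exact h E E' hE
    refine (hmax (A D) (A D') (hA.1 D') (hlev _ _ hD) (hlev _ _ (hsymm _ _ hD))).trans ?_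
    exact le_iSup₂_of_le P' Q' (le_iSup_of_le ⟨hP', hQ', h1, h2⟩ le_rfl)
  · refine iSup₂_le fun P Q => iSup_le fun ⟨hP, hQ, h1, h2⟩ => ?_
    obtain ⟨D, D', hne, hD⟩ := hadj
    -- Only `P` and `Q` occur as outputs, so every neighbouring pair sees divergence zero or one of
    -- the two bounded by `ε`.
    set A : BernPost.Algorithm DB (BernPost.Cube d) := fun E => if E = D then P else Q with hA
    have hAD : A D = P := if_pos rfl
    have hAD' : A D' = Q := if_neg hne.symm
    have hε' : (0 : EReal) ≤ (ε : EReal) := EReal.coe_nonneg.2 hε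
    have hmem : A ∈ BernPost.boundedAlgorithms DB d c := fun E => by
      simp only [hA]
      split_ifs
      · exact BernPost.cornerDistributions_ae hc hP
      · exact BernPost.cornerDistributions_ae hc hQ
    have hlev : BernPost.rdpLevel Adj α A ≤ (ε : EReal) := by
      refine iSup₂_le fun E E' => iSup_le fun _ => ?_
      simp only [hA]
      split_ifs
      · rwa [BernPost.renyiDiv_self]
      · exact h1
      · exact h2
      · rwa [BernPost.renyiDiv_self]
    refine le_iSup₂_of_le A ⟨hmem, hlev⟩ (le_iSup₂_of_le D D' (le_iSup_of_le hD ?_))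
    simp only [hAD, hAD', le_refl]
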